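/- **Setting.** Let $\Pi=\{1,\dots,n\}$ be the set of locations and $0\le f<n$. Let $D$ be a strong-sampling asynchronous failure detector (AFD): its inputs are the crash actions $\mathrm{crash}_i$, its outputs $O_D=\bigcup_i O_{D,i}$ occur at locations, it is solved by some I/O automaton, and its set $T_D$ of traces contains only valid sequences (no outputs at $i$ after $\mathrm{crash}_i$, infinitely many outputs at every location that does not crash) and is closed under sampling, constrained reordering, crash extension, extra crashes, and strong sampling (every valid subsequence of a trace is a trace). Let $A$ be a distributed algorithm, that is, one I/O automaton $A_i$ per location, deterministic with a single task, permanently disabled by $\mathrm{crash}_i$, and assume that $A$ solves $f$-crash-tolerant binary consensus using $D$: in every fair trace of the composition of $A$, the reliable FIFO channels, the consensus environment (which at each location $i$ has a task $Env_{i,v}$ for proposing $v$, $v\in\{0,1\}$) and the crash automaton whose projection on the actions of $D$ lies in $T_D$, the projection on the actions of consensus satisfies the specification of $f$-crash-tolerant binary consensus. Let $\mathcal S$ be the composition of $A$, the channels and the environment. **Observations.** An observation $G$ of $D$ is a directed acyclic graph whose vertices are triples $(i,k,e)$ with $i\in\Pi$, $k\ge1$, $e\in O_{D,i}$, such that: for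 each $(i,k)$ there is at most one vertex $(i,k,\ast)$; if there is a vertex $(i,k,\ast)$, there is a vertex $(i,k',\ast)$ for every $1\le k'<k$; there is an edge from $(i,k,\ast)$ to $(i,k+1,\ast)$ whenever both exist; the edge relation is transitive; and if there are infinitely many vertices with location $j$, then every vertex with a location $i\ne j$ has an edge to some vertex with location $j$. A location $i$ is live in $G$ if infinitely many vertices have location $i$. $G$ is viable for $D$ if the sequence of actions $e$ along some topological ordering of the vertices of $G$ is the projection on $O_D$ of some $t_D\in T_D$. An observation $G'$ is a prefix of $G$ if it is a subgraph of $G$ and every vertex of $G'$ has the same incoming edges in $G'$ as in $G$. A sequence $G_1,G_2,\dots$ of finite observations, each a prefix of the next, converges to $G$ if $G=\bigcup_x G_x$ (union of the vertex sets and of the edge sets). **Execution tree.** For an observation $G$ with vertex set $V$, the tree $\mathcal R^G$ is the following rooted tree of depth $|V|$. Nodes carry a configuration (a state of $\mathcal S$) and a vertex tag; the root $\top$ carries the (fixed) start state and the tag $(\bot,0,\bot)$. Call $i$ active at a node with tag $v$ if some vertex of $G$ with location $i$ follows $v$ (is the head of an edge from $v$; every vertex follows $(\bot,0,\bot)$).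 The labels are the tasks $Proc_i$, $Env_{i,v}$, $Chan_{i,j}$ ($i\neq j$) of $\mathcal S$ and $FD_i$, $i\in\Pi$. From every internal node $N$ with tag $v$ there is, for each label other than the $FD_i$, exactly one edge; its lower endpoint has tag $v$, and its action tag is the action of this task that is enabled in the configuration of $N$, or $\bot$ if there is none or if the label is $Proc_i$ or $Env_{i,\ast}$ and $i$ is not active. For each $i$ that is active there is one $FD_i$-edge for each vertex $(i,k,e)$ following $v$, with vertex tag $(i,k,e)$ and action tag $e$; for each inactive $i$ there is a single $FD_i$-edge, with vertex tag $v$ and action tag $\bot$. The configuration of the lower endpoint results from applying the action tag. A node is determined by the labels and vertex tags of the edges on the path from $\top$ to it; this identifies nodes, edges and gadgets of the trees of different observations. A node is non-$\bot$ if no edge on the path from $\top$ to it has action tag $\bot$. For $v\in\{0,1\}$, a node is $v$-valent if $v$, but not $1-v$, is a decision value on the path from $\top$ to some descendant (the node itself included); it is bivalent if both $0$ and $1$ are. **Gadgets.** A gadget of $\mathcal R^G$ is either a tuple $(N,l,E^l,E'^l)$, where $E^l,E'^l$ are $l$-edges of the node $N$, or a tuple $(N,l,r,E^l,E^r,E^{rl})$,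 where $l\ne r$, $E^l$ is an $l$-edge of $N$, $E^r$ is an $r$-edge of $N$ and $E^{rl}$ is an $l$-edge of the lower endpoint of $E^r$. It is a decision gadget if $N$ is bivalent and, respectively, (fork) the lower endpoints of $E^l$ and $E'^l$ are $v$-valent and $(1-v)$-valent for some $v$, or (hook) the lower endpoints of $E^l$ and $E^{rl}$ are $v$-valent and $(1-v)$-valent for some $v$ and the action tag of $E^r$ is not $\bot$. It is non-$\bot$ if $N$ is non-$\bot$. **Metric.** Number the labels by $m(l)=1,\dots,n^2+3n$ in the order $Proc_1,\dots,Proc_n$, $Env_{1,0},Env_{1,1},\dots,Env_{n,0},Env_{n,1}$, the $Chan_{i,j}$ lexicographically in $(i,j)$, $FD_1,\dots,FD_n$. Put $m(i,k,e)=kn+i$, $m(\bot,0,\bot)=0$, and, for an edge $E$ with label $l_E$ and vertex tag $v_E$, $m(E)=(m(v_E),m(l_E))$. For a node $N$ at depth $d$ whose tag has index $k$ and whose path from $\top$ has the edges $E_1,\dots,E_d$, put $m(N)=(d+k,m(E_1),\dots,m(E_d))$; all these values are compared lexicographically, a proper initial segment being smaller. Let $rank_G(N)$ be the number of nodes of $\mathcal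 R^G$ with a smaller metric value than $N$. The metric value of a gadget of $\mathcal R^G$ is $\langle rank_G(N),\langle rank_G(N^l),rank_G(N')\rangle\rangle$, where $N^l$ is the lower endpoint of $E^l$, $N'$ is the lower endpoint of $E'^l$ or of $E^{rl}$, respectively, and $\langle a,b\rangle=\frac12(a+b)(a+b+1)+b$ is the Cantor pairing function. The first non-$\bot$ decision gadget of $\mathcal R^G$ is the non-$\bot$ decision gadget of $\mathcal R^G$ whose metric value is strictly smaller than that of every other non-$\bot$ decision gadget of $\mathcal R^G$. **Theorem.** Let $G$ be an observation that is viable for $D$ and in which at most $f$ locations are not live. Then $\mathcal R^G$ has a first non-$\bot$ decision gadget $Y_{min}$. Moreover, for every sequence $G_1,G_2,\dots$ of finite observations, each a prefix of the next, that converges to $G$, there is a positive integer $x$ such that for all $x'\ge x$, $Y_{min}$ is the first non-$\bot$ decision gadget of $\mathcal R^{G_{x'}}$. -/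

import Mathlib

universe u

namespace CHT

open Classical in
/-- The subsequence of `t` formed by the events at the positions that satisfy `p`: its `m`-th event
is the event of `t` at the position `k` that satisfies `p` and is preceded by exactly `m` such
positions. -/
noncomputable def select {α : Type u} (t : Stream'.Seq α) (p : ℕ → Prop) : Stream'.Seq α :=
  ⟨fun m => if h : ∃ k, (p k ∧ (t.get? k).isSome) ∧
        Nat.count (fun k => p k ∧ (t.get? k).isSome) k = m
      then t.get? h.choose else none, by
    intro m hm
    have key : ∀ k, m < Nat.count (fun k => p k ∧ (t.get? k).isSome) k →
        ∃ k', (p k' ∧ (t.get? k').isSome) ∧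
          Nat.count (fun k => p k ∧ (t.get? k).isSome) k' = m := by
      intro k
      induction k with
      | zero => intro h; simp at h
      | succ k ih =>
        intro h
        by_cases hlt : m < Nat.count (fun k => p k ∧ (t.get? k).isSome) k
        · exact ih hlt
        · rw [Nat.count_succ] at h
          by_cases hq : p k ∧ (t.get? k).isSome
          · rw [if_pos hq] at h
            exact ⟨k, hq, by omega⟩
          · rw [if_neg hq] at h
            omega
    by_cases h : ∃ k, (p k ∧ (t.get? k).isSome) ∧
        Nat.count (fun k => p k ∧ (t.get? k).isSome) k = m + 1
    · exfalso
      obtain ⟨k, -, hk⟩ := h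
      have h' := key k (by omega)
      have hm' : t.get? h'.choose = none := (dif_pos h').symm.trans hm
      have hs := h'.choose_spec.1.2
      rw [hm'] at hs
      simp at hs
    · exact dif_neg h⟩

/-- The projection `t|_B` of a sequence on a set of actions. -/
noncomputable def proj {α : Type u} (B : Set α) (t : Stream'.Seq α) : Stream'.Seq α :=
  select t (fun k => ∃ a ∈ B, t.get? k = some a)

/-- `t'` is a subsequence of `t`, its events being those of `t` at the positions `φ 0 < φ 1 < ⋯`. -/
def IsSubseqVia {α : Type u} (φ : ℕ → ℕ) (t' t : Stream'.Seq α) : Prop :=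
  StrictMonoOn φ {k | (t'.get? k).isSome} ∧
    ∀ k a, t'.get? k = some a → t.get? (φ k) = some a

/-- `s` is a (finite or infinite) prefix of `t`. -/
def SeqPrefix {α : Type u} (s t : Stream'.Seq α) : Prop :=
  ∀ k a, s.get? k = some a → t.get? k = some a

/-- The sequence `t` is finite and has exactly `m` events. -/
def HasLength {α : Type u} (t : Stream'.Seq α) (m : ℕ) : Prop :=
  t.get? m = none ∧ ∀ k < m, (t.get? k).isSome

/-- I/O automata with actions in `α`. -/
structure Automaton (α : Type u) where
  State : Type u
  input : Set α
  output : Set α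
  internal : Set α
  start : Set State
  trans : State → α → State → Prop
  tasks : Set (Set α)
  disj_input_output : Disjoint input output
  disj_input_internal : Disjoint input internal
  disj_output_internal : Disjoint output internal
  start_nonempty : start.Nonempty
  trans_mem : ∀ s a s', trans s a s' → a ∈ input ∪ output ∪ internal
  input_enabled : ∀ a ∈ input, ∀ s, ∃ s', trans s a s'
  tasks_union : ⋃₀ tasks = output ∪ internal
  tasks_disjoint : tasks.PairwiseDisjoint id

namespace Automaton

variable {α : Type u}

def acts (A : Automaton α) : Set α := A.input ∪ A.output ∪ A.internal

def external (A : Automaton α) : Set α := A.input ∪ A.output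

def locallyControlled (A : Automaton α) : Set α := A.output ∪ A.internal

def Enabled (A : Automaton α) (s : A.State) (a : α) : Prop := ∃ s', A.trans s a s'

def TaskEnabled (A : Automaton α) (s : A.State) (T : Set α) : Prop := ∃ a ∈ T, A.Enabled s a

def TaskDeterministic (A : Automaton α) : Prop :=
  (∀ T ∈ A.tasks, ∀ s, ∀ a ∈ T, ∀ b ∈ T, A.Enabled s a → A.Enabled s b → a = b) ∧
    ∀ s a s' s'', A.trans s a s' → A.trans s a s'' → s' = s''

/-- Task deterministic, with exactly one task and a unique start state. -/
def Deterministic (A : Automaton α) : Prop :=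
  A.TaskDeterministic ∧ (∃ T, A.tasks = {T}) ∧ ∃ s, A.start = {s}

/-- `s'` is the final state of some finite execution fragment that starts in `s`. -/
def Reaches (A : Automaton α) (s s' : A.State) : Prop :=
  Relation.ReflTransGen (fun s s' => ∃ a, A.trans s a s') s s'

def Reachable (A : Automaton α) (s : A.State) : Prop := ∃ s₀ ∈ A.start, A.Reaches s₀ s

/-- Whenever the action `a` occurs in an execution, no locally controlled action is enabled
from then on. -/
def PermanentlyDisabledBy (A : Automaton α) (a : α) : Prop :=
  ∀ s s' s'', A.Reachable s → A.trans s a s' → A.Reaches s' s'' →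
    ∀ b ∈ A.locallyControlled, ¬ A.Enabled s'' b

/-- A finite or infinite execution fragment `s₀, a₁, s₁, a₂, …`. The values of `states` beyond the
number of events are irrelevant. -/
structure Fragment (A : Automaton α) where
  states : ℕ → A.State
  events : Stream'.Seq α
  step : ∀ k a, events.get? k = some a → A.trans (states k) a (states (k + 1))

def Fragment.IsExecution {A : Automaton α} (x : A.Fragment) : Prop := x.states 0 ∈ A.start

def Fragment.IsFair {A : Automaton α} (x : A.Fragment) : Prop :=
  ∀ T ∈ A.tasks,
    (∀ m, HasLength x.events m → ¬ A.TaskEnabled (x.states m) T) ∧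
    ((∀ m, ¬ HasLength x.events m) →
      {k | ∃ a ∈ T, x.events.get? k = some a}.Infinite ∨
      {k | ¬ A.TaskEnabled (x.states k) T}.Infinite)

noncomputable def Fragment.trace {A : Automaton α} (x : A.Fragment) : Stream'.Seq α :=
  proj A.external x.events

def fairTraces (A : Automaton α) : Set (Stream'.Seq α) :=
  {t | ∃ x : A.Fragment, x.IsExecution ∧ x.IsFair ∧ t = x.trace}

/-- The conditions under which a finite collection of automata can be composed. -/
def Compatible {ι : Type} (A : ι → Automaton α) : Prop :=
  (∀ k l, k ≠ l → Disjoint (A k).output (A l).output) ∧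
    ∀ k l, k ≠ l → Disjoint (A k).internal (A l).acts

/-- Composition: actions with the same name are performed together, and an output that is matched
with inputs stays an output. -/
def compose {ι : Type} (A : ι → Automaton α) (hA : Compatible A) : Automaton α where
  State := ∀ k, (A k).State
  input := (⋃ k, (A k).input) \ ⋃ k, (A k).output
  output := ⋃ k, (A k).output
  internal := ⋃ k, (A k).internal
  start := {s | ∀ k, s k ∈ (A k).start}
  trans s a s' := (∃ k, a ∈ (A k).acts) ∧
    ∀ k, (a ∈ (A k).acts → (A k).trans (s k) a (s' k)) ∧ (a ∉ (A k).acts → s' k = s k)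
  tasks := ⋃ k, (A k).tasks
  disj_input_output := Set.disjoint_sdiff_left
  disj_input_internal := by
    rw [Set.disjoint_left]
    rintro a ⟨ha, -⟩ ha'
    obtain ⟨k, hk⟩ := Set.mem_iUnion.1 ha
    obtain ⟨l, hl⟩ := Set.mem_iUnion.1 ha'
    by_cases hkl : l = k
    · subst hkl
      exact Set.disjoint_left.1 (A l).disj_input_internal hk hl
    · exact Set.disjoint_left.1 (hA.2 l k hkl) hl (Or.inl (Or.inl hk))
  disj_output_internal := by
    rw [Set.disjoint_left]
    intro a ha ha'
    obtain ⟨k, hk⟩ := Set.mem_iUnion.1 ha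
    obtain ⟨l, hl⟩ := Set.mem_iUnion.1 ha'
    by_cases hkl : l = k
    · subst hkl
      exact Set.disjoint_left.1 (A l).disj_output_internal hk hl
    · exact Set.disjoint_left.1 (hA.2 l k hkl) hl (Or.inl (Or.inr hk))
  start_nonempty := ⟨fun k => (A k).start_nonempty.some, fun k => (A k).start_nonempty.some_mem⟩
  trans_mem := by
    rintro s a s' ⟨⟨k, hk⟩, -⟩
    rcases hk with (hk | hk) | hk
    · by_cases h : a ∈ ⋃ k, (A k).output
      · exact Or.inl (Or.inr h)
      · exact Or.inl (Or.inl ⟨Set.mem_iUnion.2 ⟨k, hk⟩, h⟩)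
    · exact Or.inl (Or.inr (Set.mem_iUnion.2 ⟨k, hk⟩))
    · exact Or.inr (Set.mem_iUnion.2 ⟨k, hk⟩)
  input_enabled := by
    classical
    rintro a ⟨ha, hno⟩ s
    obtain ⟨k₀, hk₀⟩ := Set.mem_iUnion.1 ha
    have hin : ∀ k, a ∈ (A k).acts → a ∈ (A k).input := by
      rintro k ((h | h) | h)
      · exact h
      · exact absurd (Set.mem_iUnion.2 ⟨k, h⟩) hno
      · by_cases hkk : k = k₀
        · subst hkk; exact hk₀
        · exact absurd (Or.inl (Or.inl hk₀)) (Set.disjoint_left.1 (hA.2 k k₀ hkk) h)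
    refine ⟨fun k => if h : a ∈ (A k).acts then
      ((A k).input_enabled a (hin k h) (s k)).choose else s k, ⟨k₀, Or.inl (Or.inl hk₀)⟩, ?_⟩
    intro k
    refine ⟨fun h => ?_, fun h => ?_⟩
    · simp only [dif_pos h]
      exact ((A k).input_enabled a (hin k h) (s k)).choose_spec
    · simp only [dif_neg h]
  tasks_union := by
    ext a
    simp only [Set.mem_sUnion, Set.mem_iUnion, Set.mem_union]
    constructor
    · rintro ⟨T, ⟨k, hT⟩, ha⟩
      have : a ∈ (A k).output ∪ (A k).internal := by
        rw [← (A k).tasks_union]; exact ⟨T, hT, ha⟩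
      rcases this with h | h
      · exact Or.inl ⟨k, h⟩
      · exact Or.inr ⟨k, h⟩
    · intro h
      have : ∃ k, a ∈ (A k).output ∪ (A k).internal := by
        rcases h with ⟨k, h⟩ | ⟨k, h⟩
        · exact ⟨k, Or.inl h⟩
        · exact ⟨k, Or.inr h⟩
      obtain ⟨k, hk⟩ := this
      rw [← (A k).tasks_union] at hk
      obtain ⟨T, hT, ha⟩ := hk
      exact ⟨T, ⟨k, hT⟩, ha⟩
  tasks_disjoint := by
    intro T hT T' hT' hne
    obtain ⟨k, hk⟩ := Set.mem_iUnion.1 hT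
    obtain ⟨l, hl⟩ := Set.mem_iUnion.1 hT'
    by_cases hkl : k = l
    · subst hkl
      exact (A k).tasks_disjoint hk hl hne
    · refine Set.disjoint_left.2 fun a ha ha' => ?_
      have h1 : a ∈ (A k).output ∪ (A k).internal := by
        rw [← (A k).tasks_union]; exact ⟨T, hk, ha⟩
      have h2 : a ∈ (A l).output ∪ (A l).internal := by
        rw [← (A l).tasks_union]; exact ⟨T', hl, ha'⟩
      rcases h1 with h1 | h1
      · rcases h2 with h2 | h2
        · exact Set.disjoint_left.1 (hA.1 k l hkl) h1 h2
        · exact Set.disjoint_left.1 (hA.2 l k (Ne.symm hkl)) h2 (Or.inl (Or.inr h1))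
      · refine Set.disjoint_left.1 (hA.2 k l hkl) h1 ?_
        rcases h2 with h2 | h2
        · exact Or.inl (Or.inr h2)
        · exact Or.inr h2

end Automaton

/-- The actions, for the locations `Fin n`, messages `M`, names `O` of failure-detector outputs and
names `X` of internal actions. `send i j m` is `send(m,j)_i`, and `receive i j m` is
`receive(m,j)_i`: at `i`, message `m` from `j`. -/
inductive Act (n : ℕ) (M O X : Type u) : Type u where
  | crash (i : Fin n)
  | send (i j : Fin n) (m : M)
  | receive (i j : Fin n) (m : M)
  | propose (i : Fin n) (v : Bool)
  | decide (i : Fin n) (v : Bool)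
  | fd (i : Fin n) (o : O)
  | internal (i : Fin n) (x : X)

variable {n : ℕ} {M O X : Type u}

/-- The location at which an action occurs. -/
def Act.loc : Act n M O X → Fin n
  | .crash i => i
  | .send i _ _ => i
  | .receive i _ _ => i
  | .propose i _ => i
  | .decide i _ => i
  | .fd i _ => i
  | .internal i _ => i

/-- The actions in `B` that occur at location `i`. -/
def atLoc (B : Set (Act n M O X)) (i : Fin n) : Set (Act n M O X) := {a | a ∈ B ∧ a.loc = i}

/-- The set of all crash actions. -/
def crashes : Set (Act n M O X) := {a | ∃ i, a = .crash i}

def faulty (t : Stream'.Seq (Act n M O X)) : Set (Fin n) := {i | .crash i ∈ t}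

/-- A problem `(I, O, T)` without the requirement that it be solvable by some automaton. -/
structure Problem (α : Type u) where
  I : Set α
  O : Set α
  T : Set (Stream'.Seq α)
  disjoint : Disjoint I O
  mem_acts : ∀ t ∈ T, ∀ a ∈ t, a ∈ I ∪ O

def Problem.SolvedBy {α : Type u} (P : Problem α) (U : Automaton α) : Prop :=
  U.input = P.I ∧ U.output = P.O ∧ U.fairTraces ⊆ P.T

namespace Problem

/-- Valid sequences: no outputs at `i` after a crash of `i`, infinitely many outputs at `i` if `i`
does not crash. -/
def Valid (D : Problem (Act n M O X)) (t : Stream'.Seq (Act n M O X)) : Prop :=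
  (∀ i k k', k < k' → t.get? k = some (.crash i) →
    ∀ a ∈ atLoc D.O i, t.get? k' ≠ some a) ∧
  ∀ i, i ∉ faulty t → {k | ∃ a ∈ atLoc D.O i, t.get? k = some a}.Infinite

/-- `k` is the position of the first crash of `i` in `t`. -/
def IsFirstCrash (t : Stream'.Seq (Act n M O X)) (i : Fin n) (k : ℕ) : Prop :=
  t.get? k = some (.crash i) ∧ ∀ k' < k, t.get? k' ≠ some (.crash i)

def IsSampling (D : Problem (Act n M O X)) (t' t : Stream'.Seq (Act n M O X)) : Prop :=
  ∃ φ : ℕ → ℕ, IsSubseqVia φ t' t ∧ ∀ i,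
    (i ∉ faulty t → proj (atLoc D.O i) t' = proj (atLoc D.O i) t) ∧
    (i ∈ faulty t →
      (∃ k, (t'.get? k).isSome ∧ IsFirstCrash t i (φ k)) ∧
      SeqPrefix (proj (atLoc D.O i) t') (proj (atLoc D.O i) t))

def IsConstrainedReordering (D : Problem (Act n M O X))
    (t' t : Stream'.Seq (Act n M O X)) : Prop :=
  D.Valid t' ∧
  ∃ π : {k // (t.get? k).isSome} ≃ {k // (t'.get? k).isSome},
    (∀ k, t'.get? (π k) = t.get? k) ∧
    ∀ (k k' : {k // (t.get? k).isSome}) (a a' : Act n M O X), (k : ℕ) < k' →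
      t.get? k = some a → t.get? k' = some a' →
      ((a ∈ D.O ∧ a' ∈ D.O ∧ a.loc = a'.loc) ∨ (a ∈ crashes ∧ a' ∈ D.O)) →
      (π k : ℕ) < π k'

/-- `t` is a finite sequence and `t'` extends it by crash events only. -/
def IsCrashExtension (t' t : Stream'.Seq (Act n M O X)) : Prop :=
  ∃ m, HasLength t m ∧ SeqPrefix t t' ∧
    ∀ k ≥ m, ∀ a, t'.get? k = some a → a ∈ crashes

/-- The subsequence without the crashes at locations that have already crashed. -/
noncomputable def mincrash (t : Stream'.Seq (Act n M O X)) : Stream'.Seq (Act n M O X) :=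
  select t (fun k => ¬ ∃ i, t.get? k = some (.crash i) ∧ ∃ k' < k, t.get? k' = some (.crash i))

/-- Asynchronous failure detectors, whose outputs are among the actions `fd i o`. -/
structure IsAFD (D : Problem (Act n M O X)) : Prop where
  outputs : ∀ a ∈ D.O, ∃ i o, a = .fd i o
  crash_exclusivity : D.I = crashes
  solvable : ∃ U : Automaton (Act n M O X), D.SolvedBy U
  validity : ∀ t ∈ D.T, D.Valid t
  sampling : ∀ t ∈ D.T, ∀ t', D.IsSampling t' t → t' ∈ D.T
  reordering : ∀ t ∈ D.T, ∀ t', D.IsConstrainedReordering t' t → t' ∈ D.T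
  crash_extension_finite : ∀ t ∈ D.T, ∀ s, SeqPrefix s t → ∀ t', IsCrashExtension t' s →
    (∃ m, HasLength t' m) → ∃ t'' ∈ D.T, SeqPrefix t' t''
  crash_extension_full : ∀ t ∈ D.T, ∀ s, SeqPrefix s t → ∀ t', IsCrashExtension t' s →
    faulty t' = Set.univ → t' ∈ D.T
  extra_crashes : ∀ t ∈ D.T, ∀ t', mincrash t' = mincrash t → t' ∈ D.T

/-- AFDs that are closed under strong sampling. -/
structure IsStrongSamplingAFD (D : Problem (Act n M O X)) : Prop extends IsAFD D where
  strong_sampling : ∀ t ∈ D.T, ∀ t', (∃ φ, IsSubseqVia φ t' t) → D.Valid t' → t' ∈ D.T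

end Problem

/-! ### Binary consensus -/

section Consensus

/-- At most one event of `t` belongs to `B`. -/
def AtMostOne (B : Set (Act n M O X)) (t : Stream'.Seq (Act n M O X)) : Prop :=
  ∀ k k', ∀ a ∈ B, ∀ a' ∈ B, t.get? k = some a → t.get? k' = some a' → k = k'

def ExactlyOne (B : Set (Act n M O X)) (t : Stream'.Seq (Act n M O X)) : Prop :=
  AtMostOne B t ∧ ∃ a ∈ B, a ∈ t

def proposals (i : Fin n) : Set (Act n M O X) := {a | ∃ v, a = .propose i v}

def decisions (i : Fin n) : Set (Act n M O X) := {a | ∃ v, a = .decide i v}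

def NoneAfterCrash (i : Fin n) (B : Set (Act n M O X)) (t : Stream'.Seq (Act n M O X)) : Prop :=
  ∀ k k', k < k' → t.get? k = some (.crash i) → ∀ a ∈ B, t.get? k' ≠ some a

def EnvironmentWellFormed (t : Stream'.Seq (Act n M O X)) : Prop :=
  ∀ i, AtMostOne (proposals i) t ∧ NoneAfterCrash i (proposals i) t ∧
    (i ∉ faulty t → ExactlyOne (proposals i) t)

def CrashLimitation (f : ℕ) (t : Stream'.Seq (Act n M O X)) : Prop := (faulty t).ncard ≤ f

def CrashValidity (t : Stream'.Seq (Act n M O X)) : Prop :=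
  ∀ i, NoneAfterCrash i (decisions i) t

def Agreement (t : Stream'.Seq (Act n M O X)) : Prop :=
  ∀ i j v w, .decide i v ∈ t → .decide j w ∈ t → v = w

def ConsensusValidity (t : Stream'.Seq (Act n M O X)) : Prop :=
  ∀ i v, .decide i v ∈ t → ∃ j, .propose j v ∈ t

def Termination (t : Stream'.Seq (Act n M O X)) : Prop :=
  ∀ i, AtMostOne (decisions i) t ∧ (i ∉ faulty t → ExactlyOne (decisions i) t)

/-- `f`-crash-tolerant binary consensus. -/
def consensus (n : ℕ) (M O X : Type u) (f : ℕ) : Problem (Act n M O X) where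
  I := {a | (∃ i v, a = .propose i v) ∨ a ∈ crashes}
  O := {a | ∃ i v, a = .decide i v}
  T := {t | (∀ a ∈ t, (∃ i v, a = .propose i v) ∨ a ∈ crashes ∨ ∃ i v, a = .decide i v) ∧
    (EnvironmentWellFormed t → CrashLimitation f t →
      CrashValidity t ∧ Agreement t ∧ ConsensusValidity t ∧ Termination t)}
  disjoint := by
    rw [Set.disjoint_left]
    rintro a (⟨i, v, rfl⟩ | ⟨i, rfl⟩) ⟨j, w, h⟩ <;> cases h
  mem_acts := by
    rintro t ⟨ht, -⟩ a ha
    rcases ht a ha with h | h | h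
    · exact Or.inl (Or.inl h)
    · exact Or.inl (Or.inr h)
    · exact Or.inr h

end Consensus

/-! ### The system -/

/-- The reliable FIFO channel from `i` to `j`. -/
def channel (i j : Fin n) : Automaton (Act n M O X) where
  State := List M
  input := {a | ∃ m, a = .send i j m}
  output := {a | ∃ m, a = .receive j i m}
  internal := ∅
  start := {[]}
  trans s a s' := (∃ m, a = .send i j m ∧ s' = s ++ [m]) ∨ ∃ m, a = .receive j i m ∧ s = m :: s'
  tasks := {{a | ∃ m, a = .receive j i m}}
  disj_input_output := by
    rw [Set.disjoint_left]
    rintro a ⟨m, rfl⟩ ⟨m', h⟩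
    cases h
  disj_input_internal := Set.disjoint_empty _
  disj_output_internal := Set.disjoint_empty _
  start_nonempty := Set.singleton_nonempty _
  trans_mem := by
    rintro s a s' (⟨m, rfl, -⟩ | ⟨m, rfl, -⟩)
    · exact Or.inl (Or.inl ⟨m, rfl⟩)
    · exact Or.inl (Or.inr ⟨m, rfl⟩)
  input_enabled := by
    rintro a ⟨m, rfl⟩ s
    exact ⟨_, Or.inl ⟨m, rfl, rfl⟩⟩
  tasks_union := by simp
  tasks_disjoint := Set.pairwiseDisjoint_singleton _ _

/-- The consensus environment at `i`; the state is the value of the variable `stop`. -/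
def environment (i : Fin n) : Automaton (Act n M O X) where
  State := ULift.{u} Bool
  input := {a | a = .crash i ∨ ∃ v, a = .decide i v}
  output := {a | ∃ v, a = .propose i v}
  internal := ∅
  start := {⟨false⟩}
  trans s a s' := (a = .crash i ∧ s' = ⟨true⟩) ∨ (∃ v, a = .decide i v ∧ s' = s) ∨
    ∃ v, a = .propose i v ∧ s = ⟨false⟩ ∧ s' = ⟨true⟩
  tasks := {{.propose i false}, {.propose i true}}
  disj_input_output := by
    rw [Set.disjoint_left]
    rintro a (rfl | ⟨v, rfl⟩) ⟨v', h⟩ <;> cases h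
  disj_input_internal := Set.disjoint_empty _
  disj_output_internal := Set.disjoint_empty _
  start_nonempty := Set.singleton_nonempty _
  trans_mem := by
    rintro s a s' (⟨rfl, -⟩ | ⟨v, rfl, -⟩ | ⟨v, rfl, -⟩)
    · exact Or.inl (Or.inl (Or.inl rfl))
    · exact Or.inl (Or.inl (Or.inr ⟨v, rfl⟩))
    · exact Or.inl (Or.inr ⟨v, rfl⟩)
  input_enabled := by
    rintro a (rfl | ⟨v, rfl⟩) s
    · exact ⟨_, Or.inl ⟨rfl, rfl⟩⟩
    · exact ⟨_, Or.inr (Or.inl ⟨v, rfl, rfl⟩)⟩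
  tasks_union := by
    ext a
    simp only [Set.sUnion_insert, Set.sUnion_singleton, Set.union_empty, Set.mem_union,
      Set.mem_singleton_iff, Set.mem_ofPred_eq, Bool.exists_bool]
  tasks_disjoint := by
    rintro T (rfl | rfl) T' (rfl | rfl) h
    · exact absurd rfl h
    · simp [Function.onFun]
    · simp [Function.onFun]
    · exact absurd rfl h

/-- Crash automata: the outputs are the crash actions, there are no other actions, and every
sequence of crash actions is a fair trace. -/
structure IsCrashAutomaton (C : Automaton (Act n M O X)) : Prop where
  input_eq : C.input = ∅
  output_eq : C.output = crashes
  internal_eq : C.internal = ∅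
  all_fair : ∀ t : Stream'.Seq (Act n M O X), (∀ a ∈ t, a ∈ crashes) → t ∈ C.fairTraces

/-- Distributed algorithms (one process automaton per location) with the signature that is required
for solving binary consensus using `D` in the consensus environment. -/
structure Algorithm (D : Problem (Act n M O X)) where
  proc : Fin n → Automaton (Act n M O X)
  input_eq : ∀ i, (proc i).input =
    {a | (∃ j m, j ≠ i ∧ a = .receive i j m) ∨ (∃ v, a = .propose i v) ∨ a = .crash i ∨
      a ∈ atLoc D.O i}
  output_eq : ∀ i, (proc i).output =
    {a | (∃ j m, j ≠ i ∧ a = .send i j m) ∨ ∃ v, a = .decide i v}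
  internal_loc : ∀ i, ∀ a ∈ (proc i).internal, a.loc = i
  deterministic : ∀ i, (proc i).Deterministic
  crash_disables : ∀ i, (proc i).PermanentlyDisabledBy (.crash i)

/-- Names of the component automata of the system. -/
inductive Component (n : ℕ) : Type where
  | proc (i : Fin n)
  | chan (i j : Fin n) (h : i ≠ j)
  | env (i : Fin n)

namespace Algorithm

variable {D : Problem (Act n M O X)}

def component (A : Algorithm D) : Component n → Automaton (Act n M O X)
  | .proc i => A.proc i
  | .chan i j _ => channel i j
  | .env i => environment i

theorem compatible (A : Algorithm D) : Automaton.Compatible A.component := by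
  have hin : ∀ i, (A.proc i).acts = (A.proc i).input ∪ (A.proc i).output ∪ (A.proc i).internal :=
    fun i => rfl
  have hloc : ∀ i, ∀ a ∈ (A.proc i).acts, a.loc = i := by
    rintro i a ((h | h) | h)
    · rw [A.input_eq] at h
      rcases h with ⟨j, m, -, rfl⟩ | ⟨v, rfl⟩ | rfl | h
      · rfl
      · rfl
      · rfl
      · exact h.2
    · rw [A.output_eq] at h
      rcases h with ⟨j, m, -, rfl⟩ | ⟨v, rfl⟩ <;> rfl
    · exact A.internal_loc i a h
  have hni : ∀ i, ∀ a ∈ (A.proc i).internal,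
      a ∉ (A.proc i).input ∧ a ∉ (A.proc i).output := fun i a ha =>
    ⟨fun h => Set.disjoint_left.1 (A.proc i).disj_input_internal h ha,
      fun h => Set.disjoint_left.1 (A.proc i).disj_output_internal h ha⟩
  constructor
  · intro k l hkl
    rw [Set.disjoint_left]
    intro a ha hb
    cases k with
    | proc i =>
      cases l with
      | proc j =>
        have h1 := hloc i a (Or.inl (Or.inr ha))
        have h2 := hloc j a (Or.inl (Or.inr hb))
        exact hkl (by rw [← h1, ← h2])
      | chan p q h =>
        obtain ⟨m, rfl⟩ := hb
        change _ ∈ (A.proc i).output at ha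
        rw [A.output_eq] at ha
        rcases ha with ⟨_, _, _, h⟩ | ⟨_, h⟩ <;> cases h
      | env j =>
        obtain ⟨v, rfl⟩ := hb
        change _ ∈ (A.proc i).output at ha
        rw [A.output_eq] at ha
        rcases ha with ⟨_, _, _, h⟩ | ⟨_, h⟩ <;> cases h
    | chan p q h =>
      obtain ⟨m, rfl⟩ := ha
      cases l with
      | proc j =>
        change _ ∈ (A.proc j).output at hb
        rw [A.output_eq] at hb
        rcases hb with ⟨_, _, _, h⟩ | ⟨_, h⟩ <;> cases h
      | chan p' q' h' =>
        obtain ⟨m', h''⟩ := hb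
        cases h''
        exact hkl rfl
      | env j =>
        obtain ⟨v, h''⟩ := hb
        cases h''
    | env i =>
      obtain ⟨v, rfl⟩ := ha
      cases l with
      | proc j =>
        change _ ∈ (A.proc j).output at hb
        rw [A.output_eq] at hb
        rcases hb with ⟨_, _, _, h⟩ | ⟨_, h⟩ <;> cases h
      | chan p' q' h' =>
        obtain ⟨m', h''⟩ := hb
        cases h''
      | env j =>
        obtain ⟨v', h''⟩ := hb
        cases h''
        exact hkl rfl
  · intro k l hkl
    rw [Set.disjoint_left]
    intro a ha hb
    cases k with
    | chan p q h => exact ha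
    | env i => exact ha
    | proc i =>
      have hai : a.loc = i := A.internal_loc i a ha
      obtain ⟨h1, h2⟩ := hni i a ha
      rw [A.input_eq] at h1
      rw [A.output_eq] at h2
      cases l with
      | proc j =>
        exact hkl (by rw [← hai, ← hloc j a hb])
      | chan p q h =>
        rcases hb with (⟨m, rfl⟩ | ⟨m, rfl⟩) | hb
        · obtain rfl : p = i := hai
          exact h2 (Or.inl ⟨q, m, Ne.symm h, rfl⟩)
        · obtain rfl : q = i := hai
          exact h1 (Or.inl ⟨p, m, h, rfl⟩)
        · exact hb
      | env j =>
        rcases hb with ((rfl | ⟨v, rfl⟩) | ⟨v, rfl⟩) | hb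
        · obtain rfl : j = i := hai
          exact h1 (Or.inr (Or.inr (Or.inl rfl)))
        · obtain rfl : j = i := hai
          exact h2 (Or.inr ⟨v, rfl⟩)
        · obtain rfl : j = i := hai
          exact h1 (Or.inr (Or.inl ⟨v, rfl⟩))
        · exact hb

/-- The system: the processes, the channels and the consensus environment. The crashes and the
failure-detector outputs are inputs of it. -/
def system (A : Algorithm D) : Automaton (Act n M O X) :=
  Automaton.compose A.component A.compatible

def componentWithCrash (A : Algorithm D) (C : Automaton (Act n M O X)) :
    Option (Component n) → Automaton (Act n M O X)
  | none => C
  | some k => A.component k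

theorem compatibleWithCrash (A : Algorithm D) {C : Automaton (Act n M O X)}
    (hC : IsCrashAutomaton C) : Automaton.Compatible (A.componentWithCrash C) := by
  have hout : ∀ k, ∀ a ∈ (A.component k).output, a ∉ (crashes : Set (Act n M O X)) := by
    rintro k a ha ⟨i, rfl⟩
    cases k with
    | proc j =>
      change _ ∈ (A.proc j).output at ha
      rw [A.output_eq] at ha
      rcases ha with ⟨_, _, _, h⟩ | ⟨_, h⟩ <;> cases h
    | chan p q h => obtain ⟨m, h⟩ := ha; cases h
    | env j => obtain ⟨m, h⟩ := ha; cases h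
  have hint : ∀ k, ∀ a ∈ (A.component k).internal, a ∉ (crashes : Set (Act n M O X)) := by
    rintro k a ha ⟨i, rfl⟩
    cases k with
    | proc j =>
      have hj : i = j := A.internal_loc j _ ha
      subst hj
      refine Set.disjoint_left.1 (A.proc i).disj_input_internal ?_ ha
      rw [A.input_eq]
      exact Or.inr (Or.inr (Or.inl rfl))
    | chan p q h => exact ha
    | env j => exact ha
  constructor
  · rintro (_ | k) (_ | l) hkl
    · exact absurd rfl hkl
    · refine Set.disjoint_left.2 fun a ha hb => hout l a hb ?_
      rw [← hC.output_eq]; exact ha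
    · refine Set.disjoint_left.2 fun a ha hb => hout k a ha ?_
      rw [← hC.output_eq]; exact hb
    · exact A.compatible.1 k l fun h => hkl (congrArg some h)
  · rintro (_ | k) (_ | l) hkl
    · exact absurd rfl hkl
    · refine Set.disjoint_left.2 fun a ha hb => ?_
      change a ∈ C.internal at ha
      rw [hC.internal_eq] at ha
      exact ha
    · refine Set.disjoint_left.2 fun a ha hb => hint k a ha ?_
      rcases hb with (hb | hb) | hb
      · change a ∈ C.input at hb
        rw [hC.input_eq] at hb
        exact hb.elim
      · rw [← hC.output_eq]; exact hb
      · change a ∈ C.internal at hb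
        rw [hC.internal_eq] at hb
        exact hb.elim
    · exact A.compatible.2 k l fun h => hkl (congrArg some h)

/-- `A` solves `f`-crash-tolerant binary consensus using `D` in the consensus environment. -/
def SolvesConsensus (A : Algorithm D) {C : Automaton (Act n M O X)} (hC : IsCrashAutomaton C)
    (f : ℕ) : Prop :=
  ∀ t ∈ (Automaton.compose (A.componentWithCrash C) (A.compatibleWithCrash hC)).fairTraces,
    proj (D.I ∪ D.O) t ∈ D.T →
      proj ((consensus n M O X f).I ∪ (consensus n M O X f).O) t ∈ (consensus n M O X f).T

end Algorithm

/-! ### Observations -/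

/-- A triple `(i, k, e)`. -/
structure Vertex (n : ℕ) (M O X : Type u) : Type u where
  loc : Fin n
  idx : ℕ
  act : Act n M O X

/-- Observations of `D`; `E` is the edge relation. -/
structure Observation (D : Problem (Act n M O X)) where
  V : Set (Vertex n M O X)
  E : Vertex n M O X → Vertex n M O X → Prop
  edge_mem : ∀ u v, E u v → u ∈ V ∧ v ∈ V
  acyclic : ∀ v, ¬ Relation.TransGen E v v
  idx_pos : ∀ v ∈ V, 0 < v.idx
  act_mem : ∀ v ∈ V, v.act ∈ atLoc D.O v.loc
  unique : ∀ u ∈ V, ∀ v ∈ V, u.loc = v.loc → u.idx = v.idx → u = v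
  down_closed : ∀ v ∈ V, ∀ k, 0 < k → k < v.idx → ∃ u ∈ V, u.loc = v.loc ∧ u.idx = k
  succ_edge : ∀ u ∈ V, ∀ v ∈ V, u.loc = v.loc → v.idx = u.idx + 1 → E u v
  edge_to_live : ∀ i j, i ≠ j → {v | v ∈ V ∧ v.loc = j}.Infinite →
    ∀ u ∈ V, u.loc = i → ∃ v ∈ V, v.loc = j ∧ E u v
  edge_trans : ∀ u v w, E u v → E v w → E u w

namespace Observation

variable {D : Problem (Act n M O X)}

def live (G : Observation D) : Set (Fin n) := {i | {v | v ∈ G.V ∧ v.loc = i}.Infinite}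

/-- An enumeration of all vertices, each exactly once, in which all edges point forward. -/
def IsTopologicalOrdering (G : Observation D) (τ : Stream'.Seq (Vertex n M O X)) : Prop :=
  (∀ v, v ∈ τ ↔ v ∈ G.V) ∧
  (∀ k k' v, τ.get? k = some v → τ.get? k' = some v → k = k') ∧
  ∀ k k' u v, τ.get? k = some u → τ.get? k' = some v → G.E u v → k < k'

def Compatible (G : Observation D) (t : Stream'.Seq (Act n M O X)) : Prop :=
  ∃ τ, G.IsTopologicalOrdering τ ∧ proj D.O t = τ.map Vertex.act

def Viable (G : Observation D) : Prop := ∃ t ∈ D.T, G.Compatible t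

/-- `G'` is a prefix of `G`. -/
def IsPrefix (G' G : Observation D) : Prop :=
  G'.V ⊆ G.V ∧ (∀ u v, G'.E u v → G.E u v) ∧ ∀ v ∈ G'.V, ∀ u, G'.E u v ↔ G.E u v

/-- `Gs` is a sequence of finite observations, each of which is a prefix of the next one, and its
limit is the observation `G`. -/
def ConvergesTo (Gs : ℕ → Observation D) (G : Observation D) : Prop :=
  (∀ x, (Gs x).V.Finite) ∧ (∀ x, (Gs x).IsPrefix (Gs (x + 1))) ∧
  G.V = ⋃ x, (Gs x).V ∧ ∀ u v, G.E u v ↔ ∃ x, (Gs x).E u v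

end Observation

/-! ### Execution trees -/

/-- The labels of the edges of the execution tree: the tasks of the system and `FD_i`. -/
inductive Label (n : ℕ) : Type where
  | proc (i : Fin n)
  | env (i : Fin n) (v : Bool)
  | chan (i j : Fin n) (h : i ≠ j)
  | fd (i : Fin n)

/-- Vertex tags; `none` is the null vertex `(⊥, 0, ⊥)`. -/
abbrev VTag (n : ℕ) (M O X : Type u) : Type u := Option (Vertex n M O X)

/-- Nodes of execution trees, given by the labels and vertex tags of the edges on the path from the
root. This determines a node of a tree, and it identifies nodes of different trees. -/
abbrev Node (n : ℕ) (M O X : Type u) : Type u := List (Label n × VTag n M O X)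

/-- The vertex tag of a node. -/
def Node.vtag (N : Node n M O X) : VTag n M O X :=
  match N.getLast? with
  | none => none
  | some e => e.2

/-- The edge with the given label and vertex tag out of the node `src`. -/
structure Edge (n : ℕ) (M O X : Type u) : Type u where
  src : Node n M O X
  label : Label n
  tag : VTag n M O X

/-- The lower endpoint. -/
def Edge.target (e : Edge n M O X) : Node n M O X := e.src ++ [(e.label, e.tag)]

namespace Observation

variable {D : Problem (Act n M O X)}

/-- `u` is a vertex that may follow a node with vertex tag `v`. -/
def Follows (G : Observation D) (v : VTag n M O X) (u : Vertex n M O X) : Prop :=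
  match v with
  | none => u ∈ G.V
  | some w => G.E w u

/-- Some vertex with location `i` may follow the vertex tag `v`. -/
def Active (G : Observation D) (v : VTag n M O X) (i : Fin n) : Prop :=
  ∃ u, G.Follows v u ∧ u.loc = i

/-- An internal node with vertex tag `v` has an outgoing edge with label `l` and vertex tag `w`. -/
def EdgeOut (G : Observation D) (v : VTag n M O X) (l : Label n) (w : VTag n M O X) : Prop :=
  match l with
  | .fd i => (∃ u, G.Follows v u ∧ u.loc = i ∧ w = some u) ∨ (¬ G.Active v i ∧ w = v)
  | _ => w = v

/-- `p` is a downward path of the task tree from a node with vertex tag `v`, apart from the bound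
on the depth. -/
def PathFrom (G : Observation D) : VTag n M O X → Node n M O X → Prop
  | _, [] => True
  | v, (l, w) :: p => G.EdgeOut v l w ∧ G.PathFrom w p

/-- `N` is a node of the tree of `G`, whose height is the number of vertices of `G`. -/
def IsNode (G : Observation D) (N : Node n M O X) : Prop :=
  G.PathFrom none N ∧ (N.length : ℕ∞) ≤ G.V.encard

/-- `N'` is a descendant of `N` (possibly `N` itself) in the tree of `G`. -/
def IsDescendant (G : Observation D) (N' N : Node n M O X) : Prop := G.IsNode N' ∧ N <+: N'

/-- `e` is an `l`-edge of the node `N` in the tree of `G`. -/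
def IsEdgeOf (G : Observation D) (e : Edge n M O X) (N : Node n M O X) (l : Label n) : Prop :=
  e.src = N ∧ e.label = l ∧ G.IsNode e.target

end Observation

namespace Algorithm

variable {D : Problem (Act n M O X)}

/-- The task of the system that a label stands for. -/
def task (A : Algorithm D) : Label n → Set (Act n M O X)
  | .proc i => (A.proc i).locallyControlled
  | .env i v => {.propose i v}
  | .chan i j _ => {a | ∃ m, a = .receive j i m}
  | .fd _ => ∅

open Classical in
/-- The action of the task `l` that is enabled in `c`, if there is one. -/
noncomputable def enabledAction (A : Algorithm D) (c : A.system.State) (l : Label n) :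
    Option (Act n M O X) :=
  if h : ∃ a ∈ A.task l, A.system.Enabled c a then some h.choose else none

open Classical in
/-- The action tag (`none` is `⊥`) of the edge with label `l` and vertex tag `w` out of a node with
configuration tag `c` and vertex tag `v`. -/
noncomputable def edgeAction (A : Algorithm D) (G : Observation D) (c : A.system.State)
    (v : VTag n M O X) (l : Label n) (w : VTag n M O X) : Option (Act n M O X) :=
  match l with
  | .fd _ => if w = v then none else w.map Vertex.act
  | .proc i => if G.Active v i then A.enabledAction c l else none
  | .env i _ => if G.Active v i then A.enabledAction c l else none
  | .chan _ _ _ => A.enabledAction c l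

open Classical in
/-- The state that results from applying an action, or nothing, to the state `c`. -/
noncomputable def applyAction (A : Algorithm D) (c : A.system.State) :
    Option (Act n M O X) → A.system.State
  | none => c
  | some a => if h : ∃ c', A.system.trans c a c' then h.choose else c

noncomputable def startState (A : Algorithm D) : A.system.State := A.system.start_nonempty.some

/-- The action tags along a path from a node with configuration tag `c` and vertex tag `v`. -/
noncomputable def actionsFrom (A : Algorithm D) (G : Observation D) :
    A.system.State → VTag n M O X → Node n M O X → List (Option (Act n M O X))
  | _, _, [] => []
  | c, v, (l, w) :: p => A.edgeAction G c v l w ::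
      A.actionsFrom G (A.applyAction c (A.edgeAction G c v l w)) w p

/-- The configuration tag at the end of a path from a node with configuration tag `c` and vertex
tag `v`. -/
noncomputable def configFrom (A : Algorithm D) (G : Observation D) :
    A.system.State → VTag n M O X → Node n M O X → A.system.State
  | c, _, [] => c
  | c, v, (l, w) :: p => A.configFrom G (A.applyAction c (A.edgeAction G c v l w)) w p

/-- The action tags on the path from the root to `N`. -/
noncomputable def pathActions (A : Algorithm D) (G : Observation D) (N : Node n M O X) :
    List (Option (Act n M O X)) := A.actionsFrom G A.startState none N

/-- The configuration tag of `N`. -/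
noncomputable def config (A : Algorithm D) (G : Observation D) (N : Node n M O X) :
    A.system.State := A.configFrom G A.startState none N

/-- The action tag of an edge. -/
noncomputable def actionTag (A : Algorithm D) (G : Observation D) (e : Edge n M O X) :
    Option (Act n M O X) :=
  A.edgeAction G (A.config G e.src) (Node.vtag e.src) e.label e.tag

/-- The path from the root to the node has no edge with action tag `⊥`. -/
def NonBot (A : Algorithm D) (G : Observation D) (N : Node n M O X) : Prop :=
  none ∉ A.pathActions G N

/-- `v` is a decision value of the execution that corresponds to `N`. -/
def HasDecision (A : Algorithm D) (G : Observation D) (N : Node n M O X) (v : Bool) : Prop :=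
  ∃ i, some (Act.decide i v) ∈ A.pathActions G N

def Bivalent (A : Algorithm D) (G : Observation D) (N : Node n M O X) : Prop :=
  ∀ v, ∃ N', G.IsDescendant N' N ∧ A.HasDecision G N' v

/-- `N` is `v`-valent in the tree of `G`. -/
def Valent (A : Algorithm D) (G : Observation D) (v : Bool) (N : Node n M O X) : Prop :=
  (∃ N', G.IsDescendant N' N ∧ A.HasDecision G N' v) ∧
    ∀ N', G.IsDescendant N' N → ¬ A.HasDecision G N' (!v)

end Algorithm

/-! ### Gadgets -/

/-- Tuples of the forms `(N, l, E^l, E'^l)` and `(N, l, r, E^l, E^r, E^{rl})`. -/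
inductive Gadget (n : ℕ) (M O X : Type u) : Type u where
  | four (N : Node n M O X) (l : Label n) (e e' : Edge n M O X)
  | six (N : Node n M O X) (l r : Label n) (el er erl : Edge n M O X)

/-- The first element of the tuple. -/
def Gadget.node : Gadget n M O X → Node n M O X
  | .four N _ _ _ => N
  | .six N _ _ _ _ _ => N

/-- The tuple is a gadget of the tree of `G`. -/
def Observation.IsGadget {D : Problem (Act n M O X)} (G : Observation D) :
    Gadget n M O X → Prop
  | .four N l e e' => G.IsNode N ∧ G.IsEdgeOf e N l ∧ G.IsEdgeOf e' N l
  | .six N l r el er erl => G.IsNode N ∧ l ≠ r ∧ G.IsEdgeOf el N l ∧ G.IsEdgeOf er N r ∧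
      G.IsEdgeOf erl er.target l

namespace Algorithm

variable {D : Problem (Act n M O X)}

/-- The gadget is a fork (first case) or a hook (second case) in the tree of `G`. -/
def IsDecisionGadget (A : Algorithm D) (G : Observation D) (Y : Gadget n M O X) : Prop :=
  G.IsGadget Y ∧
  match Y with
  | .four N _ e e' => A.Bivalent G N ∧ ∃ v, A.Valent G v e.target ∧ A.Valent G (!v) e'.target
  | .six N _ _ el er erl => A.Bivalent G N ∧
      (∃ v, A.Valent G v el.target ∧ A.Valent G (!v) erl.target) ∧ A.actionTag G er ≠ none

def IsNonBotDecisionGadget (A : Algorithm D) (G : Observation D) (Y : Gadget n M O X) : Prop :=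
  A.IsDecisionGadget G Y ∧ A.NonBot G Y.node

end Algorithm

/-! ### The metric -/

/-- The position of a label in the ordering `Proc_1, …, Proc_n, Env_{1,0}, Env_{1,1}, …, Env_{n,1},
Chan_{1,2}, …, Chan_{n,n-1}, FD_1, …, FD_n`. -/
def Label.metric : Label n → ℕ
  | .proc i => i + 1
  | .env i v => n + 2 * i + (if v then 2 else 1)
  | .chan i j _ => 3 * n + (n - 1) * i + (if j < i then (j : ℕ) + 1 else j)
  | .fd i => n ^ 2 + 2 * n + (i + 1)

/-- `m(i, k, e) = k n + i`, where the locations are numbered from `1`, and `m(⊥, 0, ⊥) = 0`. -/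
def VTag.metric : VTag n M O X → ℕ
  | none => 0
  | some v => v.idx * n + (v.loc + 1)

/-- The index of the vertex, `0` for the null vertex. -/
def VTag.index : VTag n M O X → ℕ
  | none => 0
  | some v => v.idx

/-- The metric value of an edge with label `e.1` and vertex tag `e.2`. -/
def edgeMetric (e : Label n × VTag n M O X) : ℕ ×ₗ ℕ := toLex (VTag.metric e.2, e.1.metric)

/-- The metric value of a node: depth plus index, then the metric values of the edges from the root.
These values are compared lexicographically. -/
def Node.metric (N : Node n M O X) : ℕ ×ₗ List (ℕ ×ₗ ℕ) :=
  toLex (N.length + VTag.index (Node.vtag N), N.map edgeMetric)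

/-- The Cantor pairing function. -/
def cantorPair (a b : ℕ) : ℕ := (a + b) * (a + b + 1) / 2 + b

namespace Observation

variable {D : Problem (Act n M O X)}

/-- The rank of a node of the tree of `G`: the number of nodes with a smaller metric value. -/
noncomputable def rank (G : Observation D) (N : Node n M O X) : ℕ :=
  {N' | G.IsNode N' ∧ Node.metric N' < Node.metric N}.ncard

/-- The metric value of a gadget. -/
noncomputable def gadgetMetric (G : Observation D) : Gadget n M O X → ℕ
  | .four N _ e e' => cantorPair (G.rank N) (cantorPair (G.rank e.target) (G.rank e'.target))
  | .six N _ _ el _ erl =>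
      cantorPair (G.rank N) (cantorPair (G.rank el.target) (G.rank erl.target))

end Observation

/-- `Y` is the first non-`⊥` decision gadget in the execution tree of `G`. -/
def Algorithm.IsFirstNonBotDecisionGadget {D : Problem (Act n M O X)} (A : Algorithm D)
    (G : Observation D) (Y : Gadget n M O X) : Prop :=
  A.IsNonBotDecisionGadget G Y ∧
    ∀ Y', A.IsNonBotDecisionGadget G Y' → Y' ≠ Y → G.gadgetMetric Y < G.gadgetMetric Y'

end CHT

/-! The theorem combines a bivalence argument in the infinite tree of `G` with a local finiteness
argument for the limit.

From branches to executions. Let `b` be an infinite branch of the tree of `G` on which every label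
recurs. Its non-`⊥` actions, together with suitably placed crashes of the locations that are not
live, form a fair execution of the system with the crash automaton (`exists_fair_execution`). The
crash of `i` is put immediately before the step that first makes `i` "dead": the new vertex tag is a
vertex at another location, and no vertex at `i` follows it. This place is late enough that no
action of `i` comes after the crash, because tasks of `i` have action tag `⊥` once `i` is inactive
and no later tag is at `i`. It is early enough for the failure detector. If `t` witnesses viability
and `crash_i` precedes an output in `t`, then `i` is dead as soon as that output has occurred on the
branch. Hence the crashes and outputs along `b` are a constrained reordering of a valid subsequence
of `t`, and strong sampling with closure under reordering puts them into `T_D`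
(`compress_slot_mem`). Therefore every fair branch satisfies decision, agreement and validity
(`consensus_of_isFairBranch`, summarised in `Complies`).

Existence of a gadget. Scheduling all proposals of `v` first forces the decision `v`, so the root is
bivalent. If every label could always be scheduled after some further path so as to end in a
bivalent node, alternating over all labels would give a fair branch through bivalent nodes for ever,
which contradicts that it decides. So some bivalent node `N` and label `l` have the property that
every `l`-edge below `N` ends in a univalent node. Edges with action tag `⊥` change neither tag nor
configuration, so `N` and all paths below it may be taken without `⊥`. If there were no fork and no
hook, the valence after an `l`-edge would be the same `v₀` all along these paths, although one of
them decides `!v₀` (`Complies.exists_isNonBotDecisionGadget`).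

The limit. In a viable observation each vertex has finitely many predecessors, since they come
earlier in `t`. Hence only finitely many nodes have depth plus index at most `K`. A node of weight
at least `L` has rank at least `L` in every tree of height at least `L`, and the Cantor pairing
dominates its arguments, so a gadget of metric value at most `K` consists of such small nodes
(`gadget_small`). For large `x` the tree of `G_x` agrees with that of `G` on these finitely many
nodes, valences included (`eventually_agrees`): a reachable decision in `G` has a finite witness,
and a witness in `G_x` becomes one in `G` when its `⊥`-edges are deleted. So the small gadgets,
their ranks and the minimum are the same in both trees (`exists_isFirstNonBotDecisionGadget`). -/

namespace CHT

/-! ### Sequences given by partial functions on the natural numbers -/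

section Compress

variable {α : Type u}

open Classical in
/-- The number of positions below `m` at which `s` is defined. -/
noncomputable def countSome (s : ℕ → Option α) (m : ℕ) : ℕ := Nat.count (fun k => (s k).isSome) m

theorem countSome_zero (s : ℕ → Option α) : countSome s 0 = 0 := by
  classical exact Nat.count_zero _

theorem countSome_succ_some {s : ℕ → Option α} {m : ℕ} {a : α} (h : s m = some a) :
    countSome s (m + 1) = countSome s m + 1 := by
  classical
  rw [countSome, Nat.count_succ, if_pos (by simp [h]), countSome]

theorem countSome_succ_none {s : ℕ → Option α} {m : ℕ} (h : s m = none) :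
    countSome s (m + 1) = countSome s m := by
  classical
  rw [countSome, Nat.count_succ, if_neg (by simp [h]), countSome, add_zero]

theorem countSome_mono (s : ℕ → Option α) : Monotone (countSome s) := by
  classical exact Nat.count_monotone _

theorem countSome_lt {s : ℕ → Option α} {m k : ℕ} {a : α} (h : s m = some a) (hk : m < k) :
    countSome s m < countSome s k := by
  have := countSome_mono s hk
  rw [Nat.succ_eq_add_one, countSome_succ_some h] at this
  omega

/-- `countSome s m` is the place of the value at `m` in `compress s`. This equivalence reduces
questions about the order in the compressed sequence to the order of the original positions. -/
theorem countSome_lt_iff {s : ℕ → Option α} {m k : ℕ} {a : α} (h : s m = some a) :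
    countSome s m < countSome s k ↔ m < k :=
  ⟨fun hlt => lt_of_not_ge fun hle => absurd (countSome_mono s hle) (by omega), countSome_lt h⟩

theorem countSome_inj {s : ℕ → Option α} {m k : ℕ} {a b : α} (h : s m = some a) (hk : s k = some b)
    (he : countSome s m = countSome s k) : m = k := by
  rcases lt_trichotomy m k with hlt | rfl | hlt
  · exact absurd (countSome_lt h hlt) (by omega)
  · rfl
  · exact absurd (countSome_lt hk hlt) (by omega)

theorem exists_countSome_eq {s : ℕ → Option α} {j m : ℕ} (h : j < countSome s m) :
    ∃ k < m, ∃ a, s k = some a ∧ countSome s k = j := by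
  induction m with
  | zero => simp [countSome] at h
  | succ m ih =>
    rcases hs : s m with _ | a
    · rw [countSome_succ_none hs] at h
      obtain ⟨k, hk, h⟩ := ih h
      exact ⟨k, by omega, h⟩
    · by_cases hlt : j < countSome s m
      · obtain ⟨k, hk, h⟩ := ih hlt
        exact ⟨k, by omega, h⟩
      · rw [countSome_succ_some hs] at h
        exact ⟨m, by omega, a, hs, by omega⟩

open Classical in
/-- The sequence of the values of `s`, in increasing order of their positions. -/
noncomputable def compress (s : ℕ → Option α) : Stream'.Seq α :=
  ⟨fun j => if h : ∃ m, (s m).isSome ∧ countSome s m = j then s h.choose else none, by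
    intro j hj
    have hno : ¬ ∃ m, (s m).isSome ∧ countSome s m = j := by
      intro h
      have hj' : s h.choose = none := (dif_pos h).symm.trans hj
      have := h.choose_spec.1
      rw [hj'] at this
      simp at this
    refine dif_neg ?_
    rintro ⟨m, hm, hc⟩
    obtain ⟨k, -, a, hk, hk'⟩ := exists_countSome_eq (s := s) (j := j) (m := m) (by omega)
    exact hno ⟨k, by simp [hk], hk'⟩⟩

theorem compress_get?_eq_some {s : ℕ → Option α} {j : ℕ} {a : α} :
    (compress s).get? j = some a ↔ ∃ m, s m = some a ∧ countSome s m = j := by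
  classical
  change (if h : ∃ m, (s m).isSome ∧ countSome s m = j then s h.choose else none) = some a ↔ _
  constructor
  · intro h
    split_ifs at h with h'
    exact ⟨_, h, h'.choose_spec.2⟩
  · rintro ⟨m, hm, hc⟩
    have h' : ∃ m, (s m).isSome ∧ countSome s m = j := ⟨m, by simp [hm], hc⟩
    obtain ⟨b, hb⟩ := Option.isSome_iff_exists.1 h'.choose_spec.1
    have : h'.choose = m := countSome_inj hb hm (h'.choose_spec.2.trans hc.symm)
    rw [dif_pos h', this, hm]

theorem compress_get?_count {s : ℕ → Option α} {m : ℕ} {a : α} (h : s m = some a) :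
    (compress s).get? (countSome s m) = some a := compress_get?_eq_some.2 ⟨m, h, rfl⟩

theorem mem_compress {s : ℕ → Option α} {a : α} : a ∈ compress s ↔ ∃ m, s m = some a := by
  rw [Stream'.Seq.mem_iff_exists_get?]
  constructor
  · rintro ⟨j, hj⟩
    obtain ⟨m, hm, -⟩ := compress_get?_eq_some.1 hj.symm
    exact ⟨m, hm⟩
  · rintro ⟨m, hm⟩
    exact ⟨_, (compress_get?_count hm).symm⟩

theorem seq_ext_some {t t' : Stream'.Seq α} (h : ∀ k a, t.get? k = some a ↔ t'.get? k = some a) :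
    t = t' := Stream'.Seq.ext fun k => Option.ext fun a => h k a

theorem get?_isSome_of_le {t : Stream'.Seq α} {m k : ℕ} (h : m ≤ k) (hk : (t.get? k).isSome) :
    (t.get? m).isSome := by
  obtain ⟨a, ha⟩ := Option.isSome_iff_exists.1 hk
  obtain ⟨b, hb⟩ := t.ge_stable h ha
  simp [hb]

theorem countSome_get? {t : Stream'.Seq α} {k : ℕ} {a : α} (h : t.get? k = some a) :
    countSome t.get? k = k := by
  have : ∀ m ≤ k, countSome t.get? m = m := by
    intro m
    induction m with
    | zero => intro _; simp [countSome]
    | succ m ih =>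
      intro hm
      obtain ⟨b, hb⟩ := Option.isSome_iff_exists.1
        (get?_isSome_of_le (t := t) (m := m) (k := k) (by omega) (by simp [h]))
      rw [countSome_succ_some hb, ih (by omega)]
  exact this k le_rfl

theorem compress_get? (t : Stream'.Seq α) : compress t.get? = t := by
  refine seq_ext_some fun k a => ?_
  rw [compress_get?_eq_some]
  constructor
  · rintro ⟨m, hm, rfl⟩
    rwa [countSome_get? hm]
  · exact fun h => ⟨k, h, countSome_get? h⟩

open Classical in
/-- The restriction of `s` to the positions that satisfy `p`. -/
noncomputable def keep (s : ℕ → Option α) (p : ℕ → Prop) : ℕ → Option α :=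
  fun m => if p m then s m else none

theorem keep_eq_some {s : ℕ → Option α} {p : ℕ → Prop} {m : ℕ} {a : α} :
    keep s p m = some a ↔ p m ∧ s m = some a := by
  classical
  unfold keep
  split_ifs with h <;> simp [h]

theorem keep_eq_none {s : ℕ → Option α} {p : ℕ → Prop} {m : ℕ} (h : s m = none) :
    keep s p m = none := by
  classical
  unfold keep
  split_ifs <;> simp [h]

theorem keep_congr {s : ℕ → Option α} {p q : ℕ → Prop}
    (h : ∀ m a, s m = some a → (p m ↔ q m)) : keep s p = keep s q := by
  funext m
  refine Option.ext fun a => ?_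
  rw [keep_eq_some, keep_eq_some]
  exact ⟨fun ⟨h1, h2⟩ => ⟨(h m a h2).1 h1, h2⟩, fun ⟨h1, h2⟩ => ⟨(h m a h2).2 h1, h2⟩⟩

/-- The restriction of `s` to the positions with values in `B`. -/
noncomputable def keepIn (B : Set α) (s : ℕ → Option α) : ℕ → Option α :=
  keep s (fun m => ∃ a ∈ B, s m = some a)

theorem keepIn_eq_some {s : ℕ → Option α} {B : Set α} {m : ℕ} {a : α} :
    keepIn B s m = some a ↔ s m = some a ∧ a ∈ B := by
  rw [keepIn, keep_eq_some]
  constructor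
  · rintro ⟨⟨b, hb, h⟩, h'⟩
    rw [h] at h'
    cases h'
    exact ⟨h, hb⟩
  · exact fun ⟨h, h'⟩ => ⟨⟨a, h', h⟩, h⟩

/-- Replaces the choice in `select` by `compress`, so that projections and subsequences are handled
through partial functions on fixed positions. -/
theorem select_eq_compress (t : Stream'.Seq α) (p : ℕ → Prop) :
    select t p = compress (keep t.get? p) := by
  classical
  have hcount : ∀ k, Nat.count (fun k => p k ∧ (t.get? k).isSome) k =
      countSome (keep t.get? p) k := by
    intro k
    rw [countSome]
    congr 1
    funext m
    unfold keep
    split_ifs with h <;> simp [h]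
  refine seq_ext_some fun j a => ?_
  rw [compress_get?_eq_some]
  change (if h : ∃ k, (p k ∧ (t.get? k).isSome) ∧
        Nat.count (fun k => p k ∧ (t.get? k).isSome) k = j
      then t.get? h.choose else none) = some a ↔ _
  constructor
  · intro h
    split_ifs at h with h'
    exact ⟨_, keep_eq_some.2 ⟨h'.choose_spec.1.1, h⟩, (hcount _).symm.trans h'.choose_spec.2⟩
  · rintro ⟨m, hm, hc⟩
    obtain ⟨hp, hm'⟩ := keep_eq_some.1 hm
    have h' : ∃ k, (p k ∧ (t.get? k).isSome) ∧
        Nat.count (fun k => p k ∧ (t.get? k).isSome) k = j :=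
      ⟨m, ⟨hp, by simp [hm']⟩, (hcount m).trans hc⟩
    obtain ⟨b, hb⟩ := Option.isSome_iff_exists.1 h'.choose_spec.1.2
    have hk : keep t.get? p h'.choose = some b := keep_eq_some.2 ⟨h'.choose_spec.1.1, hb⟩
    have : h'.choose = m :=
      countSome_inj hk hm (((hcount _).symm.trans h'.choose_spec.2).trans hc.symm)
    rw [dif_pos h', this, hm']

/-- The kept entries counted in `compress s` up to the place `countSome s m` are the kept entries of
`s` below `m`. So compressing twice is the same as compressing once. -/
theorem compress_keep_compress (s : ℕ → Option α) (p : ℕ → Prop) :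
    compress (keep (compress s).get? p) = compress (keep s (fun m => p (countSome s m))) := by
  have hcount : ∀ m, countSome (keep (compress s).get? p) (countSome s m) =
      countSome (keep s (fun m => p (countSome s m))) m := by
    classical
    intro m
    induction m with
    | zero => simp only [countSome_zero]
    | succ m ih =>
      rcases hs : s m with _ | a
      · rw [countSome_succ_none hs, ih, countSome_succ_none (keep_eq_none hs)]
      · rw [countSome_succ_some hs]
        have hg := compress_get?_count hs
        by_cases hp : p (countSome s m)
        · rw [countSome_succ_some (keep_eq_some.2 ⟨hp, hg⟩), ih,
            countSome_succ_some
              (keep_eq_some (p := fun m => p (countSome s m)).2 ⟨hp, hs⟩)]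
        · rw [countSome_succ_none (by unfold keep; simp [hp]), ih,
            countSome_succ_none (by unfold keep; simp [hp])]
  refine seq_ext_some fun j a => ?_
  simp only [compress_get?_eq_some, keep_eq_some]
  constructor
  · rintro ⟨_, ⟨hp, m, hm, rfl⟩, hc⟩
    exact ⟨m, ⟨hp, hm⟩, (hcount m).symm.trans hc⟩
  · rintro ⟨m, ⟨hp, hm⟩, hc⟩
    exact ⟨_, ⟨hp, m, hm, rfl⟩, (hcount m).trans hc⟩

theorem proj_compress (B : Set α) (s : ℕ → Option α) :
    proj B (compress s) = compress (keepIn B s) := by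
  rw [proj, select_eq_compress, compress_keep_compress, keepIn]
  congr 1
  refine keep_congr fun m a hm => ?_
  simp only [compress_get?_count hm, hm]

theorem proj_eq_compress (B : Set α) (t : Stream'.Seq α) :
    proj B t = compress (keepIn B t.get?) := by
  conv_lhs => rw [← compress_get? t]
  rw [proj_compress]

theorem keepIn_keepIn {B B' : Set α} (h : B ⊆ B') (s : ℕ → Option α) :
    keepIn B (keepIn B' s) = keepIn B s := by
  funext m
  refine Option.ext fun a => ?_
  simp only [keepIn_eq_some]
  exact ⟨fun ⟨⟨h1, _⟩, h2⟩ => ⟨h1, h2⟩, fun ⟨h1, h2⟩ => ⟨⟨h1, h h2⟩, h2⟩⟩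

theorem keepIn_eq_self {B : Set α} {s : ℕ → Option α} (h : ∀ m a, s m = some a → a ∈ B) :
    keepIn B s = s := by
  funext m
  refine Option.ext fun a => ?_
  rw [keepIn_eq_some]
  exact ⟨fun h' => h'.1, fun h' => ⟨h', h m a h'⟩⟩

theorem hasLength_compress {s : ℕ → Option α} {L : ℕ} (h : ∀ m ≥ L, s m = none) :
    HasLength (compress s) (countSome s L) := by
  constructor
  · rw [Option.eq_none_iff_forall_ne_some]
    intro a ha
    obtain ⟨m, hm, hc⟩ := compress_get?_eq_some.1 ha
    have hlt : m < L := lt_of_not_ge fun hge => by rw [h m hge] at hm; cases hm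
    exact absurd (countSome_lt hm hlt) (by omega)
  · intro k hk
    obtain ⟨m, -, a, hm, rfl⟩ := exists_countSome_eq hk
    simp [compress_get?_count hm]

/-- A set of positions of `compress s` is infinite if it corresponds to infinitely many positions
of `s`. -/
theorem infinite_of_frequently {s : ℕ → Option α} (hs : ∀ K, ∃ m ≥ K, (s m).isSome)
    {P : ℕ → Prop} (h : ∀ K, ∃ m ≥ K, P (countSome s m)) : {k | P k}.Infinite := by
  -- Since `s` is defined again and again, the places in `compress s` are unbounded.
  have hunb : ∀ N, ∃ m, N ≤ countSome s m := by
    intro N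
    induction N with
    | zero => exact ⟨0, Nat.zero_le _⟩
    | succ N ih =>
      obtain ⟨m, hm⟩ := ih
      obtain ⟨m', hm', h'⟩ := hs m
      obtain ⟨a, ha⟩ := Option.isSome_iff_exists.1 h'
      refine ⟨m' + 1, ?_⟩
      rw [countSome_succ_some ha]
      have := countSome_mono s hm'
      omega
  rw [Set.infinite_iff_exists_gt]
  intro N
  obtain ⟨K, hK⟩ := hunb (N + 1)
  obtain ⟨m, hm, hP⟩ := h K
  exact ⟨_, hP, by have := countSome_mono s hm; omega⟩

theorem not_hasLength_compress {s : ℕ → Option α} (hs : ∀ K, ∃ m ≥ K, (s m).isSome) (L : ℕ) :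
    ¬ HasLength (compress s) L := by
  rintro ⟨h, -⟩
  have hinf : {k | L < k}.Infinite := Set.Ioi_infinite L
  have : {k | ((compress s).get? k).isSome}.Infinite := by
    refine infinite_of_frequently hs (P := fun k => ((compress s).get? k).isSome) fun K => ?_
    obtain ⟨m, hm, h'⟩ := hs K
    obtain ⟨a, ha⟩ := Option.isSome_iff_exists.1 h'
    exact ⟨m, hm, by simp [compress_get?_count ha]⟩
  obtain ⟨k, hk, hlt⟩ := this.exists_gt L
  have := get?_isSome_of_le (t := compress s) hlt.le hk
  rw [h] at this
  simp at this

/-- If `σ` changes only at the positions where `s` is defined, it factors through the number of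
these positions. -/
theorem exists_factor_countSome {β : Type*} {s : ℕ → Option α} (σ : ℕ → β)
    (h : ∀ m, s m = none → σ (m + 1) = σ m) : ∃ ρ : ℕ → β, ∀ m, ρ (countSome s m) = σ m := by
  classical
  have hle : ∀ m k, m ≤ k → countSome s m = countSome s k → σ m = σ k := by
    intro m k hmk
    induction k, hmk using Nat.le_induction with
    | base => intro _; rfl
    | succ k hk ih =>
      intro hc
      have h1 := countSome_mono s hk
      rcases hsk : s k with _ | a
      · rw [countSome_succ_none hsk] at hc
        rw [h k hsk, ih hc]
      · rw [countSome_succ_some hsk] at hc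
        omega
  refine ⟨fun j => if hj : ∃ m, countSome s m = j then σ hj.choose else σ 0, fun m => ?_⟩
  have hj : ∃ m', countSome s m' = countSome s m := ⟨m, rfl⟩
  simp only [dif_pos hj]
  rcases le_total hj.choose m with hc | hc
  · exact hle _ _ hc hj.choose_spec
  · exact (hle _ _ hc hj.choose_spec.symm).symm

/-- The positions of `compress s` correspond to the positions at which `s` is defined. -/
theorem exists_equiv_positions (s : ℕ → Option α) :
    ∃ e : {m // (s m).isSome} ≃ {k // ((compress s).get? k).isSome},
      ∀ m, (e m : ℕ) = countSome s m := by
  have hmem : ∀ m : {m // (s m).isSome}, ((compress s).get? (countSome s m)).isSome := by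
    rintro ⟨m, hm⟩
    obtain ⟨a, ha⟩ := Option.isSome_iff_exists.1 hm
    simp [compress_get?_count ha]
  refine ⟨Equiv.ofBijective (fun m => ⟨countSome s m, hmem m⟩) ⟨?_, ?_⟩, fun m => rfl⟩
  · rintro ⟨m, hm⟩ ⟨k, hk⟩ h
    obtain ⟨a, ha⟩ := Option.isSome_iff_exists.1 hm
    obtain ⟨b, hb⟩ := Option.isSome_iff_exists.1 hk
    exact Subtype.ext (countSome_inj ha hb (congrArg Subtype.val h))
  · rintro ⟨k, hk⟩
    obtain ⟨a, ha⟩ := Option.isSome_iff_exists.1 hk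
    obtain ⟨m, hm, hc⟩ := compress_get?_eq_some.1 ha
    exact ⟨⟨m, by simp [hm]⟩, Subtype.ext hc⟩

theorem isSubseqVia_compress_keep (t : Stream'.Seq α) (p : ℕ → Prop) :
    ∃ φ, IsSubseqVia φ (compress (keep t.get? p)) t := by
  classical
  have h : ∀ k, ∃ m, ∀ a, (compress (keep t.get? p)).get? k = some a →
      keep t.get? p m = some a ∧ countSome (keep t.get? p) m = k := by
    intro k
    by_cases hk : ∃ a, (compress (keep t.get? p)).get? k = some a
    · obtain ⟨a, ha⟩ := hk
      obtain ⟨m, hm⟩ := compress_get?_eq_some.1 ha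
      refine ⟨m, fun b hb => ?_⟩
      rw [ha] at hb
      cases hb
      exact hm
    · exact ⟨0, fun a ha => absurd ⟨a, ha⟩ hk⟩
  choose φ hφ using h
  refine ⟨φ, ?_, fun k a hk => (keep_eq_some.1 (hφ k a hk).1).2⟩
  intro k hk k' hk' hlt
  obtain ⟨a, ha⟩ := Option.isSome_iff_exists.1 hk
  obtain ⟨b, hb⟩ := Option.isSome_iff_exists.1 hk'
  obtain ⟨h1, h2⟩ := hφ k a ha
  obtain ⟨h3, h4⟩ := hφ k' b hb
  exact (countSome_lt_iff h1).1 (by omega)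

/-- The values of `s` are among those of `t`, the one at `m` being that of `t` at `g m`. Then the
subsequence of these values of `t` is a rearrangement of `compress s`. -/
theorem exists_equiv_of_injOn {s : ℕ → Option α} {t : Stream'.Seq α} {g : ℕ → ℕ}
    (hg : ∀ m a, s m = some a → t.get? (g m) = some a)
    (hinj : ∀ m m', (s m).isSome → (s m').isSome → g m = g m' → m = m') :
    ∃ π : {k // ((compress (keep t.get? (fun k => ∃ m, (s m).isSome ∧ g m = k))).get? k).isSome} ≃
        {k // ((compress s).get? k).isSome},
      ∀ k, ∃ m a, s m = some a ∧ (π k : ℕ) = countSome s m ∧ (compress s).get? (π k) = some a ∧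
        (k : ℕ) = countSome (keep t.get? (fun k => ∃ m, (s m).isSome ∧ g m = k)) (g m) ∧
        (compress (keep t.get? (fun k => ∃ m, (s m).isSome ∧ g m = k))).get? k = some a := by
  set s' := keep t.get? (fun k => ∃ m, (s m).isSome ∧ g m = k) with hs'
  have hval : ∀ m a, s m = some a → s' (g m) = some a := fun m a hm =>
    keep_eq_some.2 ⟨⟨m, by simp [hm], rfl⟩, hg m a hm⟩
  have hsome : ∀ m : {m // (s m).isSome}, (s' (g m)).isSome := by
    rintro ⟨m, hm⟩
    obtain ⟨a, ha⟩ := Option.isSome_iff_exists.1 hm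
    simp [hval m a ha]
  obtain ⟨e, he⟩ := exists_equiv_positions s
  obtain ⟨e', he'⟩ := exists_equiv_positions s'
  let γ : {m // (s m).isSome} ≃ {m // (s' m).isSome} :=
    Equiv.ofBijective (fun m => ⟨g m, hsome m⟩)
      ⟨fun m m' h => Subtype.ext (hinj m m' m.2 m'.2 (congrArg Subtype.val h)), by
        rintro ⟨k, hk⟩
        obtain ⟨a, ha⟩ := Option.isSome_iff_exists.1 hk
        obtain ⟨⟨m, hm, h⟩, -⟩ := keep_eq_some.1 ha
        exact ⟨⟨m, hm⟩, Subtype.ext h⟩⟩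
  -- From a place in the subsequence of `t` to its position in `t`, back along `g` to a position of
  -- `s`, and on to its place in `compress s`.
  refine ⟨e'.symm.trans (γ.symm.trans e), fun k => ?_⟩
  obtain ⟨m, rfl⟩ := (γ.trans e').surjective k
  obtain ⟨a, ha⟩ := Option.isSome_iff_exists.1 m.2
  have h1 : ((e'.symm.trans (γ.symm.trans e)) ((γ.trans e') m) : ℕ) = countSome s m := by
    simp [he]
  have h2 : (((γ.trans e') m : _) : ℕ) = countSome s' (g m) := by
    simp only [Equiv.trans_apply, he']
    rfl
  refine ⟨m, a, ha, h1, ?_, h2, ?_⟩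
  · rw [h1]; exact compress_get?_count ha
  · rw [h2]; exact compress_get?_count (hval m a ha)

end Compress

end CHT

namespace CHT

variable {n : ℕ} {M O X : Type u} {D : Problem (Act n M O X)}

/-! ### Paths in execution trees -/

/-- The vertex tag at the end of a path from a node with vertex tag `v`. -/
def endTag : VTag n M O X → Node n M O X → VTag n M O X
  | v, [] => v
  | _, (_, w) :: p => endTag w p

theorem endTag_append (v : VTag n M O X) (p q : Node n M O X) :
    endTag v (p ++ q) = endTag (endTag v p) q := by
  induction p generalizing v with
  | nil => rfl
  | cons e p ih => exact ih _

theorem vtag_append_singleton (N : Node n M O X) (e : Label n × VTag n M O X) :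
    Node.vtag (N ++ [e]) = e.2 := by
  simp [Node.vtag]

theorem vtag_eq_endTag (N : Node n M O X) : Node.vtag N = endTag none N := by
  induction N using List.reverseRecOn with
  | nil => rfl
  | append_singleton N e _ => rw [vtag_append_singleton, endTag_append]; rfl

namespace Observation

variable {G G₁ G₂ : Observation D} {v w : VTag n M O X}

theorem Follows.mem {u : Vertex n M O X} (h : G.Follows v u) : u ∈ G.V := by
  cases v with
  | none => exact h
  | some w => exact (G.edge_mem _ _ h).2

theorem Follows.trans {u u' : Vertex n M O X} (h : G.Follows v u) (h' : G.E u u') :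
    G.Follows v u' := by
  cases v with
  | none => exact (G.edge_mem _ _ h').2
  | some w => exact G.edge_trans _ _ _ h h'

theorem not_edge_self (G : Observation D) (u : Vertex n M O X) : ¬ G.E u u :=
  fun h => G.acyclic u (.single h)

theorem not_follows_self (G : Observation D) (u : Vertex n M O X) : ¬ G.Follows (some u) u :=
  G.not_edge_self u

theorem exists_edgeOut (G : Observation D) (v : VTag n M O X) (l : Label n) :
    ∃ w, G.EdgeOut v l w := by
  cases l with
  | fd i =>
    by_cases h : G.Active v i
    · obtain ⟨u, hu, hi⟩ := h
      exact ⟨some u, Or.inl ⟨u, hu, hi, rfl⟩⟩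
    · exact ⟨v, Or.inr ⟨h, rfl⟩⟩
  | proc i => exact ⟨v, rfl⟩
  | env i x => exact ⟨v, rfl⟩
  | chan i j h => exact ⟨v, rfl⟩

theorem pathFrom_append {p q : Node n M O X} :
    G.PathFrom v (p ++ q) ↔ G.PathFrom v p ∧ G.PathFrom (endTag v p) q := by
  induction p generalizing v with
  | nil => simp [PathFrom, endTag]
  | cons e p ih =>
    obtain ⟨l, w⟩ := e
    simp [PathFrom, endTag, ih, and_assoc]

theorem pathFrom_singleton {e : Label n × VTag n M O X} :
    G.PathFrom v [e] ↔ G.EdgeOut v e.1 e.2 := by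
  obtain ⟨l, w⟩ := e
  simp [PathFrom]

/-- `w` is `v` or follows `v`. -/
def TagLE (G : Observation D) (v w : VTag n M O X) : Prop :=
  w = v ∨ ∃ u, w = some u ∧ G.Follows v u

theorem TagLE.refl (G : Observation D) (v : VTag n M O X) : G.TagLE v v := Or.inl rfl

theorem TagLE.follows {u : Vertex n M O X} (h : G.TagLE v w) (hu : G.Follows w u) :
    G.Follows v u := by
  rcases h with rfl | ⟨u', rfl, h⟩
  · exact hu
  · exact h.trans hu

theorem TagLE.active {i : Fin n} (h : G.TagLE v w) (hw : G.Active w i) : G.Active v i := by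
  obtain ⟨u, hu, hi⟩ := hw
  exact ⟨u, h.follows hu, hi⟩

theorem TagLE.trans {v' : VTag n M O X} (h : G.TagLE v w) (h' : G.TagLE w v') :
    G.TagLE v v' := by
  rcases h' with rfl | ⟨u, rfl, hu⟩
  · exact h
  · exact Or.inr ⟨u, rfl, h.follows hu⟩

theorem EdgeOut.tagLE {l : Label n} (h : G.EdgeOut v l w) : G.TagLE v w := by
  cases l with
  | fd i =>
    rcases h with ⟨u, hu, -, rfl⟩ | ⟨-, rfl⟩
    · exact Or.inr ⟨u, rfl, hu⟩
    · exact Or.inl rfl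
  | proc i => exact Or.inl h
  | env i x => exact Or.inl h
  | chan i j hij => exact Or.inl h

/-- From a vertex at another location there is an edge to a vertex at the live location. From a
vertex at `i` itself there is an edge to its successor, which exists because the indices at `i` are
unbounded and closed downwards. -/
theorem active_of_live {i : Fin n} (hi : i ∈ G.live)
    (hv : ∀ u, v = some u → u ∈ G.V) : G.Active v i := by
  cases v with
  | none =>
    obtain ⟨u, hu, hi⟩ := Set.Infinite.nonempty hi
    exact ⟨u, hu, hi⟩
  | some w =>
    have hw := hv w rfl
    by_cases hwi : w.loc = i
    · have hinj : Set.InjOn Vertex.idx {v | v ∈ G.V ∧ v.loc = i} := fun a ha b hb h =>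
        G.unique a ha.1 b hb.1 (ha.2.trans hb.2.symm) h
      obtain ⟨-, ⟨u, ⟨hu, hui⟩, rfl⟩, hlt⟩ := (Set.Infinite.image hinj hi).exists_gt (w.idx + 1)
      obtain ⟨u', hu', hloc, hidx⟩ := G.down_closed u hu (w.idx + 1) (by omega) hlt
      exact ⟨u', G.succ_edge w hw u' hu' (by rw [hwi, hloc, hui]) hidx, hloc.trans hui⟩
    · obtain ⟨u, -, hu, hE⟩ := G.edge_to_live w.loc i hwi hi w hw rfl
      exact ⟨u, hE, hu⟩

end Observation

namespace Algorithm

variable {A : Algorithm D} {G G₁ G₂ : Observation D} {v w : VTag n M O X} {c : A.system.State}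

theorem actionsFrom_append (p q : Node n M O X) :
    A.actionsFrom G c v (p ++ q) =
      A.actionsFrom G c v p ++ A.actionsFrom G (A.configFrom G c v p) (endTag v p) q := by
  induction p generalizing v c with
  | nil => rfl
  | cons e p ih =>
    obtain ⟨l, w⟩ := e
    simp [actionsFrom, configFrom, endTag, ih]

theorem configFrom_append (p q : Node n M O X) :
    A.configFrom G c v (p ++ q) = A.configFrom G (A.configFrom G c v p) (endTag v p) q := by
  induction p generalizing v c with
  | nil => rfl
  | cons e p ih =>
    obtain ⟨l, w⟩ := e
    simp [configFrom, endTag, ih]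

theorem pathActions_append (N q : Node n M O X) : A.pathActions G (N ++ q) =
    A.pathActions G N ++ A.actionsFrom G (A.config G N) (Node.vtag N) q := by
  rw [pathActions, actionsFrom_append, vtag_eq_endTag]
  rfl

/-- An edge with action tag `⊥` does not change the vertex tag. -/
theorem tag_eq_of_edgeAction_eq_none {l : Label n} (h : G.EdgeOut v l w)
    (ha : A.edgeAction G c v l w = none) : w = v := by
  classical
  cases l with
  | fd i =>
    rcases h with ⟨u, -, -, rfl⟩ | ⟨-, rfl⟩
    · by_contra hne
      simp [edgeAction, hne] at ha
    · rfl
  | proc i => exact h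
  | env i x => exact h
  | chan i j hij => exact h

/-- An edge whose action tag is not `⊥` is also an edge, with the same action tag, in the tree of
an observation with more edges and vertices. -/
theorem edgeOut_and_edgeAction_of_sub {l : Label n} {a : Act n M O X}
    (hG : ∀ v u, G₁.Follows v u → G₂.Follows v u) (h : G₁.EdgeOut v l w)
    (ha : A.edgeAction G₁ c v l w = some a) :
    G₂.EdgeOut v l w ∧ A.edgeAction G₂ c v l w = some a := by
  classical
  have hact : ∀ i, G₁.Active v i → G₂.Active v i := fun i ⟨u, hu, hi⟩ => ⟨u, hG _ _ hu, hi⟩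
  cases l with
  | fd i =>
    rcases h with ⟨u, hu, hi, rfl⟩ | ⟨-, rfl⟩
    · exact ⟨Or.inl ⟨u, hG _ _ hu, hi, rfl⟩, ha⟩
    · simp [edgeAction] at ha
  | proc i =>
    refine ⟨h, ?_⟩
    simp only [edgeAction] at ha ⊢
    split_ifs at ha with h'
    rwa [if_pos (hact _ h')]
  | env i x =>
    refine ⟨h, ?_⟩
    simp only [edgeAction] at ha ⊢
    split_ifs at ha with h'
    rwa [if_pos (hact _ h')]
  | chan i j hij => exact ⟨h, ha⟩

/-- The edges with action tag `⊥` can be removed from a path. -/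
theorem exists_path_without_bot (hG : ∀ v u, G₁.Follows v u → G₂.Follows v u)
    (p : Node n M O X) (hp : G₁.PathFrom v p) :
    ∃ p', G₂.PathFrom v p' ∧ none ∉ A.actionsFrom G₂ c v p' ∧
      A.configFrom G₂ c v p' = A.configFrom G₁ c v p ∧ endTag v p' = endTag v p ∧
      ∀ a, some a ∈ A.actionsFrom G₂ c v p' ↔ some a ∈ A.actionsFrom G₁ c v p := by
  induction p generalizing v c with
  | nil => exact ⟨[], trivial, by simp [actionsFrom], rfl, rfl, fun a => Iff.rfl⟩
  | cons e p ih =>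
    obtain ⟨l, w⟩ := e
    obtain ⟨he, hp⟩ := hp
    rcases ha : A.edgeAction G₁ c v l w with _ | a
    · obtain rfl := tag_eq_of_edgeAction_eq_none he ha
      obtain ⟨p', h1, h2, h3, h4, h5⟩ := ih (c := c) hp
      refine ⟨p', h1, h2, ?_, h4, fun a => ?_⟩
      · simp only [configFrom, ha, applyAction, h3]
      · simp only [actionsFrom, ha, applyAction, h5, List.mem_cons]
        simp
    · obtain ⟨he', ha'⟩ := edgeOut_and_edgeAction_of_sub hG he ha
      obtain ⟨p', h1, h2, h3, h4, h5⟩ := ih (c := A.applyAction c (some a)) hp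
      refine ⟨(l, w) :: p', ⟨he', h1⟩, ?_, ?_, h4, fun b => ?_⟩
      · simp [actionsFrom, ha', h2]
      · simp only [configFrom, ha', ha, h3]
      · simp only [actionsFrom, ha', ha, List.mem_cons, h5]

end Algorithm

/-! ### Labels -/

/-- The four families of labels occupy consecutive disjoint blocks, and within the channel block
each sender has `n - 1` values of its own. -/
theorem Label.metric_injective : Function.Injective (Label.metric (n := n)) := by
  have hchan : ∀ (i j : Fin n), i ≠ j → (if j < i then (j : ℕ) + 1 else j) ≤ n - 1 ∧
      0 < (if j < i then (j : ℕ) + 1 else j) := by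
    intro i j hij
    have h1 := i.2
    have h2 := j.2
    have h3 : (i : ℕ) ≠ j := fun h => hij (Fin.ext h)
    split_ifs with h
    · rw [Fin.lt_def] at h; omega
    · rw [Fin.lt_def] at h; omega
  -- Says that the channel block ends at `n ^ 2 + 2 * n`, just before the `FD` block.
  have hmul : ∀ i : Fin n, (n - 1) * (i : ℕ) + (n - 1) + n ≤ n ^ 2 := by
    intro i
    have h1 := i.2
    obtain ⟨m, rfl⟩ : ∃ m, n = m + 1 := ⟨n - 1, by omega⟩
    simp only [Nat.add_sub_cancel]
    have : m * (i : ℕ) ≤ m * m := Nat.mul_le_mul_left _ (by omega)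
    nlinarith
  intro l r h
  cases l with
  | proc i =>
    cases r with
    | proc j =>
      simp only [Label.metric] at h
      rw [show i = j from Fin.ext (by omega)]
    | env j y =>
      simp only [Label.metric] at h
      have := i.2
      split_ifs at h <;> omega
    | chan j k hjk =>
      simp only [Label.metric] at h
      have := i.2
      have := hchan j k hjk
      omega
    | fd j =>
      simp only [Label.metric] at h
      have := i.2
      omega
  | env i x =>
    have hi := i.2
    cases r with
    | proc j =>
      simp only [Label.metric] at h
      have := j.2
      split_ifs at h <;> omega
    | env j y =>
      simp only [Label.metric] at h
      cases x <;> cases y <;> simp at h <;>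
        first
          | (exfalso; omega)
          | (rw [show i = j from Fin.ext (by omega)])
    | chan j k hjk =>
      simp only [Label.metric] at h
      have := hchan j k hjk
      split_ifs at h <;> omega
    | fd j =>
      simp only [Label.metric] at h
      have : 1 * n ≤ n ^ 2 := by rw [pow_two]; exact Nat.mul_le_mul_right _ (by omega)
      split_ifs at h <;> omega
  | chan i k hik =>
    have hc := hchan i k hik
    have hm := hmul i
    cases r with
    | proc j =>
      simp only [Label.metric] at h
      have := j.2
      omega
    | env j y =>
      simp only [Label.metric] at h
      have := j.2
      split_ifs at h <;> omega
    | chan j k' hjk =>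
      have hc' := hchan j k' hjk
      simp only [Label.metric] at h
      have hij : i = j := by
        -- Sub-blocks of length `n - 1` with offsets in `1, …, n - 1` do not overlap.
        have key : ∀ a b x y : ℕ, a < b → x ≤ n - 1 → 0 < y →
            (n - 1) * a + x ≠ (n - 1) * b + y := by
          intro a b x y hab hx hy he
          have : (n - 1) * (a + 1) ≤ (n - 1) * b := Nat.mul_le_mul_left _ hab
          rw [Nat.mul_add, Nat.mul_one] at this
          omega
        rcases lt_trichotomy (i : ℕ) j with hlt | heq | hlt
        · exact absurd (by omega) (key _ _ _ _ hlt hc.1 hc'.2)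
        · exact Fin.ext heq
        · exact absurd (by omega) (key _ _ _ _ hlt hc'.1 hc.2)
      subst hij
      have h3 : (i : ℕ) ≠ k := fun h => hik (Fin.ext h)
      have h4 : (i : ℕ) ≠ k' := fun h => hjk (Fin.ext h)
      have : k = k' := by
        refine Fin.ext ?_
        simp only [Fin.lt_def] at h
        split_ifs at h <;> omega
      subst this
      rfl
    | fd j =>
      simp only [Label.metric] at h
      omega
  | fd i =>
    cases r with
    | proc j =>
      simp only [Label.metric] at h
      have := j.2
      omega
    | env j y =>
      simp only [Label.metric] at h
      have : 1 * n ≤ n ^ 2 := by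
        rw [pow_two]; exact Nat.mul_le_mul_right _ (by have := i.2; omega)
      have := j.2
      split_ifs at h <;> omega
    | chan j k hjk =>
      simp only [Label.metric] at h
      have := hchan j k hjk
      have := hmul j
      omega
    | fd j =>
      simp only [Label.metric] at h
      rw [show i = j from Fin.ext (by omega)]

theorem Label.metric_le (l : Label n) : l.metric ≤ n ^ 2 + 3 * n := by
  cases l with
  | proc i => simp only [Label.metric]; have := i.2; omega
  | env i x =>
    simp only [Label.metric]
    have := i.2
    have : 1 * n ≤ n ^ 2 := by rw [pow_two]; exact Nat.mul_le_mul_right _ (by omega)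
    split_ifs <;> omega
  | chan i j h =>
    have h1 := i.2
    have h2 := j.2
    have h3 : (i : ℕ) ≠ j := fun h' => h (Fin.ext h')
    simp only [Label.metric]
    obtain ⟨m, rfl⟩ : ∃ m, n = m + 1 := ⟨n - 1, by omega⟩
    simp only [Nat.add_sub_cancel]
    have : m * (i : ℕ) ≤ m * m := Nat.mul_le_mul_left _ (by omega)
    split_ifs <;> nlinarith
  | fd i => simp only [Label.metric]; have := i.2; omega

instance : Finite (Label n) :=
  Finite.of_injective (β := Fin (n ^ 2 + 3 * n + 1))
    (fun l => ⟨l.metric, Nat.lt_succ_of_le l.metric_le⟩)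
    fun _ _ h => Label.metric_injective (congrArg Fin.val h)

/-- Project an enumeration of `α × ℕ` to `α`: every element is hit once for each natural number.
Used as a schedule in which each label recurs. -/
theorem exists_seq_frequently {α : Type*} [Nonempty α] [Countable α] :
    ∃ f : ℕ → α, ∀ a K, ∃ k ≥ K, f k = a := by
  obtain ⟨g, hg⟩ := exists_surjective_nat (α × ℕ)
  refine ⟨fun k => (g k).1, fun a K => ?_⟩
  have hinf : {k | (g k).1 = a}.Infinite := by
    refine Set.infinite_of_injective_forall_mem (f := fun m : ℕ => (hg (a, m)).choose) ?_ ?_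
    · intro m m' h
      have h1 := (hg (a, m)).choose_spec
      have h2 := (hg (a, m')).choose_spec
      simp only at h
      rw [h, h2] at h1
      exact (congrArg Prod.snd h1).symm
    · intro m
      have := (hg (a, m)).choose_spec
      simp only [Set.mem_ofPred_eq]
      rw [this]
  obtain ⟨k, hk, hlt⟩ := hinf.exists_gt K
  exact ⟨k, hlt.le, hk⟩

/-! ### Infinite branches -/

/-- The vertex tags along an infinite branch, starting with that of the root. -/
def tagAt (b : ℕ → Label n × VTag n M O X) : ℕ → VTag n M O X
  | 0 => none
  | k + 1 => (b k).2

/-- The node at depth `k` of an infinite branch. -/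
def nodeAt (b : ℕ → Label n × VTag n M O X) (k : ℕ) : Node n M O X := (List.range k).map b

theorem nodeAt_succ (b : ℕ → Label n × VTag n M O X) (k : ℕ) :
    nodeAt b (k + 1) = nodeAt b k ++ [b k] := by
  simp [nodeAt, List.range_succ]

theorem length_nodeAt (b : ℕ → Label n × VTag n M O X) (k : ℕ) : (nodeAt b k).length = k := by
  simp [nodeAt]

theorem vtag_nodeAt (b : ℕ → Label n × VTag n M O X) (k : ℕ) :
    Node.vtag (nodeAt b k) = tagAt b k := by
  cases k with
  | zero => rfl
  | succ k => rw [nodeAt_succ, vtag_append_singleton]; rfl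

namespace Observation

variable {G : Observation D} {b : ℕ → Label n × VTag n M O X}

/-- Infinite branches from the root on which every label occurs infinitely often. -/
structure IsFairBranch (G : Observation D) (b : ℕ → Label n × VTag n M O X) : Prop where
  edge : ∀ k, G.EdgeOut (tagAt b k) (b k).1 (b k).2
  fair : ∀ l K, ∃ k ≥ K, (b k).1 = l

theorem pathFrom_nodeAt (h : ∀ k, G.EdgeOut (tagAt b k) (b k).1 (b k).2) (k : ℕ) :
    G.PathFrom none (nodeAt b k) := by
  induction k with
  | zero => trivial
  | succ k ih =>
    rw [nodeAt_succ, pathFrom_append, pathFrom_singleton, ← vtag_eq_endTag, vtag_nodeAt]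
    exact ⟨ih, h k⟩

/-- If every path with the property `P` can be extended, by a path that ends with a prescribed
label, to one with this property, then there is a fair branch that has the property again and
again. -/
theorem exists_isFairBranch (hn : 0 < n) {P : Node n M O X → Prop}
    (hP : ∀ N, P N → G.PathFrom none N) {N₀ : Node n M O X} (h₀ : P N₀)
    (hstep : ∀ N, P N → ∀ l, ∃ q w, P (N ++ q ++ [(l, w)])) :
    ∃ b, G.IsFairBranch b ∧ nodeAt b N₀.length = N₀ ∧ ∀ K, ∃ k ≥ K, P (nodeAt b k) := by
  have : Nonempty (Label n) := ⟨.proc ⟨0, hn⟩⟩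
  obtain ⟨f, hf⟩ := exists_seq_frequently (α := Label n)
  choose! q w hqw using hstep
  let F : ℕ → {N // P N} := fun j => Nat.rec ⟨N₀, h₀⟩
    (fun j N => ⟨N.1 ++ q N.1 (f j) ++ [(f j, w N.1 (f j))], hqw N.1 N.2 (f j)⟩) j
  let N : ℕ → Node n M O X := fun j => (F j).1
  have hN0 : N 0 = N₀ := rfl
  have hNs : ∀ j, N (j + 1) = N j ++ q (N j) (f j) ++ [(f j, w (N j) (f j))] := fun j => rfl
  have hPN : ∀ j, P (N j) := fun j => (F j).2
  have hpre : ∀ i j, i ≤ j → N i <+: N j := by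
    intro i j hij
    induction j, hij using Nat.le_induction with
    | base => exact List.prefix_refl _
    | succ j _ ih =>
      refine ih.trans ?_
      rw [hNs, List.append_assoc]
      exact List.prefix_append _ _
  have hlen : ∀ j, j ≤ (N j).length := by
    intro j
    induction j with
    | zero => exact Nat.zero_le _
    | succ j ih =>
      rw [hNs]
      simp only [List.length_append, List.length_singleton]
      omega
  -- The nodes `N j` are increasing prefixes with at least `j` edges, so the `k`-th edge of the
  -- branch can be read from `N (k + 1)`.
  let b : ℕ → Label n × VTag n M O X := fun k => (N (k + 1))[k]'(hlen (k + 1))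
  have hget : ∀ k j (hk : k < (N j).length), b k = (N j)[k] := by
    intro k j hk
    rcases le_total (k + 1) j with h | h
    · exact (hpre _ _ h).getElem _
    · exact ((hpre _ _ h).getElem _).symm
  have hnode : ∀ j, nodeAt b (N j).length = N j := by
    intro j
    refine List.ext_getElem (length_nodeAt _ _) fun k h1 h2 => ?_
    rw [← hget k j h2]
    simp [nodeAt]
  have hedge : ∀ k, G.EdgeOut (tagAt b k) (b k).1 (b k).2 := by
    intro k
    have h1 : nodeAt b (k + 1) <+: N (k + 1) := by
      rw [← hnode (k + 1)]
      unfold nodeAt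
      refine List.IsPrefix.map _ ?_
      have := hlen (k + 1)
      obtain ⟨d, hd⟩ := Nat.exists_eq_add_of_le this
      have hr : List.range (k + 1 + d) = _ := List.range_add
      rw [hd, hr]
      exact List.prefix_append _ _
    obtain ⟨r, hr⟩ := h1
    have h2 := hP _ (hPN (k + 1))
    rw [← hr, pathFrom_append, nodeAt_succ, pathFrom_append, pathFrom_singleton,
      ← vtag_eq_endTag, vtag_nodeAt] at h2
    exact h2.1.2
  refine ⟨b, ⟨hedge, fun l K => ?_⟩, hnode 0, fun K => ⟨_, hlen K, by rw [hnode]; exact hPN K⟩⟩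
  obtain ⟨j, hj, rfl⟩ := hf l K
  have hl : (N (j + 1)).length = (N j ++ q (N j) (f j)).length + 1 := by
    rw [hNs, List.length_append, List.length_singleton]
  refine ⟨(N j ++ q (N j) (f j)).length, ?_, ?_⟩
  · have := hlen j
    simp only [List.length_append]
    omega
  · rw [hget _ (j + 1) (by omega)]
    simp [hNs]

end Observation

end CHT

namespace CHT

/-! ### Compositions -/

namespace Automaton

variable {α : Type u} {ι : Type} {B : ι → Automaton α} (hB : Compatible B)

theorem mem_input_of_locallyControlled (hB : Compatible B) {k l : ι} (hkl : l ≠ k) {a : α}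
    (ha : a ∈ (B k).locallyControlled) (hl : a ∈ (B l).acts) : a ∈ (B l).input := by
  rcases ha with ha | ha
  · rcases hl with (hl | hl) | hl
    · exact hl
    · exact absurd ha (Set.disjoint_left.1 (hB.1 l k hkl) hl)
    · exact absurd (Or.inl (Or.inr ha)) (Set.disjoint_left.1 (hB.2 l k hkl) hl)
  · exact absurd hl (Set.disjoint_left.1 (hB.2 k l (Ne.symm hkl)) ha)

/-- Whether a locally controlled action is enabled in a composition depends only on the component
that controls it. -/
theorem compose_enabled_iff {k : ι} {a : α} (ha : a ∈ (B k).locallyControlled)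
    (s : ∀ k, (B k).State) : (compose B hB).Enabled s a ↔ (B k).Enabled (s k) a := by
  classical
  have hk : a ∈ (B k).acts := by
    rcases ha with ha | ha
    · exact Or.inl (Or.inr ha)
    · exact Or.inr ha
  constructor
  · rintro ⟨s', -, hs'⟩
    exact ⟨s' k, (hs' k).1 hk⟩
  · intro h
    have : ∀ l, ∃ s', (a ∈ (B l).acts → (B l).trans (s l) a s') ∧ (a ∉ (B l).acts → s' = s l) := by
      intro l
      by_cases hl : a ∈ (B l).acts
      · by_cases hlk : l = k
        · subst hlk
          obtain ⟨s', hs'⟩ := h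
          exact ⟨s', fun _ => hs', fun h => absurd hl h⟩
        · obtain ⟨s', hs'⟩ :=
            (B l).input_enabled a (mem_input_of_locallyControlled hB hlk ha hl) (s l)
          exact ⟨s', fun _ => hs', fun h => absurd hl h⟩
      · exact ⟨s l, fun h => absurd h hl, fun _ => rfl⟩
    choose s' hs' using this
    exact ⟨s', ⟨k, hk⟩, hs'⟩

end Automaton

variable {n : ℕ} {M O X : Type u} {D : Problem (Act n M O X)}

namespace Algorithm

variable (A : Algorithm D)

theorem loc_of_mem_acts_proc {i : Fin n} {a : Act n M O X} (h : a ∈ (A.proc i).acts) :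
    a.loc = i := by
  rcases h with (h | h) | h
  · rw [A.input_eq] at h
    rcases h with ⟨j, m, -, rfl⟩ | ⟨v, rfl⟩ | rfl | h
    · rfl
    · rfl
    · rfl
    · exact h.2
  · rw [A.output_eq] at h
    rcases h with ⟨j, m, -, rfl⟩ | ⟨v, rfl⟩ <;> rfl
  · exact A.internal_loc i a h

theorem notMem_input_of_locallyControlled {U : Automaton (Act n M O X)} {a : Act n M O X}
    (h : a ∈ U.locallyControlled) : a ∉ U.input := by
  intro h'
  rcases h with h | h
  · exact Set.disjoint_left.1 U.disj_input_output h' h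
  · exact Set.disjoint_left.1 U.disj_input_internal h' h

theorem crash_notMem_output (κ : Component n) (i : Fin n) :
    Act.crash i ∉ (A.component κ).output := by
  intro h
  cases κ with
  | proc j =>
    change _ ∈ (A.proc j).output at h
    rw [A.output_eq] at h
    rcases h with ⟨_, _, _, h⟩ | ⟨_, h⟩ <;> cases h
  | chan p q hpq => obtain ⟨m, h⟩ := h; cases h
  | env j => obtain ⟨m, h⟩ := h; cases h

theorem fd_notMem_output (κ : Component n) (i : Fin n) (o : O) :
    Act.fd i o ∉ (A.component κ).output := by
  intro h
  cases κ with
  | proc j =>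
    change _ ∈ (A.proc j).output at h
    rw [A.output_eq] at h
    rcases h with ⟨_, _, _, h⟩ | ⟨_, h⟩ <;> cases h
  | chan p q hpq => obtain ⟨m, h⟩ := h; cases h
  | env j => obtain ⟨m, h⟩ := h; cases h

theorem crash_mem_system_input (i : Fin n) : Act.crash i ∈ A.system.input := by
  refine ⟨Set.mem_iUnion.2 ⟨.proc i, ?_⟩, fun h => ?_⟩
  · change _ ∈ (A.proc i).input
    rw [A.input_eq]
    exact Or.inr (Or.inr (Or.inl rfl))
  · obtain ⟨κ, h⟩ := Set.mem_iUnion.1 h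
    exact A.crash_notMem_output κ i h

theorem fd_mem_system_input (hD : D.IsAFD) {a : Act n M O X} (ha : a ∈ D.O) :
    a ∈ A.system.input := by
  obtain ⟨i, o, rfl⟩ := hD.outputs a ha
  refine ⟨Set.mem_iUnion.2 ⟨.proc i, ?_⟩, fun h => ?_⟩
  · change _ ∈ (A.proc i).input
    rw [A.input_eq]
    exact Or.inr (Or.inr (Or.inr ⟨ha, rfl⟩))
  · obtain ⟨κ, h⟩ := Set.mem_iUnion.1 h
    exact A.fd_notMem_output κ i o h

theorem crash_mem_acts {κ : Component n} {i : Fin n} (h : Act.crash i ∈ (A.component κ).acts) :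
    κ = .proc i ∨ κ = .env i := by
  cases κ with
  | proc j => exact Or.inl (by rw [show i = j from A.loc_of_mem_acts_proc h])
  | chan p q hpq =>
    rcases h with (⟨m, h⟩ | ⟨m, h⟩) | h
    · cases h
    · cases h
    · exact h.elim
  | env j =>
    rcases h with ((h | ⟨m, h⟩) | ⟨m, h⟩) | h
    · cases h; exact Or.inr rfl
    · cases h
    · cases h
    · exact h.elim

/-- Determinism of the components lets a state in the execution with crashes be identified with the
corresponding state in the tree. -/
theorem component_trans_unique {κ : Component n} {s s' s'' : (A.component κ).State}
    {a : Act n M O X} (h : (A.component κ).trans s a s') (h' : (A.component κ).trans s a s'') :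
    s' = s'' := by
  cases κ with
  | proc i => exact (A.deterministic i).1.2 _ _ _ _ h h'
  | chan p q hpq =>
    rcases h with ⟨m, rfl, h⟩ | ⟨m, rfl, h⟩
    · rcases h' with ⟨m', e, h'⟩ | ⟨m', e, h'⟩
      · cases e; exact h.trans h'.symm
      · cases e
    · rcases h' with ⟨m', e, h'⟩ | ⟨m', e, h'⟩
      · cases e
      · cases e; exact (List.cons.inj (h.symm.trans h')).2
  | env i =>
    rcases h with ⟨rfl, h⟩ | ⟨v, rfl, h⟩ | ⟨v, rfl, -, h⟩ <;>
      rcases h' with ⟨e, h'⟩ | ⟨v', e, h'⟩ | ⟨v', e, -, h'⟩ <;>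
      first
        | exact h.trans h'.symm
        | cases e

/-- The component that controls the actions of a task. -/
def owner : Label n → Option (Component n)
  | .proc i => some (.proc i)
  | .env i _ => some (.env i)
  | .chan i j h => some (.chan i j h)
  | .fd _ => none

theorem mem_locallyControlled_of_mem_task {l : Label n} {a : Act n M O X} (ha : a ∈ A.task l) :
    ∃ κ, owner l = some κ ∧ a ∈ (A.component κ).locallyControlled := by
  cases l with
  | proc i => exact ⟨_, rfl, ha⟩
  | env i v => exact ⟨_, rfl, Or.inl ⟨v, ha⟩⟩
  | chan i j h => exact ⟨_, rfl, Or.inl ha⟩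
  | fd i => exact ha.elim

theorem notMem_of_mem_task (hD : D.IsAFD) {l : Label n} {a : Act n M O X} (ha : a ∈ A.task l) :
    a ∉ (crashes ∪ D.O : Set (Act n M O X)) := by
  have hcase : ∀ a ∈ (crashes ∪ D.O : Set (Act n M O X)), a ∈ A.system.input := by
    rintro a (⟨i, rfl⟩ | ha)
    · exact A.crash_mem_system_input i
    · exact A.fd_mem_system_input hD ha
  intro h
  obtain ⟨κ, -, hκ⟩ := A.mem_locallyControlled_of_mem_task ha
  rcases hκ with hκ | hκ
  · exact (hcase a h).2 (Set.mem_iUnion.2 ⟨κ, hκ⟩)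
  · exact Set.disjoint_left.1 A.system.disj_input_internal (hcase a h) (Set.mem_iUnion.2 ⟨κ, hκ⟩)

/-- Proposals are inputs of the processes, hence not among their locally controlled actions. Only
the environment can perform them. -/
theorem eq_env_of_propose_mem_task {l : Label n} {i : Fin n} {v : Bool}
    (ha : Act.propose i v ∈ A.task l) : l = .env i v := by
  cases l with
  | proc j =>
    exfalso
    have hj : i = j :=
      A.loc_of_mem_acts_proc (ha.elim (fun h => Or.inl (Or.inr h)) fun h => Or.inr h)
    refine notMem_input_of_locallyControlled ha ?_
    rw [A.input_eq, hj]
    exact Or.inr (Or.inl ⟨v, rfl⟩)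
  | env j w =>
    have h : Act.propose i v = (Act.propose j w : Act n M O X) := ha
    cases h
    rfl
  | chan j k h => obtain ⟨m, h⟩ := ha; cases h
  | fd j => exact ha.elim

end Algorithm

/-! ### Positions of the vertices of a viable observation -/

namespace Observation

variable {G : Observation D} {t : Stream'.Seq (Act n M O X)}

/-- `pos` assigns to the vertices of `G` the positions of their actions in `t`. -/
structure IsPosition (G : Observation D) (t : Stream'.Seq (Act n M O X))
    (pos : Vertex n M O X → ℕ) : Prop where
  get? : ∀ v ∈ G.V, t.get? (pos v) = some v.act
  lt : ∀ u v, G.E u v → pos u < pos v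
  inj : ∀ u ∈ G.V, ∀ v ∈ G.V, pos u = pos v → u = v
  surj : ∀ k a, t.get? k = some a → a ∈ D.O → ∃ v ∈ G.V, pos v = k

/-- Transports the topological ordering to positions in `t` itself, where vertices can also be
compared with the crashes. -/
theorem Compatible.exists_isPosition (h : G.Compatible t) : ∃ pos, G.IsPosition t pos := by
  obtain ⟨τ, ⟨hmem, hinj, hlt⟩, hτ⟩ := h
  set s := keepIn D.O t.get? with hs
  have hval : ∀ j v, τ.get? j = some v →
      ∃ m, t.get? m = some v.act ∧ v.act ∈ D.O ∧ countSome s m = j := by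
    intro j v hv
    have h1 : (proj D.O t).get? j = some v.act := by rw [hτ, Stream'.Seq.map_get?, hv]; rfl
    rw [proj_eq_compress, compress_get?_eq_some] at h1
    obtain ⟨m, hm, hc⟩ := h1
    rw [keepIn_eq_some] at hm
    exact ⟨m, hm.1, hm.2, hc⟩
  have hpos : ∀ v, ∃ m, v ∈ G.V → t.get? m = some v.act ∧ v.act ∈ D.O ∧
      τ.get? (countSome s m) = some v := by
    intro v
    by_cases hv : v ∈ G.V
    · obtain ⟨j, hj⟩ := Stream'.Seq.mem_iff_exists_get?.1 ((hmem v).2 hv)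
      obtain ⟨m, h1, h2, rfl⟩ := hval j v hj.symm
      exact ⟨m, fun _ => ⟨h1, h2, hj.symm⟩⟩
    · exact ⟨0, fun h => absurd h hv⟩
  choose pos hpos using hpos
  have hsome : ∀ v ∈ G.V, s (pos v) = some v.act := fun v hv =>
    keepIn_eq_some.2 ⟨(hpos v hv).1, (hpos v hv).2.1⟩
  refine ⟨pos, fun v hv => (hpos v hv).1, fun u v huv => ?_, fun u hu v hv huv => ?_,
    fun k a hk ha => ?_⟩
  · obtain ⟨hu, hv⟩ := G.edge_mem u v huv
    exact (countSome_lt_iff (hsome u hu)).1 (hlt _ _ u v (hpos u hu).2.2 (hpos v hv).2.2 huv)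
  · have h1 := (hpos u hu).2.2
    rw [huv, (hpos v hv).2.2] at h1
    exact (Option.some.inj h1).symm
  · have hk' : s k = some a := keepIn_eq_some.2 ⟨hk, ha⟩
    have h1 : (proj D.O t).get? (countSome s k) = some a := by
      rw [proj_eq_compress]; exact compress_get?_count hk'
    rw [hτ, Stream'.Seq.map_get?] at h1
    obtain ⟨v, hv, rfl⟩ := Option.map_eq_some_iff.1 h1
    have hvV : v ∈ G.V := (hmem v).1 (Stream'.Seq.get?_mem hv)
    exact ⟨v, hvV, countSome_inj (hsome v hvV) hk' (hinj _ _ v (hpos v hvV).2.2 hv)⟩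

variable {pos : Vertex n M O X → ℕ}

theorem IsPosition.finite_le (h : G.IsPosition t pos) (K : ℕ) :
    {v | v ∈ G.V ∧ pos v ≤ K}.Finite := by
  refine Set.Finite.of_finite_image (f := pos) ((Set.finite_Iic K).subset ?_) ?_
  · rintro _ ⟨v, hv, rfl⟩
    exact hv.2
  · exact fun u hu v hv huv => h.inj u hu.1 v hv.1 huv

/-- Predecessors of `w` have smaller positions in `t`. This local finiteness is what makes the ranks
in the infinite tree finite. -/
theorem IsPosition.finite_predecessors (h : G.IsPosition t pos) (w : Vertex n M O X) :
    {u | G.E u w}.Finite :=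
  (h.finite_le (pos w)).subset fun u hu => ⟨(G.edge_mem u w hu).1, (h.lt u w hu).le⟩

/-- No vertex at `i` has a position after a crash of `i`. -/
theorem IsPosition.le_crash (h : G.IsPosition t pos) (ht : D.Valid t) {v : Vertex n M O X}
    (hv : v ∈ G.V) {k : ℕ} (hk : t.get? k = some (.crash v.loc)) : pos v ≤ k := by
  by_contra hlt
  exact ht.1 v.loc k (pos v) (by omega) hk v.act (G.act_mem v hv) (h.get? v hv)

/-- By validity, a crash bounds the positions of the outputs at its location, while a location
without a crash has infinitely many outputs. -/
theorem IsPosition.mem_live_iff (h : G.IsPosition t pos) (ht : D.Valid t) (i : Fin n) :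
    i ∈ G.live ↔ i ∉ faulty t := by
  constructor
  · intro hi hf
    obtain ⟨k, hk⟩ := Stream'.Seq.mem_iff_exists_get?.1 (show Act.crash i ∈ t from hf)
    refine hi ((h.finite_le k).subset ?_)
    rintro v ⟨hv, rfl⟩
    exact ⟨hv, h.le_crash ht hv hk.symm⟩
  · intro hf hfin
    refine ht.2 i hf ((hfin.image pos).subset ?_)
    rintro k ⟨a, ha, hk⟩
    obtain ⟨v, hv, rfl⟩ := h.surj k a hk ha.1
    have hva := h.get? v hv
    rw [hk] at hva
    cases hva
    exact ⟨v, ⟨hv, (G.act_mem v hv).2.symm.trans ha.2⟩, rfl⟩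

end Observation

/-! ### Executions along infinite branches -/

namespace Observation

variable {G : Observation D} {v w : VTag n M O X} {i : Fin n}

/-- No vertex at `i` may follow the vertex `v`, which has another location. -/
def Dead (G : Observation D) (v : VTag n M O X) (i : Fin n) : Prop :=
  ∃ u, v = some u ∧ u.loc ≠ i ∧ ¬ G.Active v i

/-- A later tag at `i` would be a vertex at `i` following `v`, and a vertex at `i` following a later
tag would follow `v` by transitivity. -/
theorem Dead.mono (h : G.TagLE v w) (hv : G.Dead v i) : G.Dead w i := by
  obtain ⟨u, rfl, hu, hact⟩ := hv
  have hw : ¬ G.Active w i := fun hw => hact (h.active hw)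
  rcases h with rfl | ⟨u', rfl, hu'⟩
  · exact ⟨u, rfl, hu, hw⟩
  · exact ⟨u', rfl, fun hi => hact ⟨u', hu', hi⟩, hw⟩

/-- `i` is dead for the first time at depth `k + 1`. -/
def DiesAt (G : Observation D) (b : ℕ → Label n × VTag n M O X) (k : ℕ) (i : Fin n) : Prop :=
  ¬ G.Dead (tagAt b k) i ∧ G.Dead (tagAt b (k + 1)) i

variable {b : ℕ → Label n × VTag n M O X}

theorem IsFairBranch.tagLE (hb : G.IsFairBranch b) {k k' : ℕ} (h : k ≤ k') :
    G.TagLE (tagAt b k) (tagAt b k') := by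
  induction k', h using Nat.le_induction with
  | base => exact TagLE.refl G _
  | succ k' _ ih => exact ih.trans (hb.edge k').tagLE

theorem IsFairBranch.mem (hb : G.IsFairBranch b) {k : ℕ} {u : Vertex n M O X}
    (h : tagAt b k = some u) : u ∈ G.V := by
  rcases hb.tagLE (Nat.zero_le k) with h' | ⟨u', h', hu'⟩
  · rw [h] at h'; cases h'
  · rw [h] at h'; cases h'; exact hu'

theorem IsFairBranch.active (hb : G.IsFairBranch b) (hi : i ∈ G.live) (k : ℕ) :
    G.Active (tagAt b k) i := active_of_live hi fun _ hu => hb.mem hu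

theorem IsFairBranch.not_dead (hb : G.IsFairBranch b) (hi : i ∈ G.live) (k : ℕ) :
    ¬ G.Dead (tagAt b k) i := by
  rintro ⟨u, -, -, h⟩
  exact h (hb.active hi k)

/-- If `i` stayed active, each of the infinitely many `FD_i`-edges would use a new vertex at `i`,
because the tags increase along a branch and no vertex follows itself. -/
theorem IsFairBranch.exists_not_active (hb : G.IsFairBranch b) (hi : i ∉ G.live) :
    ∃ k, ¬ G.Active (tagAt b k) i := by
  by_contra! hact
  have hstep : ∀ k, (b k).1 = .fd i → ∃ u, tagAt b (k + 1) = some u ∧ u ∈ G.V ∧ u.loc = i ∧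
      G.Follows (tagAt b k) u := by
    intro k hk
    have he := hb.edge k
    rw [hk] at he
    rcases he with ⟨u, hu, hi, he⟩ | ⟨h, -⟩
    · exact ⟨u, he, hu.mem, hi, hu⟩
    · exact absurd (hact k) h
  have hinf : {k | (b k).1 = .fd i}.Infinite := by
    rw [Set.infinite_iff_exists_gt]
    intro K
    obtain ⟨k, hk, h⟩ := hb.fair (.fd i) (K + 1)
    exact ⟨k, h, by omega⟩
  have hne : ∀ k k', (b k).1 = .fd i → (b k').1 = .fd i → k < k' →
      tagAt b (k + 1) ≠ tagAt b (k' + 1) := by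
    intro k k' _ hk' hlt he
    obtain ⟨u, hu, -, -, hF⟩ := hstep k' hk'
    have := (hb.tagLE (Nat.succ_le_of_lt hlt)).follows hF
    rw [Nat.succ_eq_add_one, he, hu] at this
    exact G.not_follows_self u this
  have hinj : Set.InjOn (fun k => tagAt b (k + 1)) {k | (b k).1 = .fd i} := by
    intro k hk k' hk' he
    rcases lt_trichotomy k k' with hlt | rfl | hlt
    · exact absurd he (hne k k' hk hk' hlt)
    · rfl
    · exact absurd he.symm (hne k' k hk' hk hlt)
  refine hinf.image hinj (Set.Finite.subset ((Set.not_infinite.1 hi).image some) ?_)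
  rintro _ ⟨k, hk, rfl⟩
  obtain ⟨u, hu, hV, hloc, -⟩ := hstep k hk
  exact ⟨u, ⟨hV, hloc⟩, hu.symm⟩

/-- Once `i` is inactive, the next `FD_j`-edge of a live location `j` leads to a tag at `j ≠ i`, at
which `i` is dead. -/
theorem IsFairBranch.exists_diesAt (hb : G.IsFairBranch b) (hlive : G.live.Nonempty)
    (hi : i ∉ G.live) : ∃ k, G.DiesAt b k i := by
  classical
  obtain ⟨j, hj⟩ := hlive
  obtain ⟨K, hK⟩ := hb.exists_not_active hi
  obtain ⟨k, hk, hl⟩ := hb.fair (.fd j) K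
  have he := hb.edge k
  rw [hl] at he
  have hex : ∃ k, G.Dead (tagAt b k) i := by
    rcases he with ⟨u, hu, rfl, he⟩ | ⟨h, -⟩
    · refine ⟨k + 1, u, he, fun h => hi (h ▸ hj), fun h => hK ?_⟩
      exact (hb.tagLE (show K ≤ k + 1 by omega)).active h
    · exact absurd (hb.active hj k) h
  -- The null tag of the root is not a vertex, so nothing is dead there and the first dead depth is
  -- a successor.
  have h0 : Nat.find hex ≠ 0 := by
    intro h0
    obtain ⟨u, hu, -⟩ := Nat.find_spec hex
    rw [h0] at hu
    cases hu
  obtain ⟨k', hk'⟩ := Nat.exists_eq_succ_of_ne_zero h0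
  refine ⟨k', Nat.find_min hex (by omega), ?_⟩
  have := Nat.find_spec hex
  rwa [hk'] at this

theorem IsFairBranch.diesAt_unique (hb : G.IsFairBranch b) {k k' : ℕ} (h : G.DiesAt b k i)
    (h' : G.DiesAt b k' i) : k = k' := by
  rcases lt_trichotomy k k' with hlt | rfl | hlt
  · exact absurd (Dead.mono (hb.tagLE hlt) h.2) h'.1
  · rfl
  · exact absurd (Dead.mono (hb.tagLE hlt) h'.2) h.1

end Observation

namespace Algorithm

variable (A : Algorithm D) (G : Observation D) (b : ℕ → Label n × VTag n M O X)

/-- The configuration tags along an infinite branch. -/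
noncomputable def cfgAt (k : ℕ) : A.system.State := A.config G (nodeAt b k)

/-- The action tags along an infinite branch. -/
noncomputable def actAt (k : ℕ) : Option (Act n M O X) :=
  A.edgeAction G (A.cfgAt G b k) (tagAt b k) (b k).1 (b k).2

theorem cfgAt_succ (k : ℕ) :
    A.cfgAt G b (k + 1) = A.applyAction (A.cfgAt G b k) (A.actAt G b k) := by
  rw [cfgAt, nodeAt_succ, config, configFrom_append, ← vtag_eq_endTag, vtag_nodeAt]
  rfl

theorem pathActions_nodeAt (k : ℕ) :
    A.pathActions G (nodeAt b k) = (List.range k).map (A.actAt G b) := by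
  induction k with
  | zero => rfl
  | succ k ih =>
    rw [nodeAt_succ, pathActions_append, ih, vtag_nodeAt, List.range_succ, List.map_append]
    rfl

variable {A G b}

theorem applyAction_trans {c : A.system.State} {a : Act n M O X} (h : A.system.Enabled c a) :
    A.system.trans c a (A.applyAction c (some a)) := by
  classical
  have h' : ∃ c', A.system.trans c a c' := h
  rw [applyAction, dif_pos h']
  exact h'.choose_spec

/-- The origin of an action tag on a branch. -/
theorem actAt_cases (hb : G.IsFairBranch b) {k : ℕ} {a : Act n M O X}
    (ha : A.actAt G b k = some a) :
    (∃ u, tagAt b (k + 1) = some u ∧ (b k).1 = .fd u.loc ∧ G.Follows (tagAt b k) u ∧ a = u.act) ∨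
    (tagAt b (k + 1) = tagAt b k ∧ a ∈ A.task (b k).1 ∧ A.system.Enabled (A.cfgAt G b k) a ∧
      ∀ i, (b k).1 = .proc i ∨ (∃ v, (b k).1 = .env i v) → G.Active (tagAt b k) i) := by
  classical
  have he := hb.edge k
  have hen : ∀ l, A.enabledAction (A.cfgAt G b k) l = some a →
      a ∈ A.task l ∧ A.system.Enabled (A.cfgAt G b k) a := by
    intro l h
    unfold enabledAction at h
    split_ifs at h with h'
    cases h
    exact h'.choose_spec
  unfold actAt at ha
  have htag : tagAt b (k + 1) = (b k).2 := rfl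
  rcases hl : (b k).1 with i | ⟨i, v⟩ | ⟨i, j, hij⟩ | i
  · right
    rw [hl] at ha he
    simp only [edgeAction] at ha
    split_ifs at ha with h
    refine ⟨he, (hen _ ha).1, (hen _ ha).2, ?_⟩
    rintro i' (h' | ⟨v', h'⟩) <;> cases h'
    exact h
  · right
    rw [hl] at ha he
    simp only [edgeAction] at ha
    split_ifs at ha with h
    refine ⟨he, (hen _ ha).1, (hen _ ha).2, ?_⟩
    rintro i' (h' | ⟨v', h'⟩) <;> cases h'
    exact h
  · right
    rw [hl] at ha he
    refine ⟨he, (hen _ ha).1, (hen _ ha).2, ?_⟩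
    rintro i' (h' | ⟨v', h'⟩) <;> cases h'
  · left
    rw [hl] at ha he
    simp only [edgeAction] at ha
    split_ifs at ha with h
    rcases he with ⟨u, hu, rfl, he⟩ | ⟨-, he⟩
    · rw [he] at ha
      exact ⟨u, he, rfl, hu, (Option.some.inj ha).symm⟩
    · exact absurd he h

/-- At an active location, `⊥` means that the task has nothing to do. The other source of `⊥`,
inactivity, is excluded by `hact`. -/
theorem not_taskEnabled_of_actAt_eq_none {k : ℕ} (ha : A.actAt G b k = none)
    (hact : ∀ i, (b k).1 = .proc i ∨ (∃ v, (b k).1 = .env i v) → G.Active (tagAt b k) i) :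
    ∀ a ∈ A.task (b k).1, ¬ A.system.Enabled (A.cfgAt G b k) a := by
  classical
  have hen : A.enabledAction (A.cfgAt G b k) (b k).1 = none →
      ∀ a ∈ A.task (b k).1, ¬ A.system.Enabled (A.cfgAt G b k) a := by
    intro h a ha hE
    rw [enabledAction, dif_pos ⟨a, ha, hE⟩] at h
    cases h
  unfold actAt at ha
  rcases hl : (b k).1 with i | ⟨i, v⟩ | ⟨i, j, hij⟩ | i
  · rw [hl] at ha hact hen
    simp only [edgeAction, if_pos (hact i (Or.inl rfl))] at ha
    exact hen ha
  · rw [hl] at ha hact hen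
    simp only [edgeAction, if_pos (hact i (Or.inr ⟨v, rfl⟩))] at ha
    exact hen ha
  · rw [hl] at ha hen
    exact hen ha
  · exact fun a ha => ha.elim

theorem cfgAt_trans (hD : D.IsAFD) (hb : G.IsFairBranch b) {k : ℕ} {a : Act n M O X}
    (ha : A.actAt G b k = some a) :
    A.system.trans (A.cfgAt G b k) a (A.cfgAt G b (k + 1)) := by
  rw [cfgAt_succ, ha]
  refine applyAction_trans ?_
  rcases actAt_cases hb ha with ⟨u, -, -, hu, rfl⟩ | ⟨-, -, h, -⟩
  · exact A.system.input_enabled _ (A.fd_mem_system_input hD (G.act_mem u hu.mem).1) _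
  · exact h

/-! #### Interleaving the crashes with the actions of a branch -/

/-- The place of a crash of `i` in front of the `k`-th action. -/
def crashSlot (k : ℕ) (i : Fin n) : ℕ := (n + 1) * k + i

/-- The place of the `k`-th action. -/
def actSlot (n k : ℕ) : ℕ := (n + 1) * k + n

open Classical in
variable (A G b) in
/-- The actions of a branch together with a crash action for each location that is not live. -/
noncomputable def slot (m : ℕ) : Option (Act n M O X) :=
  if h : m % (n + 1) < n then
    if G.DiesAt b (m / (n + 1)) ⟨m % (n + 1), h⟩ then some (.crash ⟨m % (n + 1), h⟩) else none
  else A.actAt G b (m / (n + 1))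

theorem slot_cases (n m : ℕ) : (∃ k, ∃ i : Fin n, m = crashSlot k i) ∨ ∃ k, m = actSlot n k := by
  have h1 := Nat.div_add_mod m (n + 1)
  have h2 := Nat.mod_lt m (show 0 < n + 1 by omega)
  by_cases h : m % (n + 1) < n
  · exact Or.inl ⟨m / (n + 1), ⟨m % (n + 1), h⟩, h1.symm⟩
  · refine Or.inr ⟨m / (n + 1), ?_⟩
    unfold actSlot
    have : m % (n + 1) = n := by omega
    rw [this] at h1
    exact h1.symm

theorem add_div_and_mod {k r : ℕ} (hr : r < n + 1) :
    ((n + 1) * k + r) / (n + 1) = k ∧ ((n + 1) * k + r) % (n + 1) = r := by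
  constructor
  · rw [Nat.mul_add_div (Nat.succ_pos n), Nat.div_eq_of_lt hr, add_zero]
  · rw [Nat.mul_add_mod, Nat.mod_eq_of_lt hr]

open Classical in
theorem slot_crashSlot (k : ℕ) (i : Fin n) :
    slot A G b (crashSlot k i) = if G.DiesAt b k i then some (.crash i) else none := by
  obtain ⟨h1, h2⟩ := add_div_and_mod (n := n) (k := k) (r := i) (by omega)
  unfold slot crashSlot
  simp only [h1, h2, i.2, dif_pos]

theorem slot_actSlot (k : ℕ) : slot A G b (actSlot n k) = A.actAt G b k := by
  obtain ⟨h1, h2⟩ := add_div_and_mod (n := n) (k := k) (r := n) (by omega)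
  unfold slot actSlot
  simp only [h1, h2, lt_irrefl, dif_neg, not_false_eq_true]

/-- The inequality on the right is not strict: a crash at depth `k` comes before the action of the
same depth, the one whose edge makes the location dead. -/
theorem crashSlot_lt_actSlot {k k' : ℕ} {i : Fin n} : crashSlot k i < actSlot n k' ↔ k ≤ k' := by
  have := i.2
  unfold crashSlot actSlot
  constructor
  · intro h
    by_contra! hlt
    have := Nat.mul_le_mul_left (n + 1) (Nat.succ_le_of_lt hlt)
    rw [Nat.succ_eq_add_one, Nat.mul_add] at this
    omega
  · intro h
    have := Nat.mul_le_mul_left (n + 1) h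
    omega

theorem actSlot_lt_actSlot {k k' : ℕ} : actSlot n k < actSlot n k' ↔ k < k' := by
  unfold actSlot
  constructor
  · intro h
    by_contra! hlt
    have := Nat.mul_le_mul_left (n + 1) hlt
    omega
  · intro h
    have := Nat.mul_le_mul_left (n + 1) (Nat.succ_le_of_lt h)
    rw [Nat.succ_eq_add_one, Nat.mul_add] at this
    omega

theorem le_actSlot (n k : ℕ) : k ≤ actSlot n k := by
  unfold actSlot
  have := Nat.mul_le_mul_right k (show 1 ≤ n + 1 by omega)
  omega

theorem actAt_ne_crash (hD : D.IsAFD) (hb : G.IsFairBranch b) {k : ℕ} {i : Fin n} :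
    A.actAt G b k ≠ some (.crash i) := by
  intro h
  rcases actAt_cases hb h with ⟨u, -, -, hu, h⟩ | ⟨-, h, -⟩
  · obtain ⟨j, o, h'⟩ := hD.outputs _ (G.act_mem u hu.mem).1
    rw [← h] at h'
    cases h'
  · exact A.notMem_of_mem_task hD h (Or.inl ⟨i, rfl⟩)

theorem slot_eq_crash (hD : D.IsAFD) (hb : G.IsFairBranch b) {m : ℕ} {i : Fin n} :
    slot A G b m = some (.crash i) ↔ ∃ k, m = crashSlot k i ∧ G.DiesAt b k i := by
  classical
  constructor
  · intro h
    rcases slot_cases n m with ⟨k, j, rfl⟩ | ⟨k, rfl⟩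
    · rw [slot_crashSlot] at h
      split_ifs at h with h'
      cases h
      exact ⟨k, rfl, h'⟩
    · rw [slot_actSlot] at h
      exact absurd h (actAt_ne_crash hD hb)
  · rintro ⟨k, rfl, h⟩
    rw [slot_crashSlot, if_pos h]

theorem slot_eq_of_ne_crash {m : ℕ} {a : Act n M O X} (ha : a ∉ (crashes : Set (Act n M O X)))
    (h : slot A G b m = some a) : ∃ k, m = actSlot n k ∧ A.actAt G b k = some a := by
  classical
  rcases slot_cases n m with ⟨k, j, rfl⟩ | ⟨k, rfl⟩
  · rw [slot_crashSlot] at h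
    split_ifs at h with h'
    cases h
    exact absurd ⟨j, rfl⟩ ha
  · rw [slot_actSlot] at h
    exact ⟨k, rfl, h⟩

/-- The failure-detector outputs along a branch. -/
theorem slot_eq_output (hD : D.IsAFD) (hb : G.IsFairBranch b) {m : ℕ} {a : Act n M O X}
    (ha : a ∈ D.O) (h : slot A G b m = some a) :
    ∃ k u, m = actSlot n k ∧ tagAt b (k + 1) = some u ∧ u ∈ G.V ∧ G.Follows (tagAt b k) u ∧
      a = u.act := by
  obtain ⟨k, rfl, hk⟩ := slot_eq_of_ne_crash (by
    rintro ⟨i, rfl⟩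
    obtain ⟨j, o, h'⟩ := hD.outputs _ ha
    cases h') h
  rcases actAt_cases hb hk with ⟨u, hu, -, hF, rfl⟩ | ⟨-, h', -⟩
  · exact ⟨k, u, rfl, hu, hF.mem, hF, rfl⟩
  · exact absurd (Or.inr ha) (A.notMem_of_mem_task hD h')

theorem exists_slot_output (hb : G.IsFairBranch b) {i : Fin n}
    (hi : i ∈ G.live) (K : ℕ) : ∃ m ≥ K, ∃ a ∈ atLoc D.O i, slot A G b m = some a := by
  classical
  obtain ⟨k, hk, hl⟩ := hb.fair (.fd i) K
  refine ⟨actSlot n k, hk.trans (le_actSlot n k), ?_⟩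
  have he := hb.edge k
  rw [slot_actSlot, actAt, hl]
  rw [hl] at he
  rcases he with ⟨u, hu, rfl, he⟩ | ⟨h, -⟩
  · refine ⟨u.act, G.act_mem u hu.mem, ?_⟩
    have hne : some u ≠ tagAt b k := fun h => G.not_follows_self u (by rw [h]; exact hu)
    simp [edgeAction, he, hne]
  · exact absurd (hb.active hi k) h

end Algorithm
end CHT

/-! ### The failure-detector trace along a fair branch -/

namespace CHT

variable {n : ℕ} {M O X : Type u} {D : Problem (Act n M O X)}

namespace Algorithm

variable {A : Algorithm D} {G : Observation D} {b : ℕ → Label n × VTag n M O X}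

/-- The crashes and failure-detector outputs along a fair branch form a trace of the failure
detector. -/
theorem compress_slot_mem (hD : D.IsStrongSamplingAFD) (hb : G.IsFairBranch b)
    (hlive : G.live.Nonempty) {t : Stream'.Seq (Act n M O X)} (ht : t ∈ D.T)
    {pos : Vertex n M O X → ℕ} (hpos : G.IsPosition t pos) :
    compress (keepIn (crashes ∪ D.O) (slot A G b)) ∈ D.T := by
  classical
  have hval := hD.validity t ht
  have hfd : ∀ (u : Vertex n M O X), u ∈ G.V → ∀ i, u.act ≠ .crash i := by
    intro u hu i h
    obtain ⟨j, o, h'⟩ := hD.outputs _ (G.act_mem u hu).1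
    rw [h] at h'
    cases h'
  set s := keepIn (crashes ∪ D.O) (slot A G b) with hs
  -- Any crash of `i` in `t` will do: validity forbids outputs at `i` after each of them.
  have hcpos : ∀ i, ∃ p, i ∉ G.live → t.get? p = some (.crash i) := by
    intro i
    by_cases hi : i ∈ G.live
    · exact ⟨0, fun h => absurd hi h⟩
    · rw [hpos.mem_live_iff hval, not_not] at hi
      obtain ⟨p, hp⟩ := Stream'.Seq.mem_iff_exists_get?.1 (show Act.crash i ∈ t from hi)
      exact ⟨p, fun _ => hp.symm⟩
  choose cpos hcpos using hcpos
  -- The matching of the events on the branch with events of `t`: crashes go to the chosen crash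
  -- positions, and outputs to the positions of their vertices. The vertex of the action of block
  -- `k` is the tag at depth `k + 1`. The value `0` is never used for an event.
  let g : ℕ → ℕ := fun m => match s m with
    | some (.crash i) => cpos i
    | _ => match tagAt b (m / (n + 1) + 1) with
      | some u => pos u
      | none => 0
  have hclass : ∀ m a, s m = some a →
      (∃ k i, m = crashSlot k i ∧ G.DiesAt b k i ∧ a = .crash i ∧ g m = cpos i) ∨
      (∃ k u, m = actSlot n k ∧ tagAt b (k + 1) = some u ∧ u ∈ G.V ∧ G.Follows (tagAt b k) u ∧
        a = u.act ∧ g m = pos u) := by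
    intro m a hm
    obtain ⟨hm', ha | ha⟩ := keepIn_eq_some.1 hm
    · obtain ⟨i, rfl⟩ := ha
      obtain ⟨k, rfl, hk⟩ := (slot_eq_crash hD.toIsAFD hb).1 hm'
      refine Or.inl ⟨k, i, rfl, hk, rfl, ?_⟩
      simp only [g, hm]
    · obtain ⟨k, u, rfl, htag, hu, hF, rfl⟩ := slot_eq_output hD.toIsAFD hb ha hm'
      refine Or.inr ⟨k, u, rfl, htag, hu, hF, rfl, ?_⟩
      have hdiv : actSlot n k / (n + 1) = k := (add_div_and_mod (by omega)).1
      obtain ⟨j, o, h'⟩ := hD.outputs _ (G.act_mem u hu).1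
      simp only [g, hm, h', hdiv, htag]
  have hdies : ∀ {k i}, G.DiesAt b k i → i ∉ G.live := fun h hi => hb.not_dead hi _ h.2
  -- The vertices met along a branch form a chain in `G`, so outputs occur on the branch in the same
  -- order as in `t`.
  have hedge : ∀ {k k' u u'}, tagAt b (k + 1) = some u → tagAt b (k' + 1) = some u' →
      G.Follows (tagAt b k') u' → k < k' → G.E u u' := by
    intro k k' u u' h _ hF hlt
    have := (hb.tagLE (Nat.succ_le_of_lt hlt)).follows hF
    rwa [Nat.succ_eq_add_one, h] at this
  have hg : ∀ m a, s m = some a → t.get? (g m) = some a := by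
    intro m a hm
    rcases hclass m a hm with ⟨k, i, -, hk, rfl, h⟩ | ⟨k, u, -, -, hu, -, rfl, h⟩
    · rw [h, hcpos i (hdies hk)]
    · rw [h, hpos.get? u hu]
  have hinj : ∀ m m', (s m).isSome → (s m').isSome → g m = g m' → m = m' := by
    intro m m' hm hm' he
    obtain ⟨a, ha⟩ := Option.isSome_iff_exists.1 hm
    obtain ⟨a', ha'⟩ := Option.isSome_iff_exists.1 hm'
    have haa := hg m a ha
    rw [he, hg m' a' ha'] at haa
    cases haa
    rcases hclass m _ ha with ⟨k, i, rfl, hk, h1, h⟩ | ⟨k, u, rfl, htag, hu, hF, h1, h⟩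
    · subst h1
      rcases hclass m' _ ha' with ⟨k', i', rfl, hk', h1, h'⟩ | ⟨k', u', rfl, -, hu', -, h1, h'⟩
      · cases h1
        rw [hb.diesAt_unique hk hk']
      · exact absurd h1.symm (hfd u' hu' i)
    · subst h1
      rcases hclass m' _ ha' with ⟨k', i', rfl, hk', h1, h'⟩ |
        ⟨k', u', rfl, htag', hu', hF', h1, h'⟩
      · exact absurd h1 (hfd u hu i')
      · rw [h, h'] at he
        obtain rfl := hpos.inj u hu u' hu' he
        rcases lt_trichotomy k k' with hlt | rfl | hlt
        · exact absurd (hedge htag htag' hF' hlt) (G.not_edge_self u)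
        · rfl
        · exact absurd (hedge htag' htag hF hlt) (G.not_edge_self u)
  have hex := exists_equiv_of_injOn hg hinj
  set s' := keep t.get? (fun k => ∃ m, (s m).isSome ∧ g m = k) with hs'
  obtain ⟨π, hπ⟩ := hex
  have hcrash : ∀ i, i ∉ G.live → ∃ m, s m = some (.crash i) := by
    intro i hi
    obtain ⟨k, hk⟩ := hb.exists_diesAt hlive hi
    exact ⟨crashSlot k i, keepIn_eq_some.2
      ⟨(slot_eq_crash hD.toIsAFD hb).2 ⟨k, rfl, hk⟩, Or.inl ⟨i, rfl⟩⟩⟩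
  have hfreq : ∀ i ∈ G.live, ∀ K, ∃ m ≥ K, ∃ a ∈ atLoc D.O i, s m = some a := by
    intro i hi K
    obtain ⟨m, hm, a, ha, h⟩ := exists_slot_output (A := A) hb hi K
    exact ⟨m, hm, a, ha, keepIn_eq_some.2 ⟨h, Or.inr ha.1⟩⟩
  have hinf : ∀ i ∈ G.live, {k | ∃ a ∈ atLoc D.O i, (compress s).get? k = some a}.Infinite := by
    intro i hi
    refine infinite_of_frequently (s := s)
      (P := fun k => ∃ a ∈ atLoc D.O i, (compress s).get? k = some a) (fun K => ?_) fun K => ?_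
    · obtain ⟨m, hm, a, -, h⟩ := hfreq i hi K
      exact ⟨m, hm, by simp [h]⟩
    · obtain ⟨m, hm, a, ha, h⟩ := hfreq i hi K
      exact ⟨m, hm, a, ha, compress_get?_count h⟩
  have hvalid : D.Valid (compress s) := by
    constructor
    · intro i j j' hlt hj a ha hj'
      obtain ⟨m, hm, rfl⟩ := compress_get?_eq_some.1 hj
      obtain ⟨m', hm', rfl⟩ := compress_get?_eq_some.1 hj'
      rw [countSome_lt_iff hm] at hlt
      rcases hclass m _ hm with ⟨k, i', rfl, hk, h1, -⟩ | ⟨k, u, -, -, hu, -, h1, -⟩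
      · cases h1
        rcases hclass m' _ hm' with ⟨k', i', rfl, -, h1, -⟩ | ⟨k', u, rfl, htag, hu, hF, h1, -⟩
        · obtain ⟨j, o, h⟩ := hD.outputs _ ha.1
          rw [h] at h1
          cases h1
        · subst h1
          rw [crashSlot_lt_actSlot] at hlt
          -- Death persists, and the tag at which `i` is dead is not at `i`. So no output after the
          -- crash, including the one of the same block, is at `i`.
          obtain ⟨u', h1, h2, -⟩ := Observation.Dead.mono
            (hb.tagLE (show k + 1 ≤ k' + 1 by omega)) hk.2
          rw [htag] at h1
          cases h1
          exact h2 ((G.act_mem u hu).2.symm.trans ha.2)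
      · exact absurd h1.symm (hfd u hu i)
    · intro i hi
      refine hinf i (by_contra fun hl => hi ?_)
      obtain ⟨m, hm⟩ := hcrash i hl
      exact mem_compress.2 ⟨m, hm⟩
  -- Strong sampling: the matched events, in the order of `t`, are a valid subsequence of `t`.
  -- Superfluous crashes and outputs not met on the branch are left out.
  have hsub : compress s' ∈ D.T := by
    refine hD.strong_sampling t ht _ (isSubseqVia_compress_keep t _) ⟨?_, ?_⟩
    · intro i j j' hlt hj a ha hj'
      obtain ⟨m, hm, rfl⟩ := compress_get?_eq_some.1 hj
      obtain ⟨m', hm', rfl⟩ := compress_get?_eq_some.1 hj'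
      rw [countSome_lt_iff hm] at hlt
      exact hval.1 i m m' hlt (keep_eq_some.1 hm).2 a ha (keep_eq_some.1 hm').2
    · intro i hi
      have hl : i ∈ G.live := by
        by_contra hl
        obtain ⟨m, hm⟩ := hcrash i hl
        exact hi (mem_compress.2 ⟨g m, keep_eq_some.2 ⟨⟨m, by simp [hm], rfl⟩, hg m _ hm⟩⟩)
      -- The infinitely many outputs at a live location on the branch are carried over to the
      -- subsequence of `t` by the bijection `π`.
      have hI := (hinf i hl).to_subtype
      have hsome : ∀ k : {k | ∃ a ∈ atLoc D.O i, (compress s).get? k = some a},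
          ((compress s).get? (k : ℕ)).isSome := by
        rintro ⟨k, a, ha, hk⟩
        simp [hk]
      refine Set.infinite_of_injective_forall_mem (f := fun
        k : {k | ∃ a ∈ atLoc D.O i, (compress s).get? k = some a} =>
        ((π.symm ⟨k, hsome k⟩ : _) : ℕ)) (fun k k' h => ?_) fun k => ?_
      · have := π.symm.injective (Subtype.ext h)
        exact Subtype.ext (Subtype.mk.inj this)
      · obtain ⟨m, a, -, -, h1, -, h2⟩ := hπ (π.symm ⟨k, hsome k⟩)
        rw [Equiv.apply_symm_apply] at h1
        obtain ⟨a', ha', hk⟩ := k.2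
        rw [hk] at h1
        cases h1
        exact ⟨a, ha', h2⟩
  -- The branch order may move a crash ahead of outputs that precede it in `t`, but not the reverse.
  refine hD.reordering _ hsub _ ⟨hvalid, π, fun k => ?_, ?_⟩
  · obtain ⟨m, a, -, -, h1, -, h2⟩ := hπ k
    rw [h1, h2]
  · intro k k' a a' hlt hk hk' hcon
    obtain ⟨m, x, hm, hπk, -, hkm, hx⟩ := hπ k
    obtain ⟨m', x', hm', hπk', -, hkm', hx'⟩ := hπ k'
    rw [hk] at hx
    rw [hk'] at hx'
    cases hx
    cases hx'
    have hs'm : s' (g m) = some a := keep_eq_some.2 ⟨⟨m, by simp [hm], rfl⟩, hg m _ hm⟩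
    rw [hkm, hkm', countSome_lt_iff hs'm] at hlt
    rw [hπk, hπk', countSome_lt_iff hm]
    have ha' : a' ∈ D.O := hcon.elim (fun h => h.2.1) fun h => h.2
    rcases hclass m' _ hm' with ⟨k₂, i, -, -, rfl, -⟩ | ⟨k₂, u', rfl, htag', hu', hF', rfl, h'⟩
    · obtain ⟨j, o, h⟩ := hD.outputs _ ha'
      cases h
    rw [h'] at hlt
    rcases hclass m _ hm with ⟨k₁, i, rfl, hk₁, rfl, h⟩ | ⟨k₁, u, rfl, htag, hu, hF, rfl, h⟩
    · rw [h] at hlt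
      rw [crashSlot_lt_actSlot]
      -- If the output came first on the branch, the tag `w` just before the crash would have a
      -- position in `t` beyond that crash. Then `w` is not at `i` and nothing at `i` follows it, so
      -- `i` was already dead, contrary to the choice of the first such depth.
      by_contra! hlt'
      have hci := hcpos i (hdies hk₁)
      have hle : ∀ x ∈ G.V, x.loc = i → pos x ≤ cpos i := by
        rintro x hx rfl
        exact hpos.le_crash hval hx hci
      have htl := hb.tagLE (Nat.succ_le_of_lt hlt')
      rw [Nat.succ_eq_add_one, htag'] at htl
      obtain ⟨w, hw, hwV, hwpos⟩ : ∃ w, tagAt b k₁ = some w ∧ w ∈ G.V ∧ pos u' ≤ pos w := by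
        rcases htl with h | ⟨w, h, hw⟩
        · exact ⟨u', h, hu', le_rfl⟩
        · exact ⟨w, h, hw.mem, (hpos.lt _ _ hw).le⟩
      by_cases hwi : w.loc = i
      · have := hle w hwV hwi
        omega
      · by_cases hact : G.Active (some w) i
        · obtain ⟨x, hx, hxi⟩ := hact
          have h1 := hle x hx.mem hxi
          have h2 := hpos.lt w x hx
          omega
        · exact hk₁.1 ⟨w, hw, hwi, by rwa [hw]⟩
    · rw [h] at hlt
      rw [actSlot_lt_actSlot]
      rcases lt_trichotomy k₁ k₂ with hlt' | rfl | hlt'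
      · exact hlt'
      · rw [htag] at htag'
        cases htag'
        omega
      · have := hpos.lt _ _ (hedge htag' htag hF hlt')
        omega

end Algorithm
end CHT

/-! ### States and tasks when crashes are interleaved -/

namespace CHT

variable {n : ℕ} {M O X : Type u} {D : Problem (Act n M O X)}

namespace Algorithm

section Execution

variable (A : Algorithm D) (G : Observation D) (b : ℕ → Label n × VTag n M O X)

/-- The states of the system when the crashes are interleaved with the actions of a branch. -/
noncomputable def stateAt : ℕ → A.system.State
  | 0 => A.startState
  | m + 1 => A.applyAction (stateAt m) (slot A G b m)

variable {A G b}

/-- The component is at a location that crashes before place `m`. -/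
def CrashedBefore (A : Algorithm D) (G : Observation D) (b : ℕ → Label n × VTag n M O X)
    (κ : Component n) (m : ℕ) : Prop :=
  ∃ i, (κ = .proc i ∨ κ = .env i) ∧ ∃ m' < m, slot A G b m' = some (.crash i)

theorem CrashedBefore.dead (hD : D.IsAFD) (hb : G.IsFairBranch b) {i : Fin n} {k : ℕ}
    (h : ∃ m' < actSlot n k, slot A G b m' = some (.crash i)) : G.Dead (tagAt b (k + 1)) i := by
  obtain ⟨m', hlt, hm'⟩ := h
  obtain ⟨k', rfl, hk'⟩ := (slot_eq_crash hD hb).1 hm'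
  rw [crashSlot_lt_actSlot] at hlt
  exact Observation.Dead.mono (hb.tagLE (by omega)) hk'.2

/-- A task edge keeps the vertex tag. If the location had crashed, it would be dead at depth `k +
1`, hence inactive at depth `k`, contrary to `hact`. So tasks that are allowed to act belong to
components that have not crashed. -/
theorem not_crashedBefore_owner (hD : D.IsAFD) (hb : G.IsFairBranch b) {k : ℕ} {κ : Component n}
    (hκ : owner (b k).1 = some κ)
    (hact : ∀ i, (b k).1 = .proc i ∨ (∃ v, (b k).1 = .env i v) → G.Active (tagAt b k) i) :
    ¬ CrashedBefore A G b κ (actSlot n k) := by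
  rintro ⟨i, hi, h⟩
  obtain ⟨u, hu, -, hna⟩ := CrashedBefore.dead hD hb h
  have he := hb.edge k
  have htag : tagAt b (k + 1) = tagAt b k := by
    rcases hl : (b k).1 with j | ⟨j, v⟩ | ⟨j, j', hj⟩ | j <;> rw [hl] at hκ he
    · exact he
    · exact he
    · exact he
    · cases hκ
  rw [htag] at hna
  refine hna (hact i ?_)
  rcases hl : (b k).1 with j | ⟨j, v⟩ | ⟨j, j', hj⟩ | j <;> rw [hl] at hκ <;> cases hκ
  · rcases hi with hi | hi <;> cases hi
    exact Or.inl rfl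
  · rcases hi with hi | hi <;> cases hi
    exact Or.inr ⟨v, rfl⟩
  · rcases hi with hi | hi <;> cases hi

/-- The block number `m / (n + 1)` is the depth of the corresponding configuration. A crash place
leaves it unchanged; an action place increases it. -/
theorem crashSlot_div (k : ℕ) (i : Fin n) :
    crashSlot k i / (n + 1) = k ∧ (crashSlot k i + 1) / (n + 1) = k := by
  have := i.2
  refine ⟨(add_div_and_mod (by omega)).1, ?_⟩
  rw [crashSlot, add_assoc]
  exact (add_div_and_mod (by omega)).1

theorem actSlot_div (n k : ℕ) :
    actSlot n k / (n + 1) = k ∧ (actSlot n k + 1) / (n + 1) = k + 1 := by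
  refine ⟨(add_div_and_mod (by omega)).1, ?_⟩
  have : actSlot n k + 1 = (n + 1) * (k + 1) + 0 := by
    unfold actSlot
    rw [Nat.mul_add]
    omega
  rw [this]
  exact (add_div_and_mod (by omega)).1

/-- A component has the same state as in the configuration of the branch until its location
crashes. -/
theorem stateAt_eq_and_enabled (hD : D.IsAFD) (hb : G.IsFairBranch b) (m : ℕ) :
    (∀ κ, ¬ CrashedBefore A G b κ m → stateAt A G b m κ = A.cfgAt G b (m / (n + 1)) κ) ∧
      ∀ a, slot A G b m = some a → A.system.Enabled (stateAt A G b m) a := by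
  classical
  -- Enabledness of a locally controlled action depends only on its owner, whose state agrees with
  -- the branch because it has not crashed. Crashes and failure-detector outputs are inputs and
  -- always enabled.
  have hen : ∀ m, (∀ κ, ¬ CrashedBefore A G b κ m →
      stateAt A G b m κ = A.cfgAt G b (m / (n + 1)) κ) →
      ∀ a, slot A G b m = some a → A.system.Enabled (stateAt A G b m) a := by
    intro m hm a ha
    rcases slot_cases n m with ⟨k, i, rfl⟩ | ⟨k, rfl⟩
    · rw [slot_crashSlot] at ha
      split_ifs at ha
      cases ha
      exact A.system.input_enabled _ (A.crash_mem_system_input i) _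
    · rw [slot_actSlot] at ha
      rcases actAt_cases hb ha with ⟨u, -, -, hu, rfl⟩ | ⟨-, htask, hE, hact⟩
      · exact A.system.input_enabled _ (A.fd_mem_system_input hD (G.act_mem u hu.mem).1) _
      · obtain ⟨κ, hκ, hc⟩ := A.mem_locallyControlled_of_mem_task htask
        refine (Automaton.compose_enabled_iff A.compatible hc _).2 ?_
        have := (Automaton.compose_enabled_iff A.compatible hc _).1 hE
        rw [hm κ (not_crashedBefore_owner hD hb hκ hact), (actSlot_div n k).1]
        exact this
  suffices h : ∀ κ, ¬ CrashedBefore A G b κ m →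
      stateAt A G b m κ = A.cfgAt G b (m / (n + 1)) κ from ⟨h, hen m h⟩
  induction m with
  | zero => exact fun κ _ => by rw [Nat.zero_div]; rfl
  | succ m ih =>
    intro κ hκ
    have hκ' : ¬ CrashedBefore A G b κ m := by
      rintro ⟨i, hi, m', hm', h⟩
      exact hκ ⟨i, hi, m', by omega, h⟩
    have hm := ih κ hκ'
    rcases hs : slot A G b m with _ | a
    · have hst : stateAt A G b (m + 1) = stateAt A G b m := by
        rw [stateAt, hs]; rfl
      rw [hst, hm]
      rcases slot_cases n m with ⟨k, i, rfl⟩ | ⟨k, rfl⟩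
      · rw [(crashSlot_div k i).1, (crashSlot_div k i).2]
      · rw [slot_actSlot] at hs
        rw [(actSlot_div n k).1, (actSlot_div n k).2, cfgAt_succ, hs]
        rfl
    · have htr : A.system.trans (stateAt A G b m) a (stateAt A G b (m + 1)) := by
        rw [stateAt, hs]
        exact applyAction_trans (hen m ih a hs)
      rcases slot_cases n m with ⟨k, i, rfl⟩ | ⟨k, rfl⟩
      · rw [slot_crashSlot] at hs
        split_ifs at hs with hdies
        cases hs
        rw [(crashSlot_div k i).1] at hm
        rw [(crashSlot_div k i).2, ← hm]
        -- A crash concerns only the process and the environment at its location, and these count as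
        -- crashed from the next place on. All other components keep their state.
        refine (htr.2 κ).2 fun ha => hκ ⟨i, A.crash_mem_acts ha, _, Nat.lt_succ_self _, ?_⟩
        rw [slot_crashSlot, if_pos hdies]
      · rw [slot_actSlot] at hs
        have htr' := cfgAt_trans hD hb hs
        rw [(actSlot_div n k).1] at hm
        rw [(actSlot_div n k).2]
        by_cases ha : a ∈ (A.component κ).acts
        · have h1 := (htr.2 κ).1 ha
          have h2 := (htr'.2 κ).1 ha
          rw [hm] at h1
          exact A.component_trans_unique h1 h2
        · rw [(htr.2 κ).2 ha, (htr'.2 κ).2 ha, hm]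

theorem stateAt_eq (hD : D.IsAFD) (hb : G.IsFairBranch b) {k : ℕ} {κ : Component n}
    (hκ : ¬ CrashedBefore A G b κ (actSlot n k)) :
    stateAt A G b (actSlot n k) κ = A.cfgAt G b k κ := by
  rw [(stateAt_eq_and_enabled hD hb _).1 κ hκ, (actSlot_div n k).1]

theorem stateAt_trans (hD : D.IsAFD) (hb : G.IsFairBranch b) {m : ℕ} {a : Act n M O X}
    (h : slot A G b m = some a) :
    A.system.trans (stateAt A G b m) a (stateAt A G b (m + 1)) := by
  rw [stateAt, h]
  exact applyAction_trans ((stateAt_eq_and_enabled hD hb m).2 a h)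

theorem stateAt_succ_of_none {m : ℕ} (h : slot A G b m = none) :
    stateAt A G b (m + 1) = stateAt A G b m := by
  rw [stateAt, h]; rfl

variable (A G b) in
/-- The state of the environment at `i`. -/
noncomputable def envState (m : ℕ) (i : Fin n) : ULift.{u} Bool := stateAt A G b m (.env i)

/-- The state of the environment at `i` is `true` iff there has been a crash or a
proposal at `i`. -/
theorem envState_iff (hD : D.IsAFD) (hb : G.IsFairBranch b) (i : Fin n) (m : ℕ) :
    envState A G b m i = ⟨true⟩ ↔
      ∃ m' < m, slot A G b m' = some (.crash i) ∨ ∃ v, slot A G b m' = some (.propose i v) := by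
  have hmono : ∀ m, (∃ m' < m + 1, slot A G b m' = some (.crash i) ∨
        ∃ v, slot A G b m' = some (.propose i v)) ↔
      (∃ m' < m, slot A G b m' = some (.crash i) ∨ ∃ v, slot A G b m' = some (.propose i v)) ∨
      (slot A G b m = some (.crash i) ∨ ∃ v, slot A G b m = some (.propose i v)) := by
    intro m
    constructor
    · rintro ⟨m', hm', h⟩
      rcases Nat.lt_succ_iff_lt_or_eq.1 hm' with h' | rfl
      · exact Or.inl ⟨m', h', h⟩
      · exact Or.inr h
    · rintro (⟨m', hm', h⟩ | h)
      · exact ⟨m', by omega, h⟩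
      · exact ⟨m, by omega, h⟩
  induction m with
  | zero =>
    have h0 : envState A G b 0 i = ⟨false⟩ := A.system.start_nonempty.some_mem (.env i)
    rw [h0]
    constructor
    · intro h; cases h
    · rintro ⟨m', hm', -⟩
      omega
  | succ m ih =>
    refine Iff.trans ?_ ((or_congr ih Iff.rfl).trans (hmono m).symm)
    rcases hs : slot A G b m with _ | a
    · have : envState A G b (m + 1) i = envState A G b m i :=
        congrFun (stateAt_succ_of_none hs) (.env i)
      rw [this]
      simp
    · have htr := (stateAt_trans hD hb hs).2 (.env i)
      by_cases ha : a ∈ (A.component (.env i)).acts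
      · rcases htr.1 ha with ⟨rfl, h⟩ | ⟨v, rfl, h⟩ | ⟨v, rfl, -, h⟩
        · have : envState A G b (m + 1) i = ⟨true⟩ := h
          rw [this]; simp
        · have : envState A G b (m + 1) i = envState A G b m i := h
          rw [this]; simp
        · have : envState A G b (m + 1) i = ⟨true⟩ := h
          rw [this]; simp
      · have : envState A G b (m + 1) i = envState A G b m i := htr.2 ha
        rw [this]
        constructor
        · exact Or.inl
        · rintro (h | h | ⟨v, h⟩)
          · exact h
          · cases h
            exact absurd (Or.inl (Or.inl (Or.inl rfl))) ha
          · cases h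
            exact absurd (Or.inl (Or.inr ⟨v, rfl⟩)) ha

theorem slot_eq_propose {m : ℕ} {i : Fin n} {v : Bool}
    (h : slot A G b m = some (.propose i v)) :
    ∃ k, m = actSlot n k ∧ A.actAt G b k = some (.propose i v) :=
  slot_eq_of_ne_crash (by rintro ⟨j, h⟩; cases h) h

/-- An environment task that is scheduled while its location is active has an effect unless there
was a proposal before. -/
theorem exists_propose_of_env (hD : D.IsAFD) (hb : G.IsFairBranch b) {k : ℕ} {i : Fin n}
    {v : Bool} (hl : (b k).1 = .env i v) (hact : G.Active (tagAt b k) i) :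
    ∃ k' ≤ k, ∃ w, A.actAt G b k' = some (.propose i w) := by
  have hact' : ∀ j, (b k).1 = .proc j ∨ (∃ v, (b k).1 = .env j v) → G.Active (tagAt b k) j := by
    rintro j (h | ⟨w, h⟩) <;> rw [hl] at h <;> cases h
    exact hact
  rcases ha : A.actAt G b k with _ | a
  · have hne := not_taskEnabled_of_actAt_eq_none ha hact' (.propose i v) (by rw [hl]; rfl)
    have hc : Act.propose i v ∈ (A.component (.env i)).locallyControlled := Or.inl ⟨v, rfl⟩
    replace hne := mt (Automaton.compose_enabled_iff A.compatible hc _).2 hne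
    have hnc : ¬ CrashedBefore A G b (.env i) (actSlot n k) :=
      not_crashedBefore_owner hD hb (by rw [hl]; rfl) hact'
    rw [← stateAt_eq hD hb hnc] at hne
    -- A proposal is disabled only if `stop` is true, and that is due to an earlier proposal, since
    -- an active location has not crashed.
    have hstate : envState A G b (actSlot n k) i = ⟨true⟩ := by
      by_contra hst
      have hst' : envState A G b (actSlot n k) i = ⟨false⟩ := by
        generalize envState A G b (actSlot n k) i = s at hst
        obtain ⟨_ | _⟩ := s
        · rfl
        · exact absurd rfl hst
      exact hne ⟨⟨true⟩, Or.inr (Or.inr ⟨v, rfl, hst', rfl⟩)⟩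
    obtain ⟨m', hm', h | ⟨w, h⟩⟩ := (envState_iff hD hb i _).1 hstate
    · exact absurd ⟨i, Or.inr rfl, m', hm', h⟩ hnc
    · obtain ⟨k', rfl, hk'⟩ := slot_eq_propose h
      exact ⟨k', (actSlot_lt_actSlot.1 hm').le, w, hk'⟩
  · rcases actAt_cases hb ha with ⟨u, -, h, -, -⟩ | ⟨-, h, -, -⟩
    · rw [hl] at h; cases h
    · rw [hl] at h
      obtain rfl : a = .propose i v := h
      exact ⟨k, le_rfl, v, ha⟩

/-- A crash or a proposal sets `stop` for good, which blocks every later proposal at the location.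
-/
theorem propose_unique (hD : D.IsAFD) (hb : G.IsFairBranch b) {m m' : ℕ} {i : Fin n}
    {v w : Bool} (h : slot A G b m = some (.propose i v))
    (hlt : m' < m) (h' : slot A G b m' = some (.crash i) ∨ slot A G b m' = some (.propose i w)) :
    False := by
  have hst := (envState_iff hD hb i m).2 ⟨m', hlt, h'.imp id fun h => ⟨w, h⟩⟩
  rcases ((stateAt_trans hD hb h).2 (.env i)).1 (Or.inl (Or.inr ⟨v, rfl⟩)) with
    ⟨h, -⟩ | ⟨v, h, -⟩ | ⟨v, -, h, -⟩
  · cases h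
  · cases h
  · cases hst.symm.trans h

/-- The actions of a process are disabled after its crash. -/
theorem not_enabled_after_crash (hD : D.IsAFD) (hb : G.IsFairBranch b) {i : Fin n} {m m' : ℕ}
    (h : slot A G b m = some (.crash i)) (hlt : m < m') {κ : Component n}
    (hκ : κ = .proc i ∨ κ = .env i) :
    ∀ a ∈ (A.component κ).locallyControlled,
      ¬ (A.component κ).Enabled (stateAt A G b m' κ) a := by
  rcases hκ with rfl | rfl
  · have hreach : ∀ p q, p ≤ q → (A.proc i).Reaches (stateAt A G b p (.proc i))
        (stateAt A G b q (.proc i)) := by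
      intro p q hpq
      induction q, hpq using Nat.le_induction with
      | base => exact Relation.ReflTransGen.refl
      | succ q _ ih =>
        rcases hs : slot A G b q with _ | a
        · rw [stateAt_succ_of_none hs]; exact ih
        · have htr := (stateAt_trans hD hb hs).2 (.proc i)
          by_cases ha : a ∈ (A.component (.proc i)).acts
          · exact ih.tail ⟨a, htr.1 ha⟩
          · rw [htr.2 ha]; exact ih
    have hc : Act.crash i ∈ (A.component (.proc i)).acts := by
      refine Or.inl (Or.inl ?_)
      change _ ∈ (A.proc i).input
      rw [A.input_eq]
      exact Or.inr (Or.inr (Or.inl rfl))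
    exact A.crash_disables i _ _ _
      ⟨_, A.system.start_nonempty.some_mem (.proc i), hreach 0 m (Nat.zero_le _)⟩
      (((stateAt_trans hD hb h).2 (.proc i)).1 hc) (hreach (m + 1) m' hlt)
  · have hst := (envState_iff hD hb i m').2 ⟨m, hlt, Or.inl h⟩
    rintro a ha ⟨s', hs'⟩
    have ha' : ∃ v, a = .propose i v := ha.elim id False.elim
    obtain ⟨v, rfl⟩ := ha'
    rcases hs' with ⟨h, -⟩ | ⟨v, h, -⟩ | ⟨v, -, h, -⟩
    · cases h
    · cases h
    · cases hst.symm.trans h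

/-- Every task of the components that do not crash is given infinitely many turns. -/
theorem frequently_task (hD : D.IsAFD) (hb : G.IsFairBranch b) {l : Label n} {κ : Component n}
    (hl : owner l = some κ) (hκ : ∀ i, κ = .proc i ∨ κ = .env i → i ∈ G.live) (K : ℕ) :
    ∃ m ≥ K, (∃ a ∈ A.task l, slot A G b m = some a) ∨
      ∀ a ∈ A.task l, ¬ (A.component κ).Enabled (stateAt A G b m κ) a := by
  obtain ⟨k, hk, rfl⟩ := hb.fair l K
  refine ⟨actSlot n k, hk.trans (le_actSlot n k), ?_⟩
  have hact : ∀ i, (b k).1 = .proc i ∨ (∃ v, (b k).1 = .env i v) → G.Active (tagAt b k) i := by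
    rintro i (h | ⟨v, h⟩) <;> rw [h] at hl <;> cases hl
    · exact hb.active (hκ i (Or.inl rfl)) k
    · exact hb.active (hκ i (Or.inr rfl)) k
  rcases ha : A.actAt G b k with _ | a
  · refine Or.inr fun a hat hE => ?_
    refine not_taskEnabled_of_actAt_eq_none ha hact a hat ?_
    obtain ⟨κ', hκ', hc⟩ := A.mem_locallyControlled_of_mem_task hat
    rw [hl] at hκ'
    cases hκ'
    refine (Automaton.compose_enabled_iff A.compatible hc _).2 ?_
    rw [← stateAt_eq hD hb (not_crashedBefore_owner hD hb hl hact)]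
    exact hE
  · left
    rcases actAt_cases hb ha with ⟨u, -, h, -, -⟩ | ⟨-, h, -, -⟩
    · rw [h] at hl; cases hl
    · exact ⟨a, h, by rw [slot_actSlot, ha]⟩

end Execution

end Algorithm
end CHT

/-! ### Fair branches satisfy the specification of consensus -/

namespace CHT

variable {n : ℕ} {M O X : Type u} {D : Problem (Act n M O X)}

/-- Every sequence of crashes is the sequence of events of a fair execution of a crash automaton. -/
theorem IsCrashAutomaton.exists_execution {C : Automaton (Act n M O X)} (hC : IsCrashAutomaton C)
    {t : Stream'.Seq (Act n M O X)} (ht : ∀ a ∈ t, a ∈ crashes) :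
    ∃ x : C.Fragment, x.IsExecution ∧ x.IsFair ∧ x.events = t := by
  obtain ⟨x, hx, hf, rfl⟩ := hC.all_fair t ht
  refine ⟨x, hx, hf, ?_⟩
  rw [Automaton.Fragment.trace, proj_eq_compress, keepIn_eq_self, compress_get?]
  intro m a hm
  have := C.trans_mem _ _ _ (x.step m a hm)
  rw [hC.internal_eq, Set.union_empty] at this
  exact this

theorem Observation.live_nonempty {G : Observation D} {f : ℕ} (hf : f < n)
    (hlive : {i | i ∉ G.live}.ncard ≤ f) : G.live.Nonempty := by
  by_contra hne
  rw [Set.not_nonempty_iff_eq_empty] at hne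
  rw [hne] at hlive
  simp [Set.ncard_univ] at hlive
  omega

namespace Algorithm

variable {A : Algorithm D} {G : Observation D} {b : ℕ → Label n × VTag n M O X}

/-- Every location dies at most once and there are finitely many locations. So the crash automaton
performs a finite execution, to whose last state its fairness condition applies. -/
theorem exists_forall_slot_ne_crash (hD : D.IsAFD) (hb : G.IsFairBranch b) :
    ∃ L, ∀ m ≥ L, ∀ i, slot A G b m ≠ some (.crash i) := by
  have : ∀ i, ∃ L, ∀ m ≥ L, slot A G b m ≠ some (.crash i) := by
    intro i
    by_cases h : ∃ k, G.DiesAt b k i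
    · obtain ⟨k, hk⟩ := h
      refine ⟨crashSlot k i + 1, fun m hm h => ?_⟩
      obtain ⟨k', rfl, hk'⟩ := (slot_eq_crash hD hb).1 h
      obtain rfl := hb.diesAt_unique hk hk'
      omega
    · refine ⟨0, fun m _ hm => ?_⟩
      obtain ⟨k, -, hk⟩ := (slot_eq_crash hD hb).1 hm
      exact h ⟨k, hk⟩
  choose L hL using this
  exact ⟨Finset.univ.sup L, fun m hm i => hL i m ((Finset.le_sup (Finset.mem_univ i)).trans hm)⟩

theorem exists_slot_isSome (hb : G.IsFairBranch b) (hlive : G.live.Nonempty) (K : ℕ) :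
    ∃ m ≥ K, (slot A G b m).isSome := by
  obtain ⟨i, hi⟩ := hlive
  obtain ⟨m, hm, a, -, h⟩ := exists_slot_output (A := A) hb hi K
  exact ⟨m, hm, by simp [h]⟩

theorem subset_locallyControlled {U : Automaton (Act n M O X)} {T : Set (Act n M O X)}
    (hT : T ∈ U.tasks) : T ⊆ U.locallyControlled := by
  intro a ha
  rw [Automaton.locallyControlled, ← U.tasks_union]
  exact ⟨T, hT, ha⟩

/-- The labels other than `FD_i` exhaust the tasks of the system. For a process this uses that its
single task must consist of all its locally controlled actions. -/
theorem exists_task_eq {κ : Component n} {T : Set (Act n M O X)}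
    (hT : T ∈ (A.component κ).tasks) : ∃ l, owner l = some κ ∧ A.task l = T := by
  cases κ with
  | proc i =>
    refine ⟨.proc i, rfl, ?_⟩
    obtain ⟨-, ⟨T', hT'⟩, -⟩ := A.deterministic i
    change T ∈ (A.proc i).tasks at hT
    rw [hT'] at hT
    obtain rfl : T = T' := hT
    change (A.proc i).output ∪ (A.proc i).internal = T
    rw [← (A.proc i).tasks_union, hT', Set.sUnion_singleton]
  | chan i j h =>
    obtain rfl : T = {a | ∃ m, a = .receive j i m} := hT
    exact ⟨.chan i j h, rfl, rfl⟩
  | env i =>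
    obtain rfl | rfl : T = {.propose i false} ∨ T = {.propose i true} := hT
    · exact ⟨.env i false, rfl, rfl⟩
    · exact ⟨.env i true, rfl, rfl⟩

/-- The actions along a fair branch, interleaved with the crashes, are the events of a fair
execution. -/
theorem exists_fair_execution (hD : D.IsAFD) {C : Automaton (Act n M O X)}
    (hC : IsCrashAutomaton C) (hb : G.IsFairBranch b) (hlive : G.live.Nonempty) :
    ∃ x : (Automaton.compose (A.componentWithCrash C) (A.compatibleWithCrash hC)).Fragment,
      x.IsExecution ∧ x.IsFair ∧ x.events = compress (slot A G b) := by
  set sc := keepIn crashes (slot A G b) with hsc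
  obtain ⟨y, hy, hyf, hye⟩ := hC.exists_execution (t := compress sc) (by
    intro a ha
    obtain ⟨m, hm⟩ := mem_compress.1 ha
    exact (keepIn_eq_some.1 hm).2)
  -- The crash automaton runs on its own clock, which counts the crashes before place `m`.
  let S : ℕ → ∀ κ, (A.componentWithCrash C κ).State := fun m κ => match κ with
    | none => y.states (countSome sc m)
    | some κ => stateAt A G b m κ
  have hSnone : ∀ m, slot A G b m = none → S (m + 1) = S m := by
    intro m hm
    funext κ
    cases κ with
    | none =>
      change y.states _ = y.states _
      rw [countSome_succ_none (show sc m = none from keep_eq_none hm)]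
    | some κ => exact congrFun (stateAt_succ_of_none hm) κ
  -- States are indexed by places, events by their rank among the nonempty places. Empty places do
  -- not change the state, so it can be reindexed.
  obtain ⟨ρ, hρ⟩ := exists_factor_countSome S hSnone
  have hinf := exists_slot_isSome (A := A) hb hlive
  have hCacts : C.acts = crashes := by
    rw [Automaton.acts, hC.input_eq, hC.output_eq, hC.internal_eq]; simp
  have htrans : ∀ m a, slot A G b m = some a →
      (Automaton.compose (A.componentWithCrash C) (A.compatibleWithCrash hC)).trans
        (S m) a (S (m + 1)) := by
    intro m a hm
    obtain ⟨⟨κ, hκ⟩, hall⟩ := stateAt_trans hD hb hm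
    refine ⟨⟨some κ, hκ⟩, fun κ => ?_⟩
    cases κ with
    | none =>
      change (a ∈ C.acts → C.trans (y.states _) a (y.states _)) ∧
        (a ∉ C.acts → y.states _ = y.states _)
      rw [hCacts]
      constructor
      · intro ha
        have h : sc m = some a := keepIn_eq_some.2 ⟨hm, ha⟩
        rw [countSome_succ_some h]
        refine y.step _ a ?_
        rw [hye]
        exact compress_get?_count h
      · intro ha
        have h : sc m = none := by
          rw [Option.eq_none_iff_forall_ne_some]
          intro a' h
          obtain ⟨h1, h2⟩ := keepIn_eq_some.1 h
          rw [hm] at h1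
          cases h1
          exact ha h2
        rw [countSome_succ_none h]
    | some κ => exact hall κ
  let x : (Automaton.compose (A.componentWithCrash C) (A.compatibleWithCrash hC)).Fragment :=
    { states := ρ
      events := compress (slot A G b)
      step := by
        intro k a hk
        obtain ⟨m, hm, rfl⟩ := compress_get?_eq_some.1 hk
        rw [← countSome_succ_some hm, hρ, hρ]
        exact htrans m a hm }
  refine ⟨x, ?_, ?_, rfl⟩
  · have h0 : ρ 0 = S 0 := by rw [← hρ 0, countSome_zero]
    change ρ 0 ∈ _
    rw [h0]
    intro κ
    cases κ with
    | none =>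
      change y.states (countSome sc 0) ∈ C.start
      rw [countSome_zero]
      exact hy
    | some κ => exact A.system.start_nonempty.some_mem κ
  · intro T hT
    refine ⟨fun L hL => absurd hL (not_hasLength_compress hinf L), fun _ => ?_⟩
    obtain ⟨κ, hκ⟩ := Set.mem_iUnion.1 hT
    suffices h : ∀ K, ∃ m ≥ K, (∃ a ∈ T, slot A G b m = some a) ∨
        ∀ a ∈ T, ¬ (A.componentWithCrash C κ).Enabled (S m κ) a by
      -- Either the task acts infinitely often, or from some place on it never does and then its
      -- infinitely many turns find it disabled.
      by_cases hfr : ∀ K, ∃ m ≥ K, ∃ a ∈ T, slot A G b m = some a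
      · left
        refine infinite_of_frequently hinf
          (P := fun k => ∃ a ∈ T, (compress (slot A G b)).get? k = some a) fun K => ?_
        obtain ⟨m, hm, a, ha, h⟩ := hfr K
        exact ⟨m, hm, a, ha, compress_get?_count h⟩
      · right
        push Not at hfr
        obtain ⟨K₀, hK₀⟩ := hfr
        refine infinite_of_frequently hinf
          (P := fun k => ¬ (Automaton.compose (A.componentWithCrash C)
            (A.compatibleWithCrash hC)).TaskEnabled (ρ k) T) fun K => ?_
        obtain ⟨m, hm, ⟨a, ha, h'⟩ | h'⟩ := h (max K K₀)
        · exact absurd h' (hK₀ m (le_trans (le_max_right _ _) hm) a ha)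
        · refine ⟨m, le_trans (le_max_left _ _) hm, ?_⟩
          rintro ⟨a, ha, hE⟩
          rw [hρ] at hE
          exact h' a ha ((Automaton.compose_enabled_iff (A.compatibleWithCrash hC)
            (subset_locallyControlled hκ ha) _).1 hE)
    intro K
    cases κ with
    | none =>
      obtain ⟨L, hL⟩ := exists_forall_slot_ne_crash (A := A) hD hb
      have hLn : ∀ m ≥ L, sc m = none := by
        intro m hm
        rw [Option.eq_none_iff_forall_ne_some]
        intro a h
        obtain ⟨h1, i, rfl⟩ := keepIn_eq_some.1 h
        exact hL m hm i h1
      have hlen := hasLength_compress hLn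
      rw [← hye] at hlen
      -- After the last crash the crash automaton stays in the final state of a finite fair
      -- execution, where no task is enabled.
      refine ⟨max K L, le_max_left _ _, Or.inr fun a ha hE => (hyf T hκ).1 _ hlen ⟨a, ha, ?_⟩⟩
      have hconst : ∀ m ≥ L, countSome sc m = countSome sc L := by
        intro m hm
        induction m, hm using Nat.le_induction with
        | base => rfl
        | succ m hm ih => rw [countSome_succ_none (hLn m hm), ih]
      rw [← hconst (max K L) (le_max_right _ _)]
      exact hE
    | some κ =>
      obtain ⟨l, hl, rfl⟩ := exists_task_eq (A := A) hκ
      by_cases hlv : ∀ i, κ = .proc i ∨ κ = .env i → i ∈ G.live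
      · exact frequently_task hD hb hl hlv K
      -- A component at a location that is not live is disabled after the crash of that location.
      · push Not at hlv
        obtain ⟨i, hi, hil⟩ := hlv
        obtain ⟨k, hk⟩ := hb.exists_diesAt hlive hil
        have hcr := (slot_eq_crash (A := A) hD hb).2 ⟨k, rfl, hk⟩
        refine ⟨max K (crashSlot k i + 1), le_max_left _ _, Or.inr fun a ha => ?_⟩
        exact not_enabled_after_crash hD hb hcr (le_max_right K _) hi a
          (subset_locallyControlled hκ ha)

/-- What the specification of consensus says about the actions along a fair branch. -/
theorem consensus_of_isFairBranch {f : ℕ} (hf : f < n) (hD : D.IsStrongSamplingAFD)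
    {C : Automaton (Act n M O X)} {hC : IsCrashAutomaton C} (hA : A.SolvesConsensus hC f)
    (hG : G.Viable) (hlive : {i | i ∉ G.live}.ncard ≤ f) (hb : G.IsFairBranch b) :
    (∃ k i v, A.actAt G b k = some (.decide i v)) ∧
    (∀ k k' i j v w, A.actAt G b k = some (.decide i v) →
      A.actAt G b k' = some (.decide j w) → v = w) ∧
    ∀ k i v, A.actAt G b k = some (.decide i v) → ∃ k' j, A.actAt G b k' = some (.propose j v) := by
  obtain ⟨i₀, hi₀⟩ := Observation.live_nonempty hf hlive
  have hne : G.live.Nonempty := ⟨i₀, hi₀⟩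
  have hexec := exists_fair_execution (A := A) hD.toIsAFD hC hb hne
  obtain ⟨t, ht, hcomp⟩ := hG
  obtain ⟨pos, hpos⟩ := hcomp.exists_isPosition
  have hDT := compress_slot_mem (A := A) hD hb hne ht hpos
  set U := Automaton.compose (A.componentWithCrash C) (A.compatibleWithCrash hC) with hU
  obtain ⟨x, hx, hxf, hxe⟩ := hexec
  have hext : ∀ κ, ∀ a ∈ (A.componentWithCrash C κ).external, a ∈ U.external := by
    rintro κ a (ha | ha)
    · by_cases h : a ∈ ⋃ κ, (A.componentWithCrash C κ).output
      · exact Or.inr h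
      · exact Or.inl ⟨Set.mem_iUnion.2 ⟨κ, ha⟩, h⟩
    · exact Or.inr (Set.mem_iUnion.2 ⟨κ, ha⟩)
  have hproc : ∀ i, ∀ a ∈ (A.proc i).external, a ∈ U.external := fun i =>
    hext (some (.proc i))
  have hcrash : ∀ i, Act.crash i ∈ U.external := fun i =>
    hproc i _ (Or.inl (by rw [A.input_eq]; exact Or.inr (Or.inr (Or.inl rfl))))
  have hsubD : D.I ∪ D.O ⊆ U.external := by
    rintro a (ha | ha)
    · rw [hD.crash_exclusivity] at ha
      obtain ⟨i, rfl⟩ := ha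
      exact hcrash i
    · exact hproc a.loc _ (Or.inl (by
        rw [A.input_eq]; exact Or.inr (Or.inr (Or.inr ⟨ha, rfl⟩))))
  set B := (consensus n M O X f).I ∪ (consensus n M O X f).O with hB
  have hsubB : B ⊆ U.external := by
    rintro a ((⟨i, v, rfl⟩ | ⟨i, rfl⟩) | ⟨i, v, rfl⟩)
    · exact hproc i _ (Or.inl (by rw [A.input_eq]; exact Or.inr (Or.inl ⟨v, rfl⟩)))
    · exact hcrash i
    · exact hproc i _ (Or.inr (by rw [A.output_eq]; exact Or.inr ⟨v, rfl⟩))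
  have htrace : x.trace = compress (keepIn U.external (slot A G b)) := by
    rw [Automaton.Fragment.trace, hxe, proj_compress]
  obtain ⟨-, hcons⟩ := hA x.trace ⟨x, hx, hxf, rfl⟩ (by
    rw [htrace, proj_compress, keepIn_keepIn hsubD, hD.crash_exclusivity]
    exact hDT)
  rw [htrace, proj_compress, keepIn_keepIn hsubB] at hcons
  set s := keepIn B (slot A G b) with hs
  have hcr : ∀ i m, s m = some (.crash i) ↔ slot A G b m = some (.crash i) := fun i m =>
    keepIn_eq_some.trans ⟨fun h => h.1, fun h => ⟨h, Or.inl (Or.inr ⟨i, rfl⟩)⟩⟩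
  have hpr : ∀ i v m, s m = some (.propose i v) ↔ slot A G b m = some (.propose i v) :=
    fun i v m =>
      keepIn_eq_some.trans ⟨fun h => h.1, fun h => ⟨h, Or.inl (Or.inl ⟨i, v, rfl⟩)⟩⟩
  have hde : ∀ i v, .decide i v ∈ compress s ↔ ∃ k, A.actAt G b k = some (.decide i v) := by
    intro i v
    rw [mem_compress]
    constructor
    · rintro ⟨m, hm⟩
      obtain ⟨k, -, hk⟩ := slot_eq_of_ne_crash (by rintro ⟨j, h⟩; cases h)
        (keepIn_eq_some.1 hm).1
      exact ⟨k, hk⟩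
    · rintro ⟨k, hk⟩
      exact ⟨actSlot n k, keepIn_eq_some.2 ⟨by rw [slot_actSlot, hk], Or.inr ⟨i, v, rfl⟩⟩⟩
  have hprm : ∀ i v, .propose i v ∈ compress s ↔ ∃ k, A.actAt G b k = some (.propose i v) := by
    intro i v
    rw [mem_compress]
    constructor
    · rintro ⟨m, hm⟩
      obtain ⟨k, -, hk⟩ := slot_eq_propose ((hpr i v m).1 hm)
      exact ⟨k, hk⟩
    · rintro ⟨k, hk⟩
      exact ⟨actSlot n k, (hpr i v _).2 (by rw [slot_actSlot, hk])⟩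
  have hfaulty : ∀ i, i ∈ faulty (compress s) ↔ i ∉ G.live := by
    intro i
    change .crash i ∈ compress s ↔ _
    rw [mem_compress]
    constructor
    · rintro ⟨m, hm⟩ hi
      obtain ⟨k, -, hk⟩ := (slot_eq_crash hD.toIsAFD hb).1 ((hcr i m).1 hm)
      exact hb.not_dead hi _ hk.2
    · intro hi
      obtain ⟨k, hk⟩ := hb.exists_diesAt hne hi
      exact ⟨_, (hcr i _).2 ((slot_eq_crash hD.toIsAFD hb).2 ⟨k, rfl, hk⟩)⟩
  -- The environment is part of the system, so well-formedness is proved for the execution and not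
  -- assumed. It is needed to unlock the guarantees of consensus.
  have hwf : EnvironmentWellFormed (compress s) := by
    intro i
    have h1 : AtMostOne (proposals i) (compress s) := by
      rintro k k' _ ⟨v, rfl⟩ _ ⟨w, rfl⟩ hk hk'
      obtain ⟨m, hm, rfl⟩ := compress_get?_eq_some.1 hk
      obtain ⟨m', hm', rfl⟩ := compress_get?_eq_some.1 hk'
      rw [hpr] at hm hm'
      rcases lt_trichotomy m m' with hlt | rfl | hlt
      · exact (propose_unique hD.toIsAFD hb hm' hlt (Or.inr hm)).elim
      · rfl
      · exact (propose_unique hD.toIsAFD hb hm hlt (Or.inr hm')).elim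
    refine ⟨h1, ?_, fun hi => ⟨h1, ?_⟩⟩
    · rintro k k' hlt hk _ ⟨v, rfl⟩ hk'
      obtain ⟨m, hm, rfl⟩ := compress_get?_eq_some.1 hk
      obtain ⟨m', hm', rfl⟩ := compress_get?_eq_some.1 hk'
      rw [countSome_lt_iff hm] at hlt
      rw [hcr] at hm
      rw [hpr] at hm'
      exact propose_unique (v := v) (w := v) hD.toIsAFD hb hm' hlt (Or.inl hm)
    · rw [hfaulty, not_not] at hi
      -- Any turn of an environment task at a live location ensures a proposal no later than this
      -- turn, possibly of the other value.
      obtain ⟨k, -, hk⟩ := hb.fair (.env i true) 0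
      obtain ⟨k', -, w, h⟩ := exists_propose_of_env hD.toIsAFD hb hk (hb.active hi k)
      exact ⟨_, ⟨w, rfl⟩, (hprm i w).2 ⟨k', h⟩⟩
  have hlim : CrashLimitation f (compress s) := by
    have : faulty (compress s) = {i | i ∉ G.live} := Set.ext hfaulty
    rw [CrashLimitation, this]
    exact hlive
  obtain ⟨-, hagr, hval, hterm⟩ := hcons hwf hlim
  refine ⟨?_, fun k k' i j v w hk hk' => ?_, fun k i v hk => ?_⟩
  · obtain ⟨-, _, ⟨v, rfl⟩, h⟩ := (hterm i₀).2 (by rw [hfaulty, not_not]; exact hi₀)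
    obtain ⟨k, hk⟩ := (hde i₀ v).1 h
    exact ⟨k, i₀, v, hk⟩
  · exact hagr i j v w ((hde i v).2 ⟨k, hk⟩) ((hde j w).2 ⟨k', hk'⟩)
  · obtain ⟨j, h⟩ := hval i v ((hde i v).2 ⟨k, hk⟩)
    obtain ⟨k', hk'⟩ := (hprm j v).1 h
    exact ⟨k', j, hk'⟩

end Algorithm
end CHT

/-! ### Valence and the existence of a non-`⊥` decision gadget -/

namespace CHT

variable {n : ℕ} {M O X : Type u} {D : Problem (Act n M O X)}

theorem nodeAt_prefix (b : ℕ → Label n × VTag n M O X) {j k : ℕ} (h : j ≤ k) :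
    nodeAt b j <+: nodeAt b k := by
  induction k, h using Nat.le_induction with
  | base => exact List.prefix_refl _
  | succ k _ ih =>
    rw [nodeAt_succ]
    exact ih.trans (List.prefix_append _ _)

namespace Observation

variable {G : Observation D}

theorem isNode_iff (hV : G.V.Infinite) {N : Node n M O X} : G.IsNode N ↔ G.PathFrom none N := by
  rw [IsNode, hV.encard_eq]
  simp

theorem pathFrom_append_singleton {N : Node n M O X} {e : Label n × VTag n M O X} :
    G.PathFrom none (N ++ [e]) ↔ G.PathFrom none N ∧ G.EdgeOut (Node.vtag N) e.1 e.2 := by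
  rw [pathFrom_append, pathFrom_singleton, vtag_eq_endTag]

theorem exists_isFairBranch_of_pathFrom (hn : 0 < n) {N : Node n M O X}
    (hN : G.PathFrom none N) : ∃ b, G.IsFairBranch b ∧ nodeAt b N.length = N := by
  obtain ⟨b, hb, h, -⟩ := exists_isFairBranch (G := G) hn (P := fun N => G.PathFrom none N)
    (fun _ h => h) hN fun N hN l => by
      obtain ⟨w, hw⟩ := G.exists_edgeOut (Node.vtag N) l
      refine ⟨[], w, ?_⟩
      rw [List.append_nil, pathFrom_append_singleton]
      exact ⟨hN, hw⟩
  exact ⟨b, hb, h⟩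

end Observation

namespace Algorithm

variable {A : Algorithm D} {G : Observation D} {N N' : Node n M O X} {v w : Bool}

theorem hasDecision_nodeAt {b : ℕ → Label n × VTag n M O X} {k : ℕ} :
    A.HasDecision G (nodeAt b k) v ↔ ∃ j < k, ∃ i, A.actAt G b j = some (.decide i v) := by
  simp only [HasDecision, pathActions_nodeAt, List.mem_map, List.mem_range]
  constructor
  · rintro ⟨i, j, hj, h⟩
    exact ⟨j, hj, i, h⟩
  · rintro ⟨j, hj, i, h⟩
    exact ⟨i, j, hj, h⟩

theorem HasDecision.mono (h : N <+: N') (hN : A.HasDecision G N v) : A.HasDecision G N' v := by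
  obtain ⟨q, rfl⟩ := h
  obtain ⟨i, hi⟩ := hN
  refine ⟨i, ?_⟩
  rw [pathActions_append]
  exact List.mem_append_left _ hi

theorem nonBot_append {q : Node n M O X} : A.NonBot G (N ++ q) ↔
    A.NonBot G N ∧ none ∉ A.actionsFrom G (A.config G N) (Node.vtag N) q := by
  rw [NonBot, pathActions_append, List.mem_append, not_or]
  rfl

theorem edgeAction_eq_actionTag (N : Node n M O X) (e : Label n × VTag n M O X) :
    A.actionsFrom G (A.config G N) (Node.vtag N) [e] = [A.actionTag G ⟨N, e.1, e.2⟩] := rfl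

/-- A decision value occurs on the path to some descendant. -/
def Reaches (A : Algorithm D) (G : Observation D) (N : Node n M O X) (v : Bool) : Prop :=
  ∃ N', G.IsDescendant N' N ∧ A.HasDecision G N' v

theorem Reaches.of_prefix (h : N <+: N') (hN : A.Reaches G N' v) : A.Reaches G N v := by
  obtain ⟨N'', ⟨h1, h2⟩, h3⟩ := hN
  exact ⟨N'', ⟨h1, h.trans h2⟩, h3⟩

theorem valent_iff : A.Valent G v N ↔ A.Reaches G N v ∧ ¬ A.Reaches G N (!v) := by
  constructor
  · rintro ⟨h1, h2⟩
    exact ⟨h1, fun ⟨N', h, h'⟩ => h2 N' h h'⟩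
  · rintro ⟨h1, h2⟩
    exact ⟨h1, fun N' h h' => h2 ⟨N', h, h'⟩⟩

theorem Valent.unique (h : A.Valent G v N) (h' : A.Valent G w N) : v = w := by
  rw [valent_iff] at h h'
  by_contra hne
  have : w = !v := by cases v <;> cases w <;> simp_all
  exact h.2 (this ▸ h'.1)

/-- Infinite observations for which all fair branches of the tree comply with the specification of
consensus. -/
structure Complies (A : Algorithm D) (G : Observation D) : Prop where
  pos : 0 < n
  infinite : G.V.Infinite
  decides : ∀ b, G.IsFairBranch b → ∃ k i v, A.actAt G b k = some (.decide i v)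
  agreement : ∀ b, G.IsFairBranch b → ∀ k k' i j v w, A.actAt G b k = some (.decide i v) →
    A.actAt G b k' = some (.decide j w) → v = w
  validity : ∀ b, G.IsFairBranch b → ∀ k i v, A.actAt G b k = some (.decide i v) →
    ∃ k' j, A.actAt G b k' = some (.propose j v)

/-- Extend the finite path to a fair branch and use agreement there. -/
theorem Complies.decision_unique (h : A.Complies G) (hN : G.PathFrom none N)
    (hv : A.HasDecision G N v) (hw : A.HasDecision G N w) : v = w := by
  obtain ⟨b, hb, hbN⟩ := G.exists_isFairBranch_of_pathFrom h.pos hN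
  rw [← hbN, hasDecision_nodeAt] at hv hw
  obtain ⟨j, -, i, hi⟩ := hv
  obtain ⟨j', -, i', hi'⟩ := hw
  exact h.agreement b hb _ _ _ _ _ _ hi hi'

/-- A fair branch through `N` decides at some depth. A node of that branch below both `N` and the
decision is the required descendant. Thus no node of the tree lacks a valence. -/
theorem Complies.exists_reaches (h : A.Complies G) (hN : G.PathFrom none N) :
    ∃ v, A.Reaches G N v := by
  obtain ⟨b, hb, hbN⟩ := G.exists_isFairBranch_of_pathFrom h.pos hN
  obtain ⟨k, i, v, hk⟩ := h.decides b hb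
  refine ⟨v, nodeAt b (max (k + 1) N.length),
    ⟨(Observation.isNode_iff h.infinite).2 (Observation.pathFrom_nodeAt hb.edge _), ?_⟩,
    hasDecision_nodeAt.2 ⟨k, lt_of_lt_of_le (Nat.lt_succ_self k) (le_max_left _ _), i, hk⟩⟩
  conv_lhs => rw [← hbN]
  exact nodeAt_prefix b (le_max_right _ _)

theorem Complies.bivalent_or_valent (h : A.Complies G) (hN : G.PathFrom none N) :
    A.Bivalent G N ∨ ∃ v, A.Valent G v N := by
  obtain ⟨v, hv⟩ := h.exists_reaches hN
  by_cases hv' : A.Reaches G N (!v)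
  · left
    intro w
    rcases Bool.eq_or_eq_not w v with rfl | rfl
    · exact hv
    · exact hv'
  · exact Or.inr ⟨v, valent_iff.2 ⟨hv, hv'⟩⟩

theorem Complies.not_reaches_of_hasDecision (h : A.Complies G) (hv : A.HasDecision G N v) :
    ¬ A.Reaches G N (!v) := by
  rintro ⟨N', ⟨h1, h2⟩, h3⟩
  have := h.decision_unique ((Observation.isNode_iff h.infinite).1 h1) (hv.mono h2) h3
  cases v <;> simp at this

theorem Complies.valent_of_prefix (h : A.Complies G) (hN' : G.PathFrom none N')
    (hpre : N <+: N') (hN : A.Valent G v N) : A.Valent G v N' := by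
  rw [valent_iff] at hN ⊢
  obtain ⟨w, hw⟩ := h.exists_reaches hN'
  rcases Bool.eq_or_eq_not w v with rfl | rfl
  · exact ⟨hw, fun h' => hN.2 (h'.of_prefix hpre)⟩
  · exact absurd (hw.of_prefix hpre) hN.2

/-- A branch that starts with all the tasks that propose `v` leads to the decision `v`. -/
theorem Complies.bivalent_root (h : A.Complies G) (hD : D.IsAFD) : A.Bivalent G [] := by
  intro v
  -- Schedule `Env_{1,v}, …, Env_{n,v}` first, before any vertex is consumed, so that only `v` can
  -- be proposed. Validity then forces the decision `v`.
  let N₀ : Node n M O X := (List.finRange n).map fun i => (Label.env i v, none)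
  have hN₀ : G.PathFrom none N₀ := by
    have : ∀ L : List (Fin n), G.PathFrom none (L.map fun i => (Label.env i v, none)) := by
      intro L
      induction L with
      | nil => trivial
      | cons i L ih => exact ⟨rfl, ih⟩
    exact this _
  have hlen : N₀.length = n := by simp [N₀]
  obtain ⟨b, hb, hbN⟩ := G.exists_isFairBranch_of_pathFrom h.pos hN₀
  rw [hlen] at hbN
  have hbi : ∀ i : Fin n, b i = (Label.env i v, none) := by
    intro i
    have h1 : (nodeAt b n)[(i : ℕ)]'(by rw [length_nodeAt]; exact i.2) = b i := by
      simp [nodeAt]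
    rw [← h1]
    simp only [hbN]
    simp [N₀]
  obtain ⟨k, i, w, hk⟩ := h.decides b hb
  have hreach : A.Reaches G [] w := ⟨nodeAt b (k + 1),
    ⟨(Observation.isNode_iff h.infinite).2 (Observation.pathFrom_nodeAt hb.edge _),
      List.nil_prefix⟩, hasDecision_nodeAt.2 ⟨k, Nat.lt_succ_self k, i, hk⟩⟩
  suffices hwv : w = v by rw [← hwv]; exact hreach
  obtain ⟨k', j, hk'⟩ := h.validity b hb k i w hk
  have henv : ∀ {k j w}, A.actAt G b k = some (.propose j w) →
      (b k).1 = .env j w ∧ G.Active (tagAt b k) j := by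
    intro k j w hk
    rcases actAt_cases hb hk with ⟨u, -, -, hu, h'⟩ | ⟨-, h', -, hact⟩
    · obtain ⟨i, o, h''⟩ := hD.outputs _ (G.act_mem u hu.mem).1
      rw [← h'] at h''
      cases h''
    · have := A.eq_env_of_propose_mem_task h'
      exact ⟨this, hact j (Or.inr ⟨w, this⟩)⟩
  have hact := (henv hk').2
  -- A location that is inactive at the root never proposes. One that proposes later was active at
  -- the root, so its early turn had an effect unless it had proposed already.
  have hact0 : G.Active (tagAt b j) j := by
    have h0 : tagAt b j = none := by
      rcases hj : (j : ℕ) with _ | m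
      · rfl
      · have := hbi ⟨m, by omega⟩
        simp only at this
        rw [tagAt, this]
    rw [h0]
    exact (hb.tagLE (Nat.zero_le k')).active hact
  -- The proposal falls among the first `n` edges, whose labels all propose `v`. Uniqueness of the
  -- proposal at `j` gives `w = v`.
  obtain ⟨k₂, hk₂, w', hw'⟩ := exists_propose_of_env hD hb (by rw [hbi j]) hact0
  have hw'v : w' = v := by
    have h1 := (henv hw').1
    have h2 := hbi ⟨k₂, by omega⟩
    simp only at h2
    rw [h2] at h1
    exact (Label.env.inj h1).2.symm
  subst hw'v
  rw [← slot_actSlot] at hk' hw'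
  rcases lt_trichotomy (actSlot n k') (actSlot n k₂) with hlt | heq | hlt
  · exact (propose_unique hD hb hw' hlt (Or.inr hk')).elim
  · rw [heq, hw'] at hk'
    cases hk'
    rfl
  · exact (propose_unique hD hb hk' hlt (Or.inr hw')).elim

/-- Some bivalent node has a label such that no edge with this label below the node leads to a
bivalent node. -/
theorem Complies.exists_critical (h : A.Complies G) (hD : D.IsAFD) :
    ∃ N l, G.PathFrom none N ∧ A.Bivalent G N ∧ ∀ q w, G.PathFrom none (N ++ q ++ [(l, w)]) →
      ¬ A.Bivalent G (N ++ q ++ [(l, w)]) := by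
  -- Otherwise bivalence can be preserved while every label gets its turn again and again. The
  -- resulting fair branch decides, yet bivalent nodes occur below the decision.
  by_contra! hcon
  obtain ⟨b, hb, -, hP⟩ := Observation.exists_isFairBranch (G := G) h.pos
    (P := fun N => G.PathFrom none N ∧ A.Bivalent G N) (fun N hN => hN.1) (N₀ := [])
    ⟨trivial, h.bivalent_root hD⟩ fun N hN l => hcon N l hN.1 hN.2
  obtain ⟨k, i, v, hk⟩ := h.decides b hb
  obtain ⟨k', hk', -, hbiv⟩ := hP (k + 1)
  exact h.not_reaches_of_hasDecision (hasDecision_nodeAt.2 ⟨k, hk', i, hk⟩) (hbiv (!v))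

/-- Nodes with the same configuration, vertex tag and action tags have the same descendants. -/
theorem reaches_append_congr (hV : G.V.Infinite) {N₁ N₂ : Node n M O X}
    (h₁ : G.PathFrom none N₁) (h₂ : G.PathFrom none N₂) (hc : A.config G N₁ = A.config G N₂)
    (ht : Node.vtag N₁ = Node.vtag N₂)
    (ha : ∀ a, some a ∈ A.pathActions G N₁ ↔ some a ∈ A.pathActions G N₂) (q : Node n M O X) :
    (G.PathFrom none (N₁ ++ q) ↔ G.PathFrom none (N₂ ++ q)) ∧
      (A.Reaches G (N₁ ++ q) v ↔ A.Reaches G (N₂ ++ q) v) := by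
  have hpath : ∀ q, G.PathFrom none (N₁ ++ q) ↔ G.PathFrom none (N₂ ++ q) := by
    intro q
    rw [Observation.pathFrom_append, Observation.pathFrom_append, ← vtag_eq_endTag,
      ← vtag_eq_endTag, ht]
    simp only [h₁, h₂]
  have hdec : ∀ q, A.HasDecision G (N₁ ++ q) v ↔ A.HasDecision G (N₂ ++ q) v := by
    intro q
    simp only [HasDecision, pathActions_append, List.mem_append, hc, ht, ha]
  refine ⟨hpath q, ?_⟩
  constructor
  · rintro ⟨_, ⟨h1, r, rfl⟩, h2⟩
    rw [List.append_assoc] at h1 h2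
    refine ⟨N₂ ++ (q ++ r), ⟨?_, ?_⟩, (hdec _).1 h2⟩
    · rw [Observation.isNode_iff hV] at h1 ⊢
      exact (hpath _).1 h1
    · rw [← List.append_assoc]
      exact List.prefix_append _ _
  · rintro ⟨_, ⟨h1, r, rfl⟩, h2⟩
    rw [List.append_assoc] at h1 h2
    refine ⟨N₁ ++ (q ++ r), ⟨?_, ?_⟩, (hdec _).2 h2⟩
    · rw [Observation.isNode_iff hV] at h1 ⊢
      exact (hpath _).2 h1
    · rw [← List.append_assoc]
      exact List.prefix_append _ _

theorem Complies.exists_critical_nonBot (h : A.Complies G) (hD : D.IsAFD) :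
    ∃ N l, G.PathFrom none N ∧ A.NonBot G N ∧ A.Bivalent G N ∧
      ∀ q w, G.PathFrom none (N ++ q ++ [(l, w)]) → ¬ A.Bivalent G (N ++ q ++ [(l, w)]) := by
  obtain ⟨N, l, hN, hbiv, hcrit⟩ := h.exists_critical hD
  -- Deleting the `⊥`-edges above the node keeps configuration, tag and occurring actions, hence the
  -- whole subtree with its valences.
  obtain ⟨N', h1, h2, h3, h4, h5⟩ :=
    exists_path_without_bot (A := A) (c := A.startState) (fun _ _ hu => hu) N hN
  rw [← vtag_eq_endTag, ← vtag_eq_endTag] at h4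
  have hcongr := fun v q => reaches_append_congr (v := v) h.infinite h1 hN h3 h4 h5 q
  refine ⟨N', l, h1, h2, fun v => ?_, fun q w hp hb => ?_⟩
  · have := (hcongr v []).2
    rw [List.append_nil, List.append_nil] at this
    exact this.2 (hbiv v)
  · rw [List.append_assoc] at hp hb
    refine hcrit q w ?_ fun v => ?_
    · rw [List.append_assoc]
      exact (hcongr true _).1.1 hp
    · rw [List.append_assoc]
      exact (hcongr v _).2.1 (hb v)

theorem Complies.isEdgeOf (h : A.Complies G) {l : Label n} {w : VTag n M O X}
    (hN : G.PathFrom none (N ++ [(l, w)])) : G.IsEdgeOf ⟨N, l, w⟩ N l :=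
  ⟨rfl, rfl, (Observation.isNode_iff h.infinite).2 hN⟩

theorem bivalent_of_valent_of_valent_not {N₁ N₂ : Node n M O X} (h₁ : N <+: N₁) (h₂ : N <+: N₂)
    (hv₁ : A.Valent G v N₁) (hv₂ : A.Valent G (!v) N₂) : A.Bivalent G N := by
  intro w
  rcases Bool.eq_or_eq_not w v with rfl | rfl
  · exact Reaches.of_prefix h₁ hv₁.1
  · exact Reaches.of_prefix h₂ hv₂.1

/-- There is a non-`⊥` decision gadget. -/
theorem Complies.exists_isNonBotDecisionGadget (h : A.Complies G) (hD : D.IsAFD) :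
    ∃ Y, A.IsNonBotDecisionGadget G Y := by
  by_contra! hcon
  obtain ⟨N, l, hN, hnb, hbiv, hcrit⟩ := h.exists_critical_nonBot hD
  have hval : ∀ q w, G.PathFrom none (N ++ q ++ [(l, w)]) →
      ∃ v, A.Valent G v (N ++ q ++ [(l, w)]) := fun q w hp =>
    (h.bivalent_or_valent hp).resolve_left (hcrit q w hp)
  have hne : ∀ {v v' : Bool}, v ≠ v' → v' = !v := fun {v v'} h => by
    cases v <;> cases v' <;> simp_all
  have hfork : ∀ q w w' v v', A.NonBot G (N ++ q) → G.PathFrom none (N ++ q ++ [(l, w)]) →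
      G.PathFrom none (N ++ q ++ [(l, w')]) → A.Valent G v (N ++ q ++ [(l, w)]) →
      A.Valent G v' (N ++ q ++ [(l, w')]) → v = v' := by
    intro q w w' v v' hq hp hp' hv hv'
    by_contra hvv
    obtain rfl := hne hvv
    refine hcon (.four (N ++ q) l ⟨N ++ q, l, w⟩ ⟨N ++ q, l, w'⟩) ⟨⟨⟨?_, ?_, ?_⟩, ?_, v, hv, hv'⟩, hq⟩
    · exact (Observation.isNode_iff h.infinite).2 (Observation.pathFrom_append.1 hp).1
    · exact h.isEdgeOf hp
    · exact h.isEdgeOf hp'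
    · exact bivalent_of_valent_of_valent_not (List.prefix_append _ _) (List.prefix_append _ _)
        hv hv'
  obtain ⟨w₀, hw₀⟩ := G.exists_edgeOut (Node.vtag N) l
  obtain ⟨v₀, hv₀⟩ := hval [] w₀ (by
    rw [List.append_nil, Observation.pathFrom_append_singleton]; exact ⟨hN, hw₀⟩)
  -- Without forks, all `l`-edges of one node lead to the same valence. Without hooks, this valence
  -- is unchanged along each non-`⊥` edge. So it is `v₀` everywhere below `N` on paths without `⊥`.
  have hall : ∀ q, A.NonBot G (N ++ q) → ∀ w v, G.PathFrom none (N ++ q ++ [(l, w)]) →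
      A.Valent G v (N ++ q ++ [(l, w)]) → v = v₀ := by
    intro q
    induction q using List.reverseRecOn with
    | nil =>
      intro hq w v hp hv
      refine hfork [] w w₀ v v₀ hq hp ?_ hv hv₀
      rw [List.append_nil, Observation.pathFrom_append_singleton]
      exact ⟨hN, hw₀⟩
    | append_singleton q e ih =>
      obtain ⟨r, t⟩ := e
      intro hq w' v' hp' hv'
      rw [← List.append_assoc] at hq hp' hv'
      have hpe : G.PathFrom none (N ++ q ++ [(r, t)]) := (Observation.pathFrom_append.1 hp').1
      have hpq : G.PathFrom none (N ++ q) := (Observation.pathFrom_append.1 hpe).1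
      obtain ⟨hq, htag⟩ := nonBot_append.1 hq
      obtain ⟨w, hw⟩ := G.exists_edgeOut (Node.vtag (N ++ q)) l
      have hp : G.PathFrom none (N ++ q ++ [(l, w)]) :=
        Observation.pathFrom_append_singleton.2 ⟨hpq, hw⟩
      obtain ⟨v, hv⟩ := hval q w hp
      rw [← ih hq w v hp hv]
      -- If the step is itself an `l`-edge, its endpoint is already univalent and passes its valence
      -- on. Otherwise a change of valence gives a hook, whose `r`-edge is not `⊥` because the path
      -- is without `⊥`.
      by_cases hrl : r = l
      · subst hrl
        obtain ⟨v'', hv''⟩ := hval q t hpe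
        rw [← hfork q t w v'' v hq hpe hp hv'' hv]
        exact hv'.unique (h.valent_of_prefix hp' (List.prefix_append _ _) hv'')
      · by_contra hvv
        obtain rfl := hne (Ne.symm hvv)
        refine hcon (.six (N ++ q) l r ⟨N ++ q, l, w⟩ ⟨N ++ q, r, t⟩
          ⟨N ++ q ++ [(r, t)], l, w'⟩)
          ⟨⟨⟨?_, Ne.symm hrl, h.isEdgeOf hp, h.isEdgeOf hpe, h.isEdgeOf hp'⟩, ?_,
            ⟨v, hv, hv'⟩, ?_⟩, hq⟩
        · exact (Observation.isNode_iff h.infinite).2 hpq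
        · refine bivalent_of_valent_of_valent_not (List.prefix_append _ _) ?_ hv hv'
          rw [List.append_assoc]
          exact List.prefix_append _ _
        · intro h0
          rw [edgeAction_eq_actionTag (A := A) (G := G) (N ++ q) (r, t)] at htag
          exact htag (by rw [h0]; exact List.mem_singleton_self _)
  -- By bivalence some path below `N` decides `!v₀`. After removing its `⊥`-edges, an `l`-edge at
  -- its end would be `v₀`-valent below a decision for `!v₀`.
  obtain ⟨_, ⟨hp, p, rfl⟩, hdec⟩ := hbiv (!v₀)
  rw [Observation.isNode_iff h.infinite, Observation.pathFrom_append, ← vtag_eq_endTag] at hp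
  obtain ⟨p', h1, h2, -, -, h5⟩ :=
    exists_path_without_bot (A := A) (c := A.config G N) (fun _ _ hu => hu) p hp.2
  have hp' : G.PathFrom none (N ++ p') := by
    rw [Observation.pathFrom_append, ← vtag_eq_endTag]
    exact ⟨hp.1, h1⟩
  have hdec' : A.HasDecision G (N ++ p') (!v₀) := by
    obtain ⟨i, hi⟩ := hdec
    refine ⟨i, ?_⟩
    rw [pathActions_append, List.mem_append] at hi ⊢
    exact hi.imp id (h5 _).2
  obtain ⟨w, hw⟩ := G.exists_edgeOut (Node.vtag (N ++ p')) l
  have hpw : G.PathFrom none (N ++ p' ++ [(l, w)]) :=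
    Observation.pathFrom_append_singleton.2 ⟨hp', hw⟩
  obtain ⟨v, hv⟩ := hval p' w hpw
  obtain rfl := hall p' (nonBot_append.2 ⟨hnb, h2⟩) w v hpw hv
  refine h.not_reaches_of_hasDecision (hdec'.mono (List.prefix_append _ [(l, w)])) ?_
  rw [Bool.not_not]
  exact hv.1

end Algorithm
end CHT

namespace CHT

variable {n : ℕ} {M O X : Type u} {D : Problem (Act n M O X)}

/-! ### Convergence -/

namespace Observation

variable {G : Observation D} {Gs : ℕ → Observation D}

theorem ConvergesTo.isPrefix_of_le (h : ConvergesTo Gs G) {x y : ℕ} (hxy : x ≤ y) :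
    (Gs x).IsPrefix (Gs y) := by
  induction y, hxy using Nat.le_induction with
  | base => exact ⟨subset_rfl, fun _ _ h => h, fun _ _ _ => Iff.rfl⟩
  | succ y _ ih =>
    obtain ⟨h1, h2, h3⟩ := h.2.1 y
    exact ⟨ih.1.trans h1, fun u v huv => h2 u v (ih.2.1 u v huv),
      fun v hv u => (ih.2.2 v hv u).trans (h3 v (ih.1 hv) u)⟩

/-- Incoming edges of a vertex never change after the vertex has appeared, so those in the limit are
already present. -/
theorem ConvergesTo.isPrefix (h : ConvergesTo Gs G) (x : ℕ) : (Gs x).IsPrefix G := by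
  refine ⟨?_, fun u v huv => (h.2.2.2 u v).2 ⟨x, huv⟩, fun v hv u =>
    ⟨fun huv => (h.2.2.2 u v).2 ⟨x, huv⟩, fun huv => ?_⟩⟩
  · rw [h.2.2.1]
    exact Set.subset_iUnion (fun x => (Gs x).V) x
  · obtain ⟨y, hy⟩ := (h.2.2.2 u v).1 huv
    rcases le_total x y with hxy | hxy
    · exact ((h.isPrefix_of_le hxy).2.2 v hv u).2 hy
    · exact (h.isPrefix_of_le hxy).2.1 u v hy

theorem IsPrefix.follows {H : Observation D} (h : H.IsPrefix G) (v : VTag n M O X)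
    (u : Vertex n M O X) (hu : H.Follows v u) : G.Follows v u := by
  cases v with
  | none => exact h.1 hu
  | some w => exact h.2.1 w u hu

theorem ConvergesTo.eventually_mem (h : ConvergesTo Gs G) {v : Vertex n M O X} (hv : v ∈ G.V) :
    ∀ᶠ x in Filter.atTop, v ∈ (Gs x).V := by
  rw [h.2.2.1, Set.mem_iUnion] at hv
  obtain ⟨x, hx⟩ := hv
  exact Filter.eventually_atTop.2 ⟨x, fun y hy => (h.isPrefix_of_le hy).1 hx⟩

/-- It suffices that `u` has appeared, since it appears together with all its incoming edges. -/
theorem ConvergesTo.eventually_follows (h : ConvergesTo Gs G) (v : VTag n M O X)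
    (u : Vertex n M O X) :
    ∀ᶠ x in Filter.atTop, (Gs x).Follows v u ↔ G.Follows v u := by
  by_cases hu : G.Follows v u
  · filter_upwards [h.eventually_mem hu.mem] with x hx
    refine ⟨(h.isPrefix x).follows v u, fun _ => ?_⟩
    cases v with
    | none => exact hx
    | some w => exact ((h.isPrefix x).2.2 u hx w).2 hu
  · exact Filter.Eventually.of_forall fun x =>
      ⟨(h.isPrefix x).follows v u, fun h' => absurd h' hu⟩

theorem ConvergesTo.eventually_active (h : ConvergesTo Gs G) (v : VTag n M O X) (i : Fin n) :
    ∀ᶠ x in Filter.atTop, (Gs x).Active v i ↔ G.Active v i := by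
  have hle : ∀ x, (Gs x).Active v i → G.Active v i := fun x ⟨u, hu, hi⟩ =>
    ⟨u, (h.isPrefix x).follows v u hu, hi⟩
  by_cases ha : G.Active v i
  · obtain ⟨u, hu, hi⟩ := ha
    filter_upwards [h.eventually_follows v u] with x hx
    exact ⟨hle x, fun _ => ⟨u, hx.2 hu, hi⟩⟩
  · exact Filter.Eventually.of_forall fun x => ⟨hle x, fun h' => absurd h' ha⟩

theorem ConvergesTo.eventually_edgeOut (h : ConvergesTo Gs G) (v : VTag n M O X) (l : Label n)
    (w : VTag n M O X) :
    ∀ᶠ x in Filter.atTop, (Gs x).EdgeOut v l w ↔ G.EdgeOut v l w := by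
  cases l with
  | fd i =>
    cases w with
    | none =>
      filter_upwards [h.eventually_active v i] with x hx
      simp [EdgeOut, hx]
    | some u =>
      filter_upwards [h.eventually_active v i, h.eventually_follows v u] with x hx hx'
      have : ∀ H : Observation D, H.EdgeOut v (.fd i) (some u) ↔
          (H.Follows v u ∧ u.loc = i) ∨ (¬ H.Active v i ∧ some u = v) := by
        intro H
        refine or_congr ⟨?_, fun ⟨h1, h2⟩ => ⟨u, h1, h2, rfl⟩⟩ Iff.rfl
        rintro ⟨u', h1, h2, h3⟩
        cases h3
        exact ⟨h1, h2⟩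
      rw [this, this, hx, hx']
  | proc i => exact Filter.Eventually.of_forall fun x => Iff.rfl
  | env i b => exact Filter.Eventually.of_forall fun x => Iff.rfl
  | chan i j hij => exact Filter.Eventually.of_forall fun x => Iff.rfl

theorem ConvergesTo.eventually_pathFrom (h : ConvergesTo Gs G) (v : VTag n M O X)
    (p : Node n M O X) :
    ∀ᶠ x in Filter.atTop, (Gs x).PathFrom v p ↔ G.PathFrom v p := by
  induction p generalizing v with
  | nil => exact Filter.Eventually.of_forall fun x => Iff.rfl
  | cons e p ih =>
    obtain ⟨l, w⟩ := e
    filter_upwards [h.eventually_edgeOut v l w, ih w] with x h1 h2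
    exact and_congr h1 h2

theorem ConvergesTo.eventually_le_encard (h : ConvergesTo Gs G) (hV : G.V.Infinite) (L : ℕ) :
    ∀ᶠ x in Filter.atTop, (L : ℕ∞) ≤ (Gs x).V.encard := by
  obtain ⟨t, ht, rfl⟩ := hV.exists_subset_card_eq L
  have : ∀ᶠ x in Filter.atTop, ∀ v ∈ t, v ∈ (Gs x).V :=
    (Filter.eventually_all_finset t).2 fun v hv => h.eventually_mem (ht hv)
  filter_upwards [this] with x hx
  rw [← Set.encard_coe_eq_coe_finsetCard]
  exact Set.encard_le_encard hx

theorem ConvergesTo.eventually_isNode (h : ConvergesTo Gs G) (hV : G.V.Infinite)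
    (N : Node n M O X) : ∀ᶠ x in Filter.atTop, (Gs x).IsNode N ↔ G.IsNode N := by
  filter_upwards [h.eventually_pathFrom none N, h.eventually_le_encard hV N.length] with x h1 h2
  rw [isNode_iff hV, IsNode, h1]
  exact and_iff_left h2

end Observation

namespace Algorithm

open Observation

variable {A : Algorithm D} {G : Observation D} {Gs : ℕ → Observation D}

theorem eventually_edgeAction (h : ConvergesTo Gs G) (v : VTag n M O X) (l : Label n)
    (w : VTag n M O X) :
    ∀ᶠ x in Filter.atTop, ∀ c, A.edgeAction (Gs x) c v l w = A.edgeAction G c v l w := by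
  cases l with
  | fd i => exact Filter.Eventually.of_forall fun x c => rfl
  | proc i =>
    filter_upwards [h.eventually_active v i] with x hx c
    classical exact if_congr hx rfl rfl
  | env i b =>
    filter_upwards [h.eventually_active v i] with x hx c
    classical exact if_congr hx rfl rfl
  | chan i j hij => exact Filter.Eventually.of_forall fun x c => rfl

theorem eventually_actionsFrom (h : ConvergesTo Gs G) (v : VTag n M O X) (p : Node n M O X) :
    ∀ᶠ x in Filter.atTop, ∀ c, A.actionsFrom (Gs x) c v p = A.actionsFrom G c v p ∧
      A.configFrom (Gs x) c v p = A.configFrom G c v p := by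
  induction p generalizing v with
  | nil => exact Filter.Eventually.of_forall fun x c => ⟨rfl, rfl⟩
  | cons e p ih =>
    obtain ⟨l, w⟩ := e
    filter_upwards [eventually_edgeAction (A := A) h v l w, ih w] with x h1 h2 c
    simp only [actionsFrom, configFrom, h1, h2, and_self]

/-- The observation `H` agrees with `G` about the node `N`. -/
structure Agrees (A : Algorithm D) (H G : Observation D) (N : Node n M O X) : Prop where
  isNode : H.IsNode N ↔ G.IsNode N
  pathActions : A.pathActions H N = A.pathActions G N
  reaches : ∀ v, A.Reaches H N v ↔ A.Reaches G N v

theorem eventually_agrees (h : ConvergesTo Gs G) (hV : G.V.Infinite) (N : Node n M O X) :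
    ∀ᶠ x in Filter.atTop, A.Agrees (Gs x) G N := by
  -- A reachable decision is witnessed by one finite path, which is eventually present with the same
  -- action tags.
  have hreach : ∀ v, ∀ᶠ x in Filter.atTop, A.Reaches G N v → A.Reaches (Gs x) N v := by
    intro v
    by_cases hv : A.Reaches G N v
    · obtain ⟨N', ⟨h1, h2⟩, h3⟩ := hv
      filter_upwards [h.eventually_isNode hV N', eventually_actionsFrom (A := A) h none N']
        with x hx hx' _
      refine ⟨N', ⟨hx.2 h1, h2⟩, ?_⟩
      obtain ⟨i, hi⟩ := h3
      refine ⟨i, ?_⟩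
      rw [Algorithm.pathActions, (hx' _).1]
      exact hi
    · exact Filter.Eventually.of_forall fun x h => absurd h hv
  filter_upwards [h.eventually_isNode hV N, eventually_actionsFrom (A := A) h none N,
    hreach true, hreach false, h.eventually_pathFrom none N] with x h1 h2 h3 h4 h5
  refine ⟨h1, (h2 _).1, fun v => ⟨?_, by cases v <;> assumption⟩⟩
  -- Here the witness in the finite tree may depend on `x` and may contain `⊥`-edges due only to the
  -- finiteness of `Gs x`. Deleting its `⊥`-edges gives a path of `G` with the same actions, so no
  -- further condition on `x` is needed.
  rintro ⟨_, ⟨hN, p, rfl⟩, i, hi⟩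
  have hp := pathFrom_append.1 hN.1
  obtain ⟨p', hp', -, -, -, ha⟩ := exists_path_without_bot (A := A) (c := A.config G N)
    (fun v u => (h.isPrefix x).follows v u) p hp.2
  refine ⟨N ++ p', ⟨?_, List.prefix_append _ _⟩, i, ?_⟩
  · rw [isNode_iff hV, pathFrom_append]
    exact ⟨h5.1 hp.1, hp'⟩
  · rw [pathActions_append, List.mem_append] at hi ⊢
    rw [vtag_eq_endTag] at hi ⊢
    have hc : A.config (Gs x) N = A.config G N := (h2 _).2
    rw [hc] at hi
    have hpa : A.pathActions (Gs x) N = A.pathActions G N := (h2 _).1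
    rw [hpa] at hi
    exact hi.imp id (ha _).2

end Algorithm

/-! ### Nodes with small metric values -/

/-- The first component of the metric value of a node. -/
def Node.weight (N : Node n M O X) : ℕ := N.length + VTag.index (Node.vtag N)

theorem weight_le_of_metric_lt {N N' : Node n M O X} (h : Node.metric N' < Node.metric N) :
    Node.weight N' ≤ Node.weight N := by
  rw [Node.metric, Node.metric, Prod.Lex.toLex_lt_toLex] at h
  rcases h with h | ⟨h, -⟩
  · exact h.le
  · exact h.le

theorem metric_lt_of_weight_lt {N N' : Node n M O X} (h : Node.weight N' < Node.weight N) :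
    Node.metric N' < Node.metric N := by
  rw [Node.metric, Node.metric, Prod.Lex.toLex_lt_toLex]
  exact Or.inl h

namespace Observation

variable {G H : Observation D}

theorem PathFrom.tagLE {v : VTag n M O X} {p : Node n M O X} (h : G.PathFrom v p) :
    G.TagLE v (endTag v p) := by
  induction p generalizing v with
  | nil => exact TagLE.refl G v
  | cons e p ih =>
    obtain ⟨l, w⟩ := e
    exact h.1.tagLE.trans (ih h.2)

theorem PathFrom.tagLE_of_mem {v : VTag n M O X} {p : Node n M O X} (h : G.PathFrom v p)
    {e : Label n × VTag n M O X} (he : e ∈ p) : G.TagLE v e.2 ∧ G.TagLE e.2 (endTag v p) := by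
  induction p generalizing v with
  | nil => cases he
  | cons e' p ih =>
    obtain ⟨l, w⟩ := e'
    rcases List.mem_cons.1 he with rfl | he
    · exact ⟨h.1.tagLE, h.2.tagLE⟩
    · exact ⟨h.1.tagLE.trans (ih h.2 he).1, (ih h.2 he).2⟩

/-- The vertex tags that can occur on the path to a node of weight at most `K`. -/
def smallTags (G : Observation D) (K : ℕ) : Set (VTag n M O X) :=
  insert none (some '' ⋃ w ∈ {w | w ∈ G.V ∧ w.idx ≤ K}, insert w {u | G.E u w})

/-- There are finitely many pairs of a location and an index at most `K`, each determines at most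
one vertex, and each vertex has finitely many predecessors. -/
theorem finite_smallTags (hfin : ∀ w, {u | G.E u w}.Finite) (K : ℕ) :
    (G.smallTags K).Finite := by
  refine (Set.Finite.image _ (Set.Finite.biUnion ?_ fun w _ => (hfin w).insert w)).insert _
  refine Set.Finite.of_finite_image (f := fun w : Vertex n M O X => (w.loc, w.idx))
    ((Set.finite_univ.prod (Set.finite_Iic K)).subset ?_) ?_
  · rintro _ ⟨w, hw, rfl⟩
    exact ⟨trivial, hw.2⟩
  · intro u hu v hv huv
    exact G.unique u hu.1 v hv.1 (congrArg Prod.fst huv) (congrArg Prod.snd huv)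

/-- A set of nodes that contains all nodes of weight at most `K`. -/
def smallNodes (G : Observation D) (K : ℕ) : Set (Node n M O X) :=
  {N | N.length ≤ K ∧ ∀ e ∈ N, e.2 ∈ G.smallTags K}

theorem finite_smallNodes (hfin : ∀ w, {u | G.E u w}.Finite) (K : ℕ) :
    (G.smallNodes K).Finite := by
  have hS : {e : Label n × VTag n M O X | e.2 ∈ G.smallTags K}.Finite := by
    have : {e : Label n × VTag n M O X | e.2 ∈ G.smallTags K} = Set.univ ×ˢ G.smallTags K := by
      ext e; simp
    rw [this]
    exact Set.finite_univ.prod (finite_smallTags hfin K)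
  have : Finite {e : Label n × VTag n M O X // e.2 ∈ G.smallTags K} := hS.to_subtype
  refine ((List.finite_length_le {e : Label n × VTag n M O X // e.2 ∈ G.smallTags K} K).image
    (List.map Subtype.val)).subset ?_
  rintro N ⟨h1, h2⟩
  lift N to List {e : Label n × VTag n M O X // e.2 ∈ G.smallTags K} using h2
  exact ⟨N, by simpa using h1, rfl⟩

theorem mem_smallNodes_of_prefix {K : ℕ} {N N' : Node n M O X} (h : N' <+: N)
    (hN : N ∈ G.smallNodes K) : N' ∈ G.smallNodes K :=
  ⟨h.length_le.trans hN.1, fun e he => hN.2 e (h.subset he)⟩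

/-- The weight bounds the depth and the index of the last tag. All earlier tags equal or precede the
last one. The ambient set depends on `G` only, so it serves all the observations that converge to
`G`. -/
theorem mem_smallNodes (hH : ∀ v u, H.Follows v u → G.Follows v u) {K : ℕ} {N : Node n M O X}
    (hN : H.IsNode N) (hw : Node.weight N ≤ K) : N ∈ G.smallNodes K := by
  refine ⟨le_trans (Nat.le_add_right _ _) hw, fun e he => ?_⟩
  obtain ⟨h1, h2⟩ := hN.1.tagLE_of_mem he
  rcases ht : e.2 with _ | u
  · exact Or.inl rfl
  · right
    refine ⟨u, ?_, rfl⟩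
    rw [ht] at h1 h2
    have hu : u ∈ G.V := by
      rcases h1 with h1 | ⟨u', h1, hu'⟩
      · cases h1
      · cases h1
        exact hH _ _ hu'
    have hidx : VTag.index (endTag none N) ≤ K := by
      rw [← vtag_eq_endTag]
      exact le_trans (Nat.le_add_left _ _) hw
    rcases h2 with h2 | ⟨u', h2, hu'⟩
    · rw [h2] at hidx
      exact Set.mem_biUnion (x := u) ⟨hu, hidx⟩ (Set.mem_insert _ _)
    · rw [h2] at hidx
      have hE := hH _ _ hu'
      exact Set.mem_biUnion (x := u') ⟨hE.mem, hidx⟩ (Or.inr hE)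

/-- Needed for `rank` to be a genuine count: `Set.ncard` of an infinite set is `0`. -/
theorem finite_metric_lt (hH : ∀ v u, H.Follows v u → G.Follows v u)
    (hfin : ∀ w, {u | G.E u w}.Finite) (N : Node n M O X) :
    {N' | H.IsNode N' ∧ Node.metric N' < Node.metric N}.Finite :=
  (finite_smallNodes hfin (Node.weight N)).subset fun _ h =>
    mem_smallNodes hH h.1 (weight_le_of_metric_lt h.2)

/-- Conversely to the finiteness above, a small rank forces a small weight: the tree contains a node
of each weight `0, …, L - 1`. -/
theorem le_rank (hn : 0 < n) (hH : ∀ v u, H.Follows v u → G.Follows v u)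
    (hfin : ∀ w, {u | G.E u w}.Finite) {N : Node n M O X} {L : ℕ} (hL : L ≤ Node.weight N)
    (hcard : (L : ℕ∞) ≤ H.V.encard) : L ≤ H.rank N := by
  -- These paths use only one process label, so they exist in every tree of sufficient height. They
  -- keep the null tag and thus have weight equal to their depth.
  let F : ℕ → Node n M O X := fun j => List.replicate j (Label.proc ⟨0, hn⟩, none)
  have htag : ∀ j, Node.vtag (F j) = none := by
    intro j
    cases j with
    | zero => rfl
    | succ j => simp only [F, List.replicate_succ', vtag_append_singleton]
  have hpath : ∀ j, H.PathFrom none (F j) := by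
    intro j
    induction j with
    | zero => trivial
    | succ j ih => exact ⟨rfl, ih⟩
  have hinj : Function.Injective F := fun i j hij => by
    have := congrArg List.length hij
    simpa [F] using this
  have hsub : F '' (Set.Iio L) ⊆ {N' | H.IsNode N' ∧ Node.metric N' < Node.metric N} := by
    rintro _ ⟨j, hj, rfl⟩
    have hj' : j < L := hj
    refine ⟨⟨hpath j, ?_⟩, metric_lt_of_weight_lt ?_⟩
    · refine le_trans ?_ hcard
      simp only [F, List.length_replicate]
      exact_mod_cast hj'.le
    · rw [Node.weight, htag]
      simp only [F, List.length_replicate, VTag.index]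
      omega
  have := Set.ncard_le_ncard hsub (finite_metric_lt hH hfin N)
  rw [Set.ncard_image_of_injective _ hinj, Set.ncard_Iio_nat] at this
  exact this

/-- Division by `n` recovers index and location, and within one observation these determine the
vertex. The null tag is the only one with value `0`. -/
theorem VTag.metric_inj {v w : VTag n M O X} (hv : ∀ u, v = some u → u ∈ G.V)
    (hw : ∀ u, w = some u → u ∈ G.V) (h : VTag.metric v = VTag.metric w) : v = w := by
  rcases v with _ | u <;> rcases w with _ | u'
  · rfl
  · simp only [VTag.metric] at h
    omega
  · simp only [VTag.metric] at h
    omega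
  · have h' : u.idx * n + u.loc = u'.idx * n + u'.loc := by
      simp only [VTag.metric] at h
      omega
    have hn : 0 < n := lt_of_le_of_lt (Nat.zero_le _) u.loc.2
    have h1 : u.idx = u'.idx := by
      have := congrArg (· / n) h'
      simpa [Nat.mul_add_div hn, Nat.mul_comm _ n, Nat.div_eq_of_lt u.loc.2,
        Nat.div_eq_of_lt u'.loc.2] using this
    rw [h1] at h'
    rw [G.unique u (hv u rfl) u' (hw u' rfl) (Fin.ext (by omega)) h1]

theorem metric_inj {N N' : Node n M O X} (hN : G.PathFrom none N) (hN' : G.PathFrom none N')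
    (h : Node.metric N = Node.metric N') : N = N' := by
  have htag : ∀ N, G.PathFrom none N → ∀ e ∈ N, ∀ u, e.2 = some u → u ∈ G.V := by
    intro N hN e he u hu
    rcases (hN.tagLE_of_mem he).1 with h | ⟨u', h, hu'⟩
    · rw [hu] at h; cases h
    · rw [hu] at h; cases h; exact hu'
  have hmap : N.map edgeMetric = N'.map edgeMetric := congrArg (fun p => (ofLex p).2) h
  have key : ∀ L L' : Node n M O X, (∀ e ∈ L, ∀ u, e.2 = some u → u ∈ G.V) →
      (∀ e ∈ L', ∀ u, e.2 = some u → u ∈ G.V) → L.map edgeMetric = L'.map edgeMetric → L = L' := by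
    intro L
    induction L with
    | nil =>
      intro L' _ _ h
      exact (List.map_eq_nil_iff.1 h.symm).symm
    | cons e L ih =>
      intro L' hL hL' h
      cases L' with
      | nil => cases h
      | cons e' L' =>
        rw [List.map_cons, List.map_cons, List.cons.injEq] at h
        have h1 := congrArg (fun p => (ofLex p).1) h.1
        have h2 := congrArg (fun p => (ofLex p).2) h.1
        have he : e = e' := Prod.ext (Label.metric_injective h2)
          (VTag.metric_inj (G := G) (hL e List.mem_cons_self) (hL' e' List.mem_cons_self) h1)
        rw [he, ih L' (fun e he => hL e (List.mem_cons_of_mem _ he))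
          (fun e he => hL' e (List.mem_cons_of_mem _ he)) h.2]
  exact key N N' (htag N hN) (htag N' hN') hmap

/-- Rank is strictly increasing in the metric value, since the smaller node itself is counted for
the larger one and the counts are finite. -/
theorem rank_inj (hfin : ∀ w, {u | G.E u w}.Finite) {N N' : Node n M O X} (hN : G.IsNode N)
    (hN' : G.IsNode N') (h : G.rank N = G.rank N') : N = N' := by
  have key : ∀ {N N'}, G.IsNode N → Node.metric N < Node.metric N' → G.rank N < G.rank N' := by
    intro N N' hN hlt
    refine Set.ncard_lt_ncard ⟨fun L hL => ⟨hL.1, hL.2.trans hlt⟩, fun hss => ?_⟩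
      (finite_metric_lt (fun _ _ h => h) hfin N')
    exact lt_irrefl _ (hss ⟨hN, hlt⟩ : N ∈ {L | G.IsNode L ∧ Node.metric L < Node.metric N}).2
  rcases lt_trichotomy (Node.metric N) (Node.metric N') with hlt | heq | hlt
  · exact absurd h (key hN hlt).ne
  · exact metric_inj hN.1 hN'.1 heq
  · exact absurd h (key hN' hlt).ne'

end Observation

/-! ### The Cantor pairing function -/

theorem le_cantorPair (a b : ℕ) : a ≤ cantorPair a b ∧ b ≤ cantorPair a b := by
  unfold cantorPair
  refine ⟨?_, Nat.le_add_left _ _⟩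
  rcases Nat.eq_zero_or_pos (a + b) with h | h
  · omega
  · have : a + b ≤ (a + b) * (a + b + 1) / 2 := by
      rw [Nat.le_div_iff_mul_le two_pos]
      exact Nat.mul_le_mul_left _ (by omega)
    omega

/-- The values with `a + b = s` fill the interval from the `s`-th triangular number to just before
the next one. -/
theorem cantorPair_inj {a b c d : ℕ} (h : cantorPair a b = cantorPair c d) : a = c ∧ b = d := by
  have hT : ∀ s, (s + 1) * (s + 1 + 1) / 2 = s * (s + 1) / 2 + (s + 1) := by
    intro s
    have : (s + 1) * (s + 1 + 1) = s * (s + 1) + (s + 1) * 2 := by ring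
    rw [this, Nat.add_mul_div_right _ _ two_pos]
  have hmono : Monotone fun s => s * (s + 1) / 2 := monotone_nat_of_le_succ fun s => by
    rw [hT]; omega
  have key : ∀ {a b c d : ℕ}, a + b < c + d → cantorPair a b < cantorPair c d := by
    intro a b c d hlt
    have h1 := hmono (Nat.succ_le_of_lt hlt)
    simp only [Nat.succ_eq_add_one] at h1
    rw [hT] at h1
    unfold cantorPair
    omega
  have hs : a + b = c + d := by
    rcases lt_trichotomy (a + b) (c + d) with hlt | heq | hlt
    · exact absurd h (key hlt).ne
    · exact heq
    · exact absurd h (key hlt).ne'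
  unfold cantorPair at h
  rw [hs] at h
  omega

theorem Edge.target_injective : Function.Injective (Edge.target (n := n) (M := M) (O := O)
    (X := X)) := by
  rintro ⟨s, l, t⟩ ⟨s', l', t'⟩ h
  obtain ⟨h1, h2⟩ := List.append_inj' h rfl
  simp only [List.cons.injEq, Prod.mk.injEq, and_true] at h2
  simp only at h1
  rw [h1, h2.1, h2.2]

/-- The metric value determines the three nodes, and these determine the gadget. The minimum is
therefore strict. -/
theorem Observation.gadgetMetric_inj {G : Observation D} (hfin : ∀ w, {u | G.E u w}.Finite)
    {Y Y' : Gadget n M O X} (hY : G.IsGadget Y) (hY' : G.IsGadget Y')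
    (h : G.gadgetMetric Y = G.gadgetMetric Y') : Y = Y' := by
  have hr : ∀ {N N' : Node n M O X}, G.IsNode N → G.IsNode N' → G.rank N = G.rank N' → N = N' :=
    fun h1 h2 h3 => rank_inj hfin h1 h2 h3
  have hlen : ∀ e : Edge n M O X, e.target.length = e.src.length + 1 := fun e => by
    simp [Edge.target]
  cases Y with
  | four N l e e' =>
    obtain ⟨hN, ⟨h1, h2, h3⟩, ⟨h1', h2', h3'⟩⟩ := hY
    cases Y' with
    | four P m d d' =>
      obtain ⟨hP, ⟨k1, k2, k3⟩, ⟨k1', k2', k3'⟩⟩ := hY'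
      obtain ⟨ha, hb⟩ := cantorPair_inj h
      obtain ⟨hb, hc⟩ := cantorPair_inj hb
      obtain rfl := hr hN hP ha
      obtain rfl := Edge.target_injective (hr h3 k3 hb)
      obtain rfl := Edge.target_injective (hr h3' k3' hc)
      rw [← h2, ← k2]
    | six P m r el er erl =>
      obtain ⟨hP, -, ⟨k1, k2, k3⟩, ⟨k1', k2', k3'⟩, ⟨k1'', k2'', k3''⟩⟩ := hY'
      obtain ⟨ha, hb⟩ := cantorPair_inj h
      obtain ⟨hb, hc⟩ := cantorPair_inj hb
      obtain rfl := hr hN hP ha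
      -- The third node lies one level below `N` for a fork-shaped tuple and two levels below for a
      -- hook-shaped one.
      have := congrArg List.length (hr h3' k3'' hc)
      rw [hlen, hlen, h1', k1'', hlen, k1'] at this
      omega
  | six N l r el er erl =>
    obtain ⟨hN, -, ⟨h1, h2, h3⟩, ⟨h1', h2', h3'⟩, ⟨h1'', h2'', h3''⟩⟩ := hY
    cases Y' with
    | four P m d d' =>
      obtain ⟨hP, ⟨k1, k2, k3⟩, ⟨k1', k2', k3'⟩⟩ := hY'
      obtain ⟨ha, hb⟩ := cantorPair_inj h
      obtain ⟨hb, hc⟩ := cantorPair_inj hb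
      obtain rfl := hr hN hP ha
      have := congrArg List.length (hr h3'' k3' hc)
      rw [hlen, hlen, h1'', k1', hlen, h1'] at this
      omega
    | six P m s dl dr drl =>
      obtain ⟨hP, -, ⟨k1, k2, k3⟩, ⟨k1', k2', k3'⟩, ⟨k1'', k2'', k3''⟩⟩ := hY'
      obtain ⟨ha, hb⟩ := cantorPair_inj h
      obtain ⟨hb, hc⟩ := cantorPair_inj hb
      obtain rfl := hr hN hP ha
      obtain rfl := Edge.target_injective (hr h3 k3 hb)
      obtain rfl := Edge.target_injective (hr h3'' k3'' hc)
      -- The edge `er` does not enter the metric, but its lower endpoint is the source of `erl`.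
      obtain rfl := Edge.target_injective (h1''.symm.trans k1'')
      rw [← h2, ← k2, ← h2', ← k2']

end CHT

/-! ### Gadgets in converging observations and the main theorem -/

namespace CHT

variable {n : ℕ} {M O X : Type u} {D : Problem (Act n M O X)}

/-- The nodes that occur in a gadget. -/
def Gadget.nodes : Gadget n M O X → Set (Node n M O X)
  | .four N _ e e' => {N, e.target, e'.target}
  | .six N _ _ el er erl => {N, el.target, er.target, erl.target}

namespace Algorithm

open Observation

variable {A : Algorithm D} {G H : Observation D}

theorem Agrees.bivalent {N : Node n M O X} (h : A.Agrees H G N) :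
    A.Bivalent H N ↔ A.Bivalent G N := forall_congr' h.reaches

theorem Agrees.valent {N : Node n M O X} (h : A.Agrees H G N) (v : Bool) :
    A.Valent H v N ↔ A.Valent G v N := by
  rw [valent_iff, valent_iff, h.reaches, h.reaches]

theorem Agrees.isEdgeOf {e : Edge n M O X} (h : A.Agrees H G e.target) (N : Node n M O X)
    (l : Label n) : H.IsEdgeOf e N l ↔ G.IsEdgeOf e N l :=
  and_congr Iff.rfl (and_congr Iff.rfl h.isNode)

theorem pathActions_target (e : Edge n M O X) :
    A.pathActions G e.target = A.pathActions G e.src ++ [A.actionTag G e] := by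
  rw [Edge.target, pathActions_append]
  rfl

theorem Agrees.actionTag {e : Edge n M O X} (h : A.Agrees H G e.target)
    (h' : A.Agrees H G e.src) : A.actionTag H e = A.actionTag G e := by
  have := h.pathActions
  rw [pathActions_target, pathActions_target, h'.pathActions] at this
  exact List.singleton_inj.1 (List.append_cancel_left this)

theorem isNonBotDecisionGadget_congr {Y : Gadget n M O X} (h : ∀ N ∈ Y.nodes, A.Agrees H G N) :
    A.IsNonBotDecisionGadget H Y ↔ A.IsNonBotDecisionGadget G Y := by
  cases Y with
  | four N l e e' =>
    have hN := h N (Or.inl rfl)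
    have he := h e.target (Or.inr (Or.inl rfl))
    have he' := h e'.target (Or.inr (Or.inr rfl))
    simp only [IsNonBotDecisionGadget, IsDecisionGadget, IsGadget, NonBot, Gadget.node,
      hN.isNode, he.isEdgeOf, he'.isEdgeOf, hN.bivalent, he.valent, he'.valent, hN.pathActions]
  | six N l r el er erl =>
    have hN := h N (Or.inl rfl)
    have hl := h el.target (Or.inr (Or.inl rfl))
    have hr := h er.target (Or.inr (Or.inr (Or.inl rfl)))
    have hrl := h erl.target (Or.inr (Or.inr (Or.inr rfl)))
    -- The action tag of `er` is the last entry of the path actions of its target. Agreement about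
    -- it needs agreement about its source, which is known only for `N`; in any other case the tuple
    -- is a gadget of neither tree.
    by_cases hsrc : er.src = N
    · have hact : A.actionTag H er = A.actionTag G er := hr.actionTag (hsrc ▸ hN)
      simp only [IsNonBotDecisionGadget, IsDecisionGadget, IsGadget, NonBot, Gadget.node,
        hN.isNode, hl.isEdgeOf, hr.isEdgeOf, hrl.isEdgeOf, hN.bivalent, hl.valent, hrl.valent,
        hN.pathActions, hact]
    · exact ⟨fun h => absurd h.1.1.2.2.2.1.1 hsrc, fun h => absurd h.1.1.2.2.2.1.1 hsrc⟩

end Algorithm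

namespace Observation

variable {G H : Observation D}

/-- A gadget with a small metric value consists of small nodes. -/
theorem gadget_small (hn : 0 < n) (hH : ∀ v u, H.Follows v u → G.Follows v u)
    (hfin : ∀ w, {u | G.E u w}.Finite) {K : ℕ} (hcard : ((K + 1 : ℕ) : ℕ∞) ≤ H.V.encard)
    {Y : Gadget n M O X} (hY : H.IsGadget Y) (hK : H.gadgetMetric Y ≤ K) :
    (∀ N ∈ Y.nodes, N ∈ G.smallNodes K) ∧ ∀ H' : Observation D,
      (∀ N, Node.weight N ≤ K → H'.rank N = H.rank N) → H'.gadgetMetric Y = H.gadgetMetric Y := by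
  -- A weight of at least `K + 1` would force a rank of at least `K + 1`, which is why the tree must
  -- have height `K + 1`.
  have hw : ∀ {N}, H.rank N ≤ K → Node.weight N ≤ K := by
    intro N hN
    by_contra! hlt
    have := le_rank hn hH hfin (L := K + 1) hlt hcard
    omega
  cases Y with
  | four N l e e' =>
    obtain ⟨hN, he, he'⟩ := hY
    change cantorPair _ (cantorPair _ _) ≤ K at hK
    obtain ⟨h1, h2⟩ := le_cantorPair (H.rank N) (cantorPair (H.rank e.target) (H.rank e'.target))
    obtain ⟨h3, h4⟩ := le_cantorPair (H.rank e.target) (H.rank e'.target)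
    have hN' := hw (h1.trans hK)
    have ht := hw (h3.trans (h2.trans hK))
    have ht' := hw (h4.trans (h2.trans hK))
    refine ⟨?_, ?_⟩
    · rintro N' (rfl | rfl | rfl)
      · exact mem_smallNodes hH hN hN'
      · exact mem_smallNodes hH he.2.2 ht
      · exact mem_smallNodes hH he'.2.2 ht'
    · intro H' hrank
      simp only [gadgetMetric, hrank _ hN', hrank _ ht, hrank _ ht']
  | six N l r el er erl =>
    obtain ⟨hN, -, hl, -, hrl⟩ := hY
    change cantorPair _ (cantorPair _ _) ≤ K at hK
    obtain ⟨h1, h2⟩ := le_cantorPair (H.rank N)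
      (cantorPair (H.rank el.target) (H.rank erl.target))
    obtain ⟨h3, h4⟩ := le_cantorPair (H.rank el.target) (H.rank erl.target)
    have hN' := hw (h1.trans hK)
    have ht := hw (h3.trans (h2.trans hK))
    have ht' := hw (h4.trans (h2.trans hK))
    have hmem := mem_smallNodes hH hrl.2.2 ht'
    refine ⟨?_, ?_⟩
    · rintro N' (rfl | rfl | rfl | rfl)
      · exact mem_smallNodes hH hN hN'
      · exact mem_smallNodes hH hl.2.2 ht
      · refine mem_smallNodes_of_prefix ?_ hmem
        rw [← hrl.1]
        exact List.prefix_append _ _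
      · exact hmem
    · intro H' hrank
      simp only [gadgetMetric, hrank _ hN', hrank _ ht, hrank _ ht']

/-- All nodes counted in the rank of a node of weight at most `K` are themselves small, so agreement
on the finite set `G.smallNodes K` fixes the rank. -/
theorem rank_eq_of_forall_isNode_iff (hH : ∀ v u, H.Follows v u → G.Follows v u) {K : ℕ}
    (h : ∀ N ∈ G.smallNodes K, H.IsNode N ↔ G.IsNode N) {N : Node n M O X}
    (hN : Node.weight N ≤ K) : H.rank N = G.rank N := by
  have hw : ∀ N', Node.metric N' < Node.metric N → Node.weight N' ≤ K := fun N' hlt =>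
    (weight_le_of_metric_lt hlt).trans hN
  unfold rank
  congr 1
  ext N'
  constructor
  · rintro ⟨h1, h2⟩
    exact ⟨(h N' (mem_smallNodes hH h1 (hw N' h2))).1 h1, h2⟩
  · rintro ⟨h1, h2⟩
    exact ⟨(h N' (mem_smallNodes (fun _ _ h => h) h1 (hw N' h2))).2 h1, h2⟩

end Observation

/-- In an infinite observation in which vertices have finitely many predecessors, the first
non-`⊥` decision gadget exists if there is a non-`⊥` decision gadget, and it is the limit of those
of the finite observations that converge to the observation. -/
theorem Algorithm.exists_isFirstNonBotDecisionGadget {A : Algorithm D} {G : Observation D}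
    (hn : 0 < n) (hV : G.V.Infinite) (hfin : ∀ w, {u | G.E u w}.Finite)
    (hex : ∃ Y, A.IsNonBotDecisionGadget G Y) :
    ∃ Y : Gadget n M O X, A.IsFirstNonBotDecisionGadget G Y ∧
      ∀ Gs : ℕ → Observation D, Observation.ConvergesTo Gs G →
        ∃ x, ∀ x' ≥ x, A.IsFirstNonBotDecisionGadget (Gs x') Y := by
  obtain ⟨Y, hY, hmin⟩ : ∃ Y, A.IsNonBotDecisionGadget G Y ∧
      ∀ Y', A.IsNonBotDecisionGadget G Y' → G.gadgetMetric Y ≤ G.gadgetMetric Y' := by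
    classical
    have h : ∃ m Y, A.IsNonBotDecisionGadget G Y ∧ G.gadgetMetric Y = m :=
      hex.elim fun Y hY => ⟨_, Y, hY, rfl⟩
    obtain ⟨Y, hY, hm⟩ := Nat.find_spec h
    exact ⟨Y, hY, fun Y' hY' => hm.trans_le (Nat.find_min' h ⟨Y', hY', rfl⟩)⟩
  have hfirst : ∀ Y', A.IsNonBotDecisionGadget G Y' → Y' ≠ Y →
      G.gadgetMetric Y < G.gadgetMetric Y' := fun Y' hY' hne =>
    lt_of_le_of_ne (hmin Y' hY') fun h =>
      hne (Observation.gadgetMetric_inj hfin hY.1.1 hY'.1.1 h).symm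
  refine ⟨Y, ⟨hY, hfirst⟩, fun Gs hGs => ?_⟩
  set K := G.gadgetMetric Y with hK
  have hagree : ∀ᶠ x in Filter.atTop, ∀ N ∈ G.smallNodes K, A.Agrees (Gs x) G N :=
    (Filter.eventually_all_finite (Observation.finite_smallNodes hfin K)).2 fun N _ =>
      eventually_agrees hGs hV N
  -- Two eventual conditions suffice: agreement on the finitely many small nodes, and at least `K +
  -- 1` vertices, so that small ranks force small weights in the finite tree too.
  rw [← Filter.eventually_atTop]
  filter_upwards [hagree, hGs.eventually_le_encard hV (K + 1)] with x hx hcard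
  have hsub := (hGs.isPrefix x).follows
  have hrank : ∀ N, Node.weight N ≤ K → (Gs x).rank N = G.rank N := fun N hN =>
    Observation.rank_eq_of_forall_isNode_iff hsub (fun N' hN' => (hx N' hN').isNode) hN
  have hYx : A.IsNonBotDecisionGadget (Gs x) Y ∧ (Gs x).gadgetMetric Y = K := by
    obtain ⟨h1, h2⟩ := Observation.gadget_small hn (fun _ _ h => h) hfin
      (by rw [hV.encard_eq]; exact le_top) hY.1.1 hK.ge
    exact ⟨(isNonBotDecisionGadget_congr fun N hN => hx N (h1 N hN)).2 hY, h2 _ hrank⟩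
  refine ⟨hYx.1, fun Y' hY' hne => ?_⟩
  rw [hYx.2]
  by_contra! hle
  -- A competitor of value at most `K` in the finite tree consists of small nodes. Hence it is a
  -- decision gadget of `G` with the same metric value, contrary to the strict minimality of `Y`
  -- there.
  obtain ⟨h1, h2⟩ := Observation.gadget_small hn hsub hfin hcard hY'.1.1 hle
  have hY'G := (isNonBotDecisionGadget_congr fun N hN => hx N (h1 N hN)).1 hY'
  have h3 := h2 G fun N hN => (hrank N hN).symm
  have := hfirst Y' hY'G hne
  omega

/-- If the algorithm solves consensus, the tree of a viable observation with enough live locations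
complies with its specification. -/
theorem Algorithm.complies_of_solvesConsensus {f : ℕ} (hf : f < n) (hD : D.IsStrongSamplingAFD)
    {C : Automaton (Act n M O X)} {hC : IsCrashAutomaton C} {A : Algorithm D}
    (hA : A.SolvesConsensus hC f) {G : Observation D} (hG : G.Viable)
    (hlive : {i | i ∉ G.live}.ncard ≤ f) : A.Complies G := by
  have hspec := fun b (hb : G.IsFairBranch b) => consensus_of_isFairBranch hf hD hA hG hlive hb
  refine ⟨by omega, ?_, fun b hb => (hspec b hb).1, fun b hb => (hspec b hb).2.1,
    fun b hb => (hspec b hb).2.2⟩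
  obtain ⟨i, hi⟩ := Observation.live_nonempty hf hlive
  exact Set.Infinite.mono (fun v hv => hv.1) hi

end CHT

theorem mainTheorem5 {n : ℕ} {M O X : Type u} (f : ℕ) (hf : f < n)
    (D : CHT.Problem (CHT.Act n M O X)) (hD : D.IsStrongSamplingAFD)
    (C : CHT.Automaton (CHT.Act n M O X)) (hC : CHT.IsCrashAutomaton C)
    (A : CHT.Algorithm D) (hA : A.SolvesConsensus hC f)
    (G : CHT.Observation D) (hG : G.Viable) (hlive : {i | i ∉ G.live}.ncard ≤ f) :
    ∃ Y : CHT.Gadget n M O X, A.IsFirstNonBotDecisionGadget G Y ∧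
      ∀ Gs : ℕ → CHT.Observation D, CHT.Observation.ConvergesTo Gs G →
        ∃ x, ∀ x' ≥ x, A.IsFirstNonBotDecisionGadget (Gs x') Y := by
  have h := CHT.Algorithm.complies_of_solvesConsensus hf hD hA hG hlive
  obtain ⟨t, -, ht⟩ := hG
  obtain ⟨pos, hpos⟩ := ht.exists_isPosition
  exact CHT.Algorithm.exists_isFirstNonBotDecisionGadget h.pos h.infinite
    hpos.finite_predecessors (h.exists_isNonBotDecisionGadget hD.toIsAFD)
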